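/- **Setting.** Let $d\ge 1$ and $\mathbb R_0=\mathbb R\setminus\{0\}$. Let $\nu$ be a measure on $\mathbb R_0$ with $m_2:=\int_{\mathbb R_0}|z|^2\,\nu(dz)<\infty$, put $\mathbf Z=\mathbb R^d\times\mathbb R_0$, $\mathfrak m=\mathrm{Leb}\times\nu$, let $N$ be a Poisson random measure on $\mathbf Z$ of intensity $\mathfrak m$ defined on a probability space $(\Omega,\mathcal F,\mathbb P)$, $\widehat N=N-\mathfrak m$, $\mathcal H^{\otimes n}=L^2(\mathbf Z^n,\mathfrak m^n)$, and let $I_n(f)$, $f\in\mathcal H^{\otimes n}$, be the multiple integral of order $n$ with respect to $\widehat N$. The Fourier transform is $\mathcal F\varphi(\xi)=\int e^{-i\xi\cdot x}\varphi(x)\,dx$. Write $\mathcal O_C'$ for the space of distributions of rapid decrease (those $T$ for which $(1+|x|^2)^{k/2}T$ is a bounded distribution for every $k\in\mathbb N$); the Fourier transform of such a $T$ is a smooth function of slow increase. A function is tempered if it is measurable and $(1+|x|^2)^{-k}$ times it is integrable for some $k$. Let $\kappa:\mathbb R^d\to[0,\infty]$ be a tempered function whose Fourier transform $h=\mathcal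 F\kappa$ is a tempered function such that $|h|^2$ is tempered and is the Fourier transform of a tempered function $f:\mathbb R^d\to[0,\infty]$. Put $\mu(d\xi)=(2\pi)^{-d}|h(\xi)|^2d\xi$ and $\kappa^{\otimes n}(x_1,\dots,x_n)=\prod_j\kappa(x_j)$. Let $(G_t)_{t>0}$ be a family of real tempered distributions on $\mathbb R^d$ (in the application, the fundamental solution of a second-order operator $\mathcal L$ with coefficients not depending on the space variable; $\mathcal L$ enters only through $G$). For $t\ge0$ let $T_n(t)=\{(t_1,\dots,t_n):0<t_1<\dots<t_n<t\}$. For $\mathbf t\in T_n(t)$, $x\in\mathbb R^d$ and with $t_{n+1}=t$, let $f_n(\mathbf t,\cdot;t,x)\in\mathcal S'(\mathbb R^{nd})$ be the distribution whose Fourier transform is $$e^{-i(\xi_1+\dots+\xi_n)\cdot x}\prod_{j=1}^n\overline{\mathcal FG_{t_{j+1}-t_j}(\xi_1+\dots+\xi_j)} .$$ Assume: * (A') $G_t\in\mathcal O_C'(\mathbb R^d)$ for all $t>0$, and $f_n(\mathbf t,\cdot;t,x)\in\mathcal O_C'(\mathbb R^{nd})$ for all $t\ge0$, $x\in\mathbb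 R^d$, $n\ge1$, $\mathbf t\in T_n(t)$. * (B') $K(t):=\sup_{\eta\in\mathbb R^d}\int|\mathcal FG_t(\xi+\eta)|^2\mu(d\xi)<\infty$ for all $t>0$. * (D') $(t,\xi)\mapsto\mathcal FG_t(\xi)$ is measurable on $(0,\infty)\times\mathbb R^d$ and $\int_0^TK(t)\,dt<\infty$ for all $T>0$. * (E') For all $t\ge0$, $x\in\mathbb R^d$, $n\ge1$ there is a measurable $g_n:T_n(t)\times\mathbb R^{nd}\to\mathbb R$ such that either $g_n(\mathbf t,\cdot)$ is a (locally integrable) function representing the distribution $f_n(\mathbf t,\cdot;t,x)*\kappa^{\otimes n}$ for every $\mathbf t\in T_n(t)$, or $g_n(\mathbf t,\cdot)=f_n(\mathbf t,\cdot;t,x)*\kappa^{\otimes n}$ in $L^2(\mathbb R^{nd})$ for almost every $\mathbf t\in T_n(t)$. We identify $f_n(\mathbf t,\cdot;t,x)*\kappa^{\otimes n}$ with any such $g_n(\mathbf t,\cdot)$. Define $$f_n^*(x_1,z_1,\dots,x_n,z_n,x;t)=\prod_{i=1}^nz_i\int_{T_n(t)}\big(f_n(\mathbf t,\cdot;t,x)*\kappa^{\otimes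 n}\big)(x_1,\dots,x_n)\,d\mathbf t,$$ $$J_n(t)=\int_{T_n(t)}\int_{(\mathbb R^d)^n}\prod_{j=1}^n|\mathcal FG_{t_{j+1}-t_j}(\xi_1+\dots+\xi_j)|^2\,\mu(d\xi_1)\cdots\mu(d\xi_n)\,d\mathbf t .$$ A (Skorohod) solution of $\mathcal Lu=u\dot X$ with initial condition $1$ is a process $\{u(t,x)\}_{t\ge0,x\in\mathbb R^d}$ with $\mathbb E|u(t,x)|^2<\infty$ such that for all $(t,x)$, $f_n^*(\cdot,x;t)\in\mathcal H^{\otimes n}$ for every $n\ge1$ and $$u(t,x)=1+\sum_{n\ge1}I_n\big(f_n^*(\cdot,x;t)\big)\quad\text{with convergence in }L^2(\Omega).$$ **Theorem.** For all $n\ge1$, $t\ge0$, $x\in\mathbb R^d$ (and any choice of $g_n$ as in (E')), the $d\mathbf t$-integral defining $f_n^*$ converges absolutely for almost every $(x_1,\dots,x_n)$, $f_n^*(\cdot,x;t)\in\mathcal H^{\otimes n}$, $J_n(t)<\infty$ and $$\|f_n^*(\cdot,x;t)\|_{\mathcal H^{\otimes n}}^2\le\frac{m_2^n\,t^n}{n!}\,J_n(t).$$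 If moreover $\sum_{n\ge1}m_2^n\,t^n\,J_n(t)<\infty$ for every $t>0$, then $\mathcal Lu=u\dot X$ with initial condition $1$ has a Skorohod solution $u$, and it is unique: any other Skorohod solution $u'$ satisfies $u'(t,x)=u(t,x)$ almost surely for all $t\ge0$, $x\in\mathbb R^d$. -/

import Mathlib

open MeasureTheory ProbabilityTheory Filter Topology
open scoped ENNReal NNReal SchwartzMap FourierTransform ComplexConjugate

noncomputable section

namespace LevySPDE

/-! ### The state spaces -/

/-- `ℝ^d` with the Euclidean norm. -/
abbrev Rd (d : ℕ) := EuclideanSpace ℝ (Fin d)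

/-- `ℝ^{nd}`, written as `n` blocks `x j : ℝ^d`, with the Euclidean norm and Lebesgue measure. -/
abbrev Rnd (n d : ℕ) := PiLp 2 fun _ : Fin n => Rd d

/-- `ℝ \ {0}`; its Borel sets are the Borel subsets of `ℝ` that do not contain `0`. -/
abbrev R0 := {z : ℝ // z ≠ 0}

/-- `𝐙 = ℝ^d × (ℝ \ {0})`. -/
abbrev ZSpace (d : ℕ) := Rd d × R0

/-- The intensity `𝔪 = Leb × ν` on `𝐙`. -/
def intensity (d : ℕ) (ν : Measure R0) : Measure (ZSpace d) :=
  (volume : Measure (Rd d)).prod ν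

/-- The product measure `𝔪^n` on `𝐙^n`, so that `ℋ^{⊗ n} = L²(𝐙^n, 𝔪^n)`. -/
def intensityPow (d : ℕ) (ν : Measure R0) (n : ℕ) : Measure (Fin n → ZSpace d) :=
  Measure.pi fun _ => intensity d ν

/-- The second moment `m₂ = ∫ |z|² ν(dz)`. -/
def secondMoment (ν : Measure R0) : ℝ≥0∞ := ∫⁻ z, ‖(z : ℝ)‖ₑ ^ 2 ∂ν

/-! ### Poisson random measures and multiple Poisson integrals -/

section Poisson

variable {Ω Z : Type*} [MeasurableSpace Ω] [MeasurableSpace Z]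

/-- `N` is a Poisson random measure of intensity `m`. -/
structure IsPoissonRandomMeasure (P : Measure Ω) (N : Ω → Measure Z) (m : Measure Z) : Prop where
  measurable_eval : ∀ A, MeasurableSet A → Measurable fun ω => N ω A
  law_eval : ∀ A, MeasurableSet A → m A ≠ ⊤ →
    P.map (fun ω => N ω A) = (poissonMeasure (m A).toNNReal).map (fun k : ℕ => (k : ℝ≥0∞))
  eval_eq_top : ∀ A, MeasurableSet A → m A = ⊤ → ∀ᵐ ω ∂P, N ω A = ⊤
  indep : ∀ (k : ℕ) (A : Fin k → Set Z), (∀ i, MeasurableSet (A i)) →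
    Pairwise (fun i j => Disjoint (A i) (A j)) → iIndepFun (fun i ω => N ω (A i)) P

/-- The compensated measure `N̂(A) = N(A) - m(A)`, for sets with `m A < ∞`. -/
def compensated (N : Ω → Measure Z) (m : Measure Z) (A : Set Z) (ω : Ω) : ℝ :=
  (N ω A).toReal - (m A).toReal

/-- Data of an elementary function of `n` variables vanishing on the diagonals: a finite linear
combination of indicators of rectangles `A₁ × ⋯ × A_n` with pairwise disjoint measurable sides
of finite measure. -/
structure OffDiagElementary (m : Measure Z) (n : ℕ) where
  card : ℕ
  coef : Fin card → ℝ
  side : Fin card → Fin n → Set Z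
  measurableSet_side : ∀ i j, MeasurableSet (side i j)
  measure_side_ne_top : ∀ i j, m (side i j) ≠ ⊤
  disjoint_side : ∀ i, Pairwise fun j k => Disjoint (side i j) (side i k)

/-- The function `∑ᵢ cᵢ 1_{A_{i1} × ⋯ × A_{in}}`. -/
def OffDiagElementary.toFun {m : Measure Z} {n : ℕ} (s : OffDiagElementary m n)
    (z : Fin n → Z) : ℝ :=
  ∑ i, s.coef i * (Set.univ.pi (s.side i)).indicator (fun _ => (1 : ℝ)) z

/-- The multiple integral `∑ᵢ cᵢ N̂(A_{i1}) ⋯ N̂(A_{in})` of an elementary function. -/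
def OffDiagElementary.integral {m : Measure Z} {n : ℕ} (s : OffDiagElementary m n)
    (N : Ω → Measure Z) (ω : Ω) : ℝ :=
  ∑ i, s.coef i * ∏ j, compensated N m (s.side i j) ω

/-- `Y = I_n(f)`: the multiple integral of `f ∈ L²(Z^n, m^n)` with respect to the compensated
Poisson random measure, as the `L²(Ω)`-limit of the integrals of elementary functions converging
to `f` in `L²(Z^n, m^n)`. -/
def IsMultipleIntegral (P : Measure Ω) (N : Ω → Measure Z) (m : Measure Z) (n : ℕ)
    (f : (Fin n → Z) → ℝ) (Y : Ω → ℝ) : Prop :=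
  MemLp f 2 (Measure.pi fun _ => m) ∧ MemLp Y 2 P ∧
  ∃ s : ℕ → OffDiagElementary m n,
    Tendsto (fun k => eLpNorm (fun z => f z - (s k).toFun z) 2 (Measure.pi fun _ => m))
      atTop (𝓝 0) ∧
    Tendsto (fun k => eLpNorm (fun ω => Y ω - (s k).integral N ω) 2 P) atTop (𝓝 0)

end Poisson

/-! ### Fourier transform, with the convention `𝓕 φ(ξ) = ∫ e^{-i ξ·x} φ(x) dx` -/

section Fourier

variable {V : Type*} [NormedAddCommGroup V] [InnerProductSpace ℝ V] [FiniteDimensional ℝ V]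
  [MeasurableSpace V] [BorelSpace V]

/-- The dilation `x ↦ 2π x`. -/
def dilation (V : Type*) [NormedAddCommGroup V] [InnerProductSpace ℝ V] : V ≃L[ℝ] V :=
  ContinuousLinearEquiv.smulLeft (Units.mk0 (2 * Real.pi) (by positivity))

/-- The Fourier transform `𝓕 φ(ξ) = ∫ e^{-i ξ·x} φ(x) dx` on Schwartz functions. -/
def fourierS : 𝓢(V, ℂ) →L[ℂ] 𝓢(V, ℂ) :=
  SchwartzMap.compCLMOfContinuousLinearEquiv ℂ (dilation V).symm ∘L
    FourierTransform.fourierCLM ℂ 𝓢(V, ℂ)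

/-- The inverse of `fourierS`. -/
def fourierSInv : 𝓢(V, ℂ) →L[ℂ] 𝓢(V, ℂ) :=
  FourierTransform.fourierInvCLM ℂ 𝓢(V, ℂ) ∘L
    SchwartzMap.compCLMOfContinuousLinearEquiv ℂ (dilation V)

theorem fourierS_apply (φ : 𝓢(V, ℂ)) (ξ : V) :
    fourierS φ ξ = ∫ x, Complex.exp (-(Complex.I * (inner ℝ ξ x : ℝ))) * φ x := by
  have h : (dilation V).symm ξ = (2 * Real.pi)⁻¹ • ξ := rfl
  have h2 : fourierS φ ξ = (𝓕 (φ : V → ℂ)) ((2 * Real.pi)⁻¹ • ξ) := by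
    rw [← h, ← SchwartzMap.fourier_coe]; rfl
  rw [h2, Real.fourier_eq']
  congr 1
  ext x
  rw [smul_eq_mul, inner_smul_right, real_inner_comm]
  congr 2
  push_cast
  have : (Real.pi : ℂ) ≠ 0 := by exact_mod_cast Real.pi_ne_zero
  field_simp

theorem fourierSInv_fourierS (φ : 𝓢(V, ℂ)) : fourierSInv (fourierS φ) = φ := by
  have h : SchwartzMap.compCLMOfContinuousLinearEquiv ℂ (dilation V) (fourierS φ) = 𝓕 φ := by
    ext x
    change (𝓕 φ) ((dilation V).symm (dilation V x)) = _
    simp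
  change 𝓕⁻ (SchwartzMap.compCLMOfContinuousLinearEquiv ℂ (dilation V) (fourierS φ)) = φ
  rw [h]
  simp

/-- The Fourier transform of the tempered distribution `T` is the function `g`, and `g` is a
smooth function of slow increase (`g ∈ 𝒪_M`). -/
def HasFourierFun (T : 𝓢'(V, ℂ)) (g : V → ℂ) : Prop :=
  g.HasTemperateGrowth ∧ ∀ φ : 𝓢(V, ℂ), T (fourierS φ) = ∫ ξ, g ξ * φ ξ

open Classical in
/-- The Fourier transform of a distribution of rapid decrease, as a function in `𝒪_M`.  (Such a
function is unique; it exists for every distribution of rapid decrease.) -/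
def fourierFun (T : 𝓢'(V, ℂ)) : V → ℂ :=
  if h : ∃ g, HasFourierFun T g then h.choose else fun _ => 0

theorem fourierFun_hasTemperateGrowth (T : 𝓢'(V, ℂ)) : (fourierFun T).HasTemperateGrowth := by
  unfold fourierFun
  split_ifs with h
  · exact h.choose_spec.1
  · exact .const 0

/-- The tempered distribution whose Fourier transform is the function `g ∈ 𝒪_M`. -/
def distOfFourier {g : V → ℂ} (hg : g.HasTemperateGrowth) : 𝓢'(V, ℂ) :=
  PointwiseConvergenceCLM.precomp ℂ fourierSInv
    (Function.HasTemperateGrowth.toTemperedDistribution volume hg)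

theorem hasFourierFun_distOfFourier {g : V → ℂ} (hg : g.HasTemperateGrowth) :
    HasFourierFun (distOfFourier hg) g := by
  refine ⟨hg, fun φ => ?_⟩
  have h : distOfFourier hg (fourierS φ) =
      Function.HasTemperateGrowth.toTemperedDistribution volume hg
        (fourierSInv (fourierS φ)) := rfl
  rw [h, fourierSInv_fourierS]
  change ∫ ξ, φ ξ • g ξ = _
  simp only [smul_eq_mul, mul_comm]

/-! ### Distributions of rapid decrease, convolution -/

/-- `T` is real-valued on real test functions. -/
def IsRealDist (T : 𝓢'(V, ℂ)) : Prop :=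
  ∀ φ : 𝓢(V, ℂ), (∀ x, (φ x).im = 0) → (T φ).im = 0

/-- `T` is a bounded distribution: it is continuous for the topology of `𝒟_{L¹}`, i.e. for the
seminorms `‖D^j φ‖_{L¹}`. -/
def IsBoundedDist (T : 𝓢'(V, ℂ)) : Prop :=
  ∃ (k : ℕ) (C : ℝ), ∀ φ : 𝓢(V, ℂ),
    ‖T φ‖ ≤ C * ∑ j ∈ Finset.range (k + 1), ∫ x, ‖iteratedFDeriv ℝ j φ x‖

/-- `T ∈ 𝒪_C'`: the distribution `(1 + |x|²)^{k/2} T` is bounded for every `k`. -/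
def IsRapidDecrease (T : 𝓢'(V, ℂ)) : Prop :=
  ∀ k : ℕ, IsBoundedDist
    (TemperedDistribution.smulLeftCLM ℂ
      (fun x : V => (((1 + ‖x‖ ^ 2) ^ ((k : ℝ) / 2) : ℝ) : ℂ)) T)

/-- The convolution `T * k` of a distribution `T ∈ 𝒪_C'` with a tempered function `k`, as a
functional on test functions: `φ ↦ ∫ k(y) ⟨T, φ(· + y)⟩ dy`. -/
def convDist (T : 𝓢'(V, ℂ)) (k : V → ℝ≥0∞) (φ : 𝓢(V, ℂ)) : ℂ :=
  ∫ y, ((k y).toReal : ℂ) * T (SchwartzMap.compSubConstCLM ℂ (-y) φ)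

/-- The functional `S` on test functions is (given by) the real function `u`. -/
def Represents (u : V → ℝ) (S : 𝓢(V, ℂ) → ℂ) : Prop :=
  LocallyIntegrable u ∧ ∀ φ : 𝓢(V, ℂ), HasCompactSupport φ → ∫ x, (u x : ℂ) * φ x = S φ

/-- A `[0,∞]`-valued function is tempered: it is measurable and integrable against some
`(1 + |x|²)^{-k}`. -/
def IsTempered (u : V → ℝ≥0∞) : Prop :=
  Measurable u ∧ ∃ k : ℕ, ∫⁻ x, u x / ENNReal.ofReal ((1 + ‖x‖ ^ 2) ^ k) ≠ ⊤

theorem hasTemperateGrowth_exp_I :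
    (fun t : ℝ => Complex.exp (-(Complex.I * t))).HasTemperateGrowth := by
  have h : ∀ t : ℝ, Complex.exp (-(Complex.I * t)) = Complex.exp ((-t : ℝ) * Complex.I) := by
    intro t; congr 1; push_cast; ring
  have hd : deriv (fun t : ℝ => Complex.exp (-(Complex.I * t))) =
      fun t : ℝ => (-Complex.I) * Complex.exp (-(Complex.I * t)) := by
    ext t
    have h1 : HasDerivAt (fun t : ℝ => -(Complex.I * (t : ℂ))) (-(Complex.I * 1)) t :=
      ((Complex.ofRealCLM.hasDerivAt (x := t)).const_mul Complex.I).neg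
    rw [(h1.cexp).deriv]
    ring
  have hs : ContDiff ℝ ((⊤ : ℕ∞) : WithTop ℕ∞) (fun t : ℝ => Complex.exp (-(Complex.I * t))) := by
    apply ContDiff.cexp
    exact (contDiff_const.mul Complex.ofRealCLM.contDiff).neg
  have hit : ∀ n : ℕ, iteratedDeriv n (fun t : ℝ => Complex.exp (-(Complex.I * t))) =
      fun t : ℝ => (-Complex.I) ^ n * Complex.exp (-(Complex.I * t)) := by
    intro n
    induction n with
    | zero => ext; simp
    | succ n ih =>
      rw [iteratedDeriv_succ, ih]
      ext t
      rw [deriv_const_mul_field, hd]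
      ring
  refine ⟨hs, fun n => ⟨0, 1, fun t => ?_⟩⟩
  rw [norm_iteratedFDeriv_eq_norm_iteratedDeriv, hit, norm_mul, norm_pow, h,
    Complex.norm_exp_ofReal_mul_I]
  simp

end Fourier

/-! ### The coloration kernel and the spectral measure -/

/-- The standing assumption on the kernel `κ`: `κ` is tempered, its Fourier transform is the
tempered function `h`, `|h|²` is tempered, and `|h|²` is the Fourier transform of a nonnegative
tempered function `f`. -/
structure KernelAssumption {d : ℕ} (κ : Rd d → ℝ≥0∞) (h : Rd d → ℂ) : Prop where
  tempered_kernel : IsTempered κ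
  measurable_fourier : Measurable h
  tempered_fourier : IsTempered fun ξ => ‖h ξ‖ₑ
  fourier_kernel : ∀ φ : 𝓢(Rd d, ℂ), ∫ ξ, h ξ * φ ξ = ∫ x, ((κ x).toReal : ℂ) * fourierS φ x
  tempered_sq : IsTempered fun ξ => ‖h ξ‖ₑ ^ 2
  exists_fourier_sq : ∃ f : Rd d → ℝ≥0∞, IsTempered f ∧
    ∀ φ : 𝓢(Rd d, ℂ), ∫ ξ, ((‖h ξ‖ ^ 2 : ℝ) : ℂ) * φ ξ =
      ∫ x, ((f x).toReal : ℂ) * fourierS φ x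

/-- `μ(dξ) = (2π)^{-d} |h(ξ)|² dξ`. -/
def spectralMeasure {d : ℕ} (h : Rd d → ℂ) : Measure (Rd d) :=
  ENNReal.ofReal (((2 * Real.pi) ^ d)⁻¹) • volume.withDensity fun ξ => ‖h ξ‖ₑ ^ 2

/-- `κ^{⊗ n}(x) = κ(x₁) ⋯ κ(x_n)`. -/
def kernelTensor {d : ℕ} (κ : Rd d → ℝ≥0∞) (n : ℕ) (x : Rnd n d) : ℝ≥0∞ := ∏ j, κ (x j)

/-! ### The chaos kernels -/

/-- `T_n(t) = {0 < t₁ < ⋯ < t_n < t}`. -/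
def simplex (n : ℕ) (t : ℝ) : Set (Fin n → ℝ) :=
  {s | StrictMono s ∧ ∀ j, 0 < s j ∧ s j < t}

/-- The increment `t_{j+1} - t_j`, with `t_{n+1} = t`. -/
def increment {n : ℕ} (s : Fin n → ℝ) (t : ℝ) (j : Fin n) : ℝ :=
  (if hj : (j : ℕ) + 1 < n then s ⟨(j : ℕ) + 1, hj⟩ else t) - s j

/-- `e^{-i (ξ₁ + ⋯ + ξ_n)·x} ∏_j conj (𝓕 G_{t_{j+1} - t_j}(ξ₁ + ⋯ + ξ_j))`. -/
def chaosSymbol {d : ℕ} (G : ℝ → 𝓢'(Rd d, ℂ)) (n : ℕ) (s : Fin n → ℝ) (t : ℝ) (x : Rd d)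
    (ξ : Rnd n d) : ℂ :=
  Complex.exp (-(Complex.I * (inner ℝ (∑ j, ξ j) x : ℝ))) *
    ∏ j, conj (fourierFun (G (increment s t j)) (∑ l ∈ Finset.Iic j, ξ l))

theorem chaosSymbol_hasTemperateGrowth {d : ℕ} (G : ℝ → 𝓢'(Rd d, ℂ)) (n : ℕ) (s : Fin n → ℝ)
    (t : ℝ) (x : Rd d) : (chaosSymbol G n s t x).HasTemperateGrowth := by
  have hsum : ∀ S : Finset (Fin n),
      (fun ξ : Rnd n d => ∑ j ∈ S, ξ j).HasTemperateGrowth := by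
    intro S
    have := (∑ j ∈ S, (PiLp.proj 2 (fun _ : Fin n => Rd d) j :
      Rnd n d →L[ℝ] Rd d)).hasTemperateGrowth
    convert this using 1
    ext ξ
    simp
  have hexp : (fun ξ : Rnd n d =>
      Complex.exp (-(Complex.I * (inner ℝ (∑ j, ξ j) x : ℝ)))).HasTemperateGrowth :=
    hasTemperateGrowth_exp_I.comp
      ((Function.hasTemperateGrowth_inner_left x).comp (hsum Finset.univ))
  have hprod : ∀ S : Finset (Fin n), (fun ξ : Rnd n d => ∏ j ∈ S,
      conj (fourierFun (G (increment s t j)) (∑ l ∈ Finset.Iic j, ξ l))).HasTemperateGrowth := by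
    intro S
    induction S using Finset.induction_on with
    | empty => simp
    | insert a S ha ih =>
      simp only [Finset.prod_insert ha]
      refine Function.HasTemperateGrowth.mul ?_ ih
      exact (Complex.conjCLE.hasTemperateGrowth).comp
        ((fourierFun_hasTemperateGrowth _).comp (hsum (Finset.Iic a)))
  exact hexp.mul (hprod Finset.univ)

/-- `f_n(t₁, ·, …, t_n, ·, t, x) ∈ 𝓢'(ℝ^{nd})`: the tempered distribution with Fourier transform
`chaosSymbol`. -/
def chaosDist {d : ℕ} (G : ℝ → 𝓢'(Rd d, ℂ)) (n : ℕ) (s : Fin n → ℝ) (t : ℝ) (x : Rd d) :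
    𝓢'(Rnd n d, ℂ) :=
  distOfFourier (chaosSymbol_hasTemperateGrowth G n s t x)

/-- `f_n(t₁, ·, …, t_n, ·, t, x) * κ^{⊗ n}`. -/
def chaosConv {d : ℕ} (κ : Rd d → ℝ≥0∞) (G : ℝ → 𝓢'(Rd d, ℂ)) (n : ℕ) (s : Fin n → ℝ) (t : ℝ)
    (x : Rd d) : 𝓢(Rnd n d, ℂ) → ℂ :=
  convDist (chaosDist G n s t x) (kernelTensor κ n)

/-- `g` is a jointly measurable function on `T_n(t) × ℝ^{nd}` with which the family
`f_n(t₁, ·, …, t_n, ·, t, x) * κ^{⊗ n}`, `(t₁, …, t_n) ∈ T_n(t)`, is identified: either `g(s, ·)`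
is `f_n * κ^{⊗ n}` for every `s ∈ T_n(t)`, or `g(s, ·) = f_n * κ^{⊗ n}` in `L²(ℝ^{nd})` for almost
every `s ∈ T_n(t)`. -/
def IsConvVersion {d : ℕ} (κ : Rd d → ℝ≥0∞) (G : ℝ → 𝓢'(Rd d, ℂ)) (n : ℕ) (t : ℝ) (x : Rd d)
    (g : (Fin n → ℝ) → Rnd n d → ℝ) : Prop :=
  Measurable (fun p : simplex n t × Rnd n d => g p.1 p.2) ∧
  ((∀ s ∈ simplex n t, Represents (g s) (chaosConv κ G n s t x)) ∨
    (∀ᵐ s ∂(volume.restrict (simplex n t)),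
      MemLp (g s) 2 ∧ Represents (g s) (chaosConv κ G n s t x)))

/-- `f_n^*(x₁, z₁, …, x_n, z_n, x; t) = ∏ᵢ zᵢ ∫_{T_n(t)} (f_n(t₁, ·, …, t_n, ·, t, x) *
κ^{⊗ n})(x₁, …, x_n) dt₁ ⋯ dt_n`, where `g` is the function identified with `f_n * κ^{⊗ n}`. -/
def chaosKernel {d : ℕ} (n : ℕ) (t : ℝ) (g : (Fin n → ℝ) → Rnd n d → ℝ)
    (z : Fin n → ZSpace d) : ℝ :=
  (∏ j, ((z j).2 : ℝ)) * ∫ s in simplex n t, g s (WithLp.toLp 2 fun j => (z j).1)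

/-- `J_n(t) = ∫_{T_n(t)} ∫ ∏_j |𝓕 G_{t_{j+1} - t_j}(ξ₁ + ⋯ + ξ_j)|² μ(dξ₁) ⋯ μ(dξ_n) dt₁ ⋯ dt_n`. -/
def chaosEnergy {d : ℕ} (h : Rd d → ℂ) (G : ℝ → 𝓢'(Rd d, ℂ)) (n : ℕ) (t : ℝ) : ℝ≥0∞ :=
  ∫⁻ s in simplex n t, ∫⁻ ξ : Fin n → Rd d,
    ∏ j, ‖fourierFun (G (increment s t j)) (∑ l ∈ Finset.Iic j, ξ l)‖ₑ ^ 2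
      ∂(Measure.pi fun _ => spectralMeasure h)

/-! ### The hypotheses -/

/-- Hypothesis A': `f_n(t₁, ·, …, t_n, ·, t, x) ∈ 𝒪_C'(ℝ^{nd})`.  The first clause, `G_t ∈ 𝒪_C'`,
is what makes `𝓕 G_t` a function in `𝒪_M`, as the definition of `f_n` presupposes; up to a
reflection and a translation of `G_t` it is the case `n = 1` of the second clause. -/
structure HypothesisA {d : ℕ} (G : ℝ → 𝓢'(Rd d, ℂ)) : Prop where
  rapid : ∀ t, 0 < t → IsRapidDecrease (G t)
  rapid_chaos : ∀ (t : ℝ) (x : Rd d) (n : ℕ), 0 ≤ t → 1 ≤ n → ∀ s ∈ simplex n t,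
    IsRapidDecrease (chaosDist G n s t x)

/-- `K(t) = sup_η ∫ |𝓕 G_t(ξ + η)|² μ(dξ)`. -/
def shiftedEnergy {d : ℕ} (h : Rd d → ℂ) (G : ℝ → 𝓢'(Rd d, ℂ)) (t : ℝ) : ℝ≥0∞ :=
  ⨆ η : Rd d, ∫⁻ ξ, ‖fourierFun (G t) (ξ + η)‖ₑ ^ 2 ∂(spectralMeasure h)

/-- Hypothesis B': `K(t) < ∞` for all `t > 0`. -/
def HypothesisB {d : ℕ} (h : Rd d → ℂ) (G : ℝ → 𝓢'(Rd d, ℂ)) : Prop :=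
  ∀ t, 0 < t → shiftedEnergy h G t < ⊤

/-- Hypothesis D': `(t, ξ) ↦ 𝓕 G_t(ξ)` is measurable and `∫_0^T K(t) dt < ∞` for all `T > 0`. -/
structure HypothesisD {d : ℕ} (h : Rd d → ℂ) (G : ℝ → 𝓢'(Rd d, ℂ)) : Prop where
  measurable : Measurable fun p : Set.Ioi (0 : ℝ) × Rd d => fourierFun (G p.1) p.2
  integral_lt_top : ∀ T, 0 < T → ∫⁻ t in Set.Ioo 0 T, shiftedEnergy h G t < ⊤

/-- Hypothesis E': `f_n(t₁, ·, …, t_n, ·, t, x) * κ^{⊗ n}` is (identified with) a jointly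
measurable function. -/
def HypothesisE {d : ℕ} (κ : Rd d → ℝ≥0∞) (G : ℝ → 𝓢'(Rd d, ℂ)) : Prop :=
  ∀ (t : ℝ) (x : Rd d) (n : ℕ), 0 ≤ t → 1 ≤ n → ∃ g, IsConvVersion κ G n t x g

/-! ### The Skorohod solution -/

/-- `u` is a (Skorohod) solution of `ℒ u = u Ẋ` with initial condition `1`, where `G_t` is the
fundamental solution of `ℒ`: every `u(t, x)` is in `L²(Ω)`, the kernels `f_n^*(·, x; t)` are in
`ℋ^{⊗ n}`, and `u(t, x) = 1 + ∑_{n ≥ 1} I_n(f_n^*(·, x; t))` with convergence in `L²(Ω)`. -/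
def IsSkorohodSolution {Ω : Type*} [MeasurableSpace Ω] {d : ℕ} (P : Measure Ω)
    (N : Ω → Measure (ZSpace d)) (ν : Measure R0) (κ : Rd d → ℝ≥0∞) (G : ℝ → 𝓢'(Rd d, ℂ))
    (u : ℝ → Rd d → Ω → ℝ) : Prop :=
  ∀ (t : ℝ) (x : Rd d), 0 ≤ t → MemLp (u t x) 2 P ∧
    ∃ (g : ∀ n : ℕ, (Fin n → ℝ) → Rnd n d → ℝ) (I : ℕ → Ω → ℝ),
      (∀ n, 1 ≤ n → IsConvVersion κ G n t x (g n) ∧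
        MemLp (chaosKernel n t (g n)) 2 (intensityPow d ν n) ∧
        IsMultipleIntegral P N (intensity d ν) n (chaosKernel n t (g n)) (I n)) ∧
      Tendsto (fun M : ℕ =>
        eLpNorm (fun ω => u t x ω - (1 + ∑ n ∈ Finset.Icc 1 M, I n ω)) 2 P) atTop (𝓝 0)

end LevySPDE

end

open LevySPDE

set_option linter.unusedSectionVars false

/-! Two estimates carry the theorem: an analytic one for the kernels and a probabilistic one for the
multiple integrals.

Kernels. For fixed times `s`, the functional `f_n * κ^{⊗n}` pairs `h^{⊗n}` times the symbol of `f_n`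
with the inverse Fourier transform of the test function (`KernelAssumption.convDist_distOfFourier`).
This rests on `𝓕 κ^{⊗n} = h^{⊗n}`: the hypothesis on `κ` gives it on tensor products, and
mollification extends it to all Schwartz functions on `ℝ^{nd}`
(`KernelAssumption.integral_prod_mul_fourierS`). The squared `L²` norm of that product, divided by
`(2π)^{nd}`, is the inner integral of `J_n` at `s`, finite by B'. Plancherel therefore computes the
`L²` norm of any function representing the functional (`Represents.lintegral_sq_eq_energy`).
Cauchy–Schwarz in `s`, with `n! |T_n(t)| ≤ t^n`, gives absolute convergence and the norm bound at
once, and the variables `z_i` contribute `m₂^n`. Finally `J_n(t) < ∞`: integrating out the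
frequencies leaves a product of `K(t_{j+1} - t_j)`, whose integral over the simplex is at most
`(∫_0^t K)^n`.

Integrals. Independence on disjoint sets gives a Wick formula: the expectation of `∏ N̂(A_i) ∏
N̂(B_j)`, each family pairwise disjoint, is a sum over matchings of `∏ m(A_j ∩ B_{σ j})`, and is
zero if the families differ in size. Hence `E I_n(f)² ≤ n! ‖f‖²` for elementary `f`, and different
orders are orthogonal. As `m` has no atoms, diagonals are null and elementary functions are dense,
so every `f ∈ L²` has an integral, unique almost surely.

The chaos series is thus orthogonal, with squared norms summing to at most `∑ m₂^n t^n J_n(t)`, and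
it converges. For uniqueness, any two choices of `g_n` agree almost everywhere, so the kernels,
their integrals and the `L²` limits agree. -/

namespace LevySPDE

/-! ### Moments of Poisson random measures -/

section PoissonMoments

variable {Ω Z : Type*} [MeasurableSpace Ω] [MeasurableSpace Z]

/-- `X` belongs to `L^p(P)` for every finite `p`. -/
def HasAllMoments (P : Measure Ω) (X : Ω → ℝ) : Prop := ∀ p : ℝ≥0, MemLp X p P

theorem HasAllMoments.mul {P : Measure Ω} {X Y : Ω → ℝ} (hX : HasAllMoments P X)
    (hY : HasAllMoments P Y) : HasAllMoments P fun ω => X ω * Y ω := by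
  intro p
  have h : ENNReal.HolderTriple ((2 * p : ℝ≥0) : ℝ≥0∞) ((2 * p : ℝ≥0) : ℝ≥0∞) p := by
    refine ⟨?_⟩
    push_cast
    rw [ENNReal.mul_inv (by simp) (by simp), ← two_mul, ← mul_assoc,
      ENNReal.mul_inv_cancel (by simp) (by simp), one_mul]
  exact (hY (2 * p)).mul (hX (2 * p))

theorem HasAllMoments.const (P : Measure Ω) [IsFiniteMeasure P] (c : ℝ) :
    HasAllMoments P fun _ => c := fun _ => memLp_const c

theorem HasAllMoments.sum {P : Measure Ω} {ι : Type*} (s : Finset ι) {X : ι → Ω → ℝ}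
    (hX : ∀ i ∈ s, HasAllMoments P (X i)) : HasAllMoments P fun ω => ∑ i ∈ s, X i ω :=
  fun p => memLp_finsetSum s fun i hi => hX i hi p

theorem HasAllMoments.prod {P : Measure Ω} [IsFiniteMeasure P] {ι : Type*} (s : Finset ι)
    {X : ι → Ω → ℝ} (hX : ∀ i ∈ s, HasAllMoments P (X i)) :
    HasAllMoments P fun ω => ∏ i ∈ s, X i ω := by
  classical
  induction s using Finset.induction_on with
  | empty => simpa using HasAllMoments.const P 1
  | insert a s ha ih =>
    simp only [Finset.prod_insert ha]
    exact (hX a (by simp)).mul (ih fun i hi => hX i (by simp [hi]))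

theorem HasAllMoments.integrable {P : Measure Ω} {X : Ω → ℝ} (hX : HasAllMoments P X) :
    Integrable X P := memLp_one_iff_integrable.1 (by simpa using hX 1)

theorem integrable_poissonMeasure_exp (r : ℝ≥0) (t : ℝ) :
    Integrable (fun k : ℕ => Real.exp (t * k)) (poissonMeasure r) := by
  rw [integrable_poissonMeasure_iff]
  have := (Real.summable_pow_div_factorial (r * Real.exp t)).mul_left (Real.exp (-r))
  refine this.congr fun n => ?_
  rw [Real.norm_of_nonneg (Real.exp_pos _).le, mul_comm t, Real.exp_nat_mul, mul_pow]
  ring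

theorem integral_poissonMeasure_cast (r : ℝ≥0) :
    ∫ k : ℕ, (k : ℝ) ∂(poissonMeasure r) = r := by
  rw [integral_poissonMeasure]
  have h1 : HasSum (fun n : ℕ => (Real.exp (-r) * r ^ n / n.factorial) * r) (1 * r) :=
    (hasSum_one_poissonMeasure r).mul_right _
  refine HasSum.tsum_eq ?_
  rw [← hasSum_nat_add_iff' 1]
  simp only [Finset.range_one, Finset.sum_singleton, Nat.cast_zero, smul_eq_mul, mul_zero,
    sub_zero]
  rw [one_mul] at h1
  refine h1.congr_fun fun n => ?_
  rw [Nat.factorial_succ]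
  push_cast
  have : (n.factorial : ℝ) ≠ 0 := by positivity
  field_simp
  ring

/-- Shifting the index by two cancels `k(k-1)` against `k!` and reproduces the Poisson masses times
`r²`; the terms `k = 0, 1` vanish. -/
theorem integral_poissonMeasure_descFactorial (r : ℝ≥0) :
    ∫ k : ℕ, (k : ℝ) * (k - 1) ∂(poissonMeasure r) = r ^ 2 := by
  rw [integral_poissonMeasure]
  have h1 : HasSum (fun n : ℕ => (Real.exp (-r) * r ^ n / n.factorial) * (r : ℝ) ^ 2)
      (1 * (r : ℝ) ^ 2) :=
    (hasSum_one_poissonMeasure r).mul_right _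
  refine HasSum.tsum_eq ?_
  rw [← hasSum_nat_add_iff' 2]
  simp only [Finset.sum_range_succ, Finset.range_zero, Finset.sum_empty, Nat.cast_zero,
    Nat.cast_one, smul_eq_mul, mul_zero, sub_self, zero_mul, add_zero, sub_zero]
  rw [one_mul] at h1
  refine h1.congr_fun fun n => ?_
  rw [Nat.factorial_succ, Nat.factorial_succ]
  push_cast
  have : (n.factorial : ℝ) ≠ 0 := by positivity
  field_simp
  ring

namespace IsPoissonRandomMeasure

variable {P : Measure Ω} {N : Ω → Measure Z} {m : Measure Z}

theorem measurable_compensated (hN : IsPoissonRandomMeasure P N m) {A : Set Z}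
    (hA : MeasurableSet A) : Measurable (compensated N m A) :=
  ((hN.measurable_eval A hA).ennreal_toReal).sub_const _

theorem map_toReal (hN : IsPoissonRandomMeasure P N m) {A : Set Z} (hA : MeasurableSet A)
    (hA' : m A ≠ ⊤) : P.map (fun ω => (N ω A).toReal) =
      (poissonMeasure (m A).toNNReal).map (fun k : ℕ => (k : ℝ)) := by
  have h := congrArg (Measure.map ENNReal.toReal) (hN.law_eval A hA hA')
  rw [Measure.map_map ENNReal.measurable_toReal (hN.measurable_eval A hA),
    Measure.map_map ENNReal.measurable_toReal .of_discrete] at h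
  exact h

theorem ae_ne_top (hN : IsPoissonRandomMeasure P N m) {A : Set Z} (hA : MeasurableSet A)
    (hA' : m A ≠ ⊤) : ∀ᵐ ω ∂P, N ω A ≠ ⊤ := by
  have h : ∀ᵐ x ∂(P.map fun ω => N ω A), x ≠ ⊤ := by
    rw [hN.law_eval A hA hA']
    exact (ae_map_iff (Measurable.of_discrete).aemeasurable
      (measurableSet_singleton ⊤).compl).2 (by simp)
  exact (ae_map_iff (hN.measurable_eval A hA).aemeasurable
    (measurableSet_singleton ⊤).compl).1 h

/-- A Poisson law has exponential moments of every real parameter, so `0` is interior to the set of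
admissible parameters and all moments are finite. All of them are wanted because products of
arbitrarily many values are handled by Hölder. -/
theorem hasAllMoments_toReal [IsProbabilityMeasure P] (hN : IsPoissonRandomMeasure P N m)
    {A : Set Z} (hA : MeasurableSet A) (hA' : m A ≠ ⊤) :
    HasAllMoments P fun ω => (N ω A).toReal := by
  refine memLp_of_mem_interior_integrableExpSet ?_
  have : integrableExpSet (fun ω => (N ω A).toReal) P = Set.univ := by
    ext t
    simp only [integrableExpSet, Set.mem_ofPred_eq, Set.mem_univ, iff_true]
    have h1 : Integrable (fun x : ℝ => Real.exp (t * x)) (P.map fun ω => (N ω A).toReal) := by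
      rw [hN.map_toReal hA hA', integrable_map_measure (by fun_prop) (by fun_prop)]
      exact integrable_poissonMeasure_exp _ t
    exact (integrable_map_measure (by fun_prop)
      (hN.measurable_eval A hA).ennreal_toReal.aemeasurable).1 h1
  simp [this]

theorem hasAllMoments_compensated [IsProbabilityMeasure P] (hN : IsPoissonRandomMeasure P N m)
    {A : Set Z} (hA : MeasurableSet A) (hA' : m A ≠ ⊤) :
    HasAllMoments P (compensated N m A) :=
  fun p => (hN.hasAllMoments_toReal hA hA' p).sub (memLp_const _)

theorem integral_comp_toReal (hN : IsPoissonRandomMeasure P N m)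
    {A : Set Z} (hA : MeasurableSet A) (hA' : m A ≠ ⊤) {f : ℝ → ℝ} (hf : Measurable f) :
    ∫ ω, f (N ω A).toReal ∂P = ∫ k : ℕ, f k ∂(poissonMeasure (m A).toNNReal) := by
  rw [← integral_map (f := f) (hN.measurable_eval A hA).ennreal_toReal.aemeasurable
    hf.aestronglyMeasurable, hN.map_toReal hA hA',
    integral_map (by fun_prop) hf.aestronglyMeasurable]

theorem integral_toReal (hN : IsPoissonRandomMeasure P N m) {A : Set Z}
    (hA : MeasurableSet A) (hA' : m A ≠ ⊤) : ∫ ω, (N ω A).toReal ∂P = (m A).toReal := by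
  rw [hN.integral_comp_toReal hA hA' (f := fun x => x) measurable_id,
    integral_poissonMeasure_cast]
  rfl

theorem integral_compensated [IsProbabilityMeasure P] (hN : IsPoissonRandomMeasure P N m)
    {A : Set Z} (hA : MeasurableSet A) (hA' : m A ≠ ⊤) : ∫ ω, compensated N m A ω ∂P = 0 := by
  unfold compensated
  rw [integral_sub (hN.hasAllMoments_toReal hA hA').integrable (integrable_const _),
    hN.integral_toReal hA hA']
  simp

/-- With `X = N(A)` and `a = m(A)`, write `(X - a)² = X(X - 1) + (1 - 2a)X + a²`; its mean is `a² +
(1 - 2a)a + a² = a`. -/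
theorem integral_compensated_sq [IsProbabilityMeasure P] (hN : IsPoissonRandomMeasure P N m)
    {A : Set Z} (hA : MeasurableSet A) (hA' : m A ≠ ⊤) :
    ∫ ω, compensated N m A ω * compensated N m A ω ∂P = (m A).toReal := by
  have hm := hN.hasAllMoments_toReal hA hA'
  have h2 : ∫ ω, (N ω A).toReal * ((N ω A).toReal - 1) ∂P = (m A).toReal ^ 2 := by
    rw [hN.integral_comp_toReal hA hA' (f := fun x => x * (x - 1)) (by fun_prop),
      integral_poissonMeasure_descFactorial]
    rfl
  have e : ∀ ω, compensated N m A ω * compensated N m A ω =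
      (N ω A).toReal * ((N ω A).toReal - 1) +
        ((1 - 2 * (m A).toReal) * (N ω A).toReal + (m A).toReal ^ 2) := by
    intro ω; unfold compensated; ring
  have i1 : Integrable (fun ω => (N ω A).toReal * ((N ω A).toReal - 1)) P :=
    HasAllMoments.integrable (hm.mul fun p => (hm p).sub (memLp_const 1))
  have i2 : Integrable (fun ω => (1 - 2 * (m A).toReal) * (N ω A).toReal) P :=
    hm.integrable.const_mul _
  have i3 : Integrable (fun ω => (1 - 2 * (m A).toReal) * (N ω A).toReal + (m A).toReal ^ 2) P :=
    i2.add (integrable_const _)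
  simp_rw [e]
  rw [integral_add i1 i3, integral_add i2 (integrable_const _), h2,
    integral_const_mul, hN.integral_toReal hA hA']
  simp
  ring

/-! ### Additivity and independence -/

/-- Equality holds only almost surely, since `toReal` is additive only where `N(A)` is finite. -/
theorem compensated_eq_add_sum (hN : IsPoissonRandomMeasure P N m) {ι : Type*} [Fintype ι]
    {A : Set Z} {B : ι → Set Z} (hA : MeasurableSet A) (hA' : m A ≠ ⊤)
    (hB : ∀ i, MeasurableSet (B i)) (hd : Pairwise fun i j => Disjoint (B i) (B j)) :
    compensated N m A =ᵐ[P] fun ω =>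
      compensated N m (A \ ⋃ i, B i) ω + ∑ i, compensated N m (A ∩ B i) ω := by
  have key : ∀ M : Measure Z, M A ≠ ⊤ →
      (M A).toReal = (M (A \ ⋃ i, B i)).toReal + ∑ i, (M (A ∩ B i)).toReal := by
    intro M hM
    have h1 : M A = M (A \ ⋃ i, B i) + ∑ i, M (A ∩ B i) := by
      rw [← measure_inter_add_sdiff A (MeasurableSet.iUnion hB), add_comm, Set.inter_iUnion,
        measure_iUnion (fun i j hij => (hd hij).mono Set.inter_subset_right Set.inter_subset_right)
          (fun i => hA.inter (hB i)), tsum_fintype]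
    have fin : ∀ S ⊆ A, M S ≠ ⊤ := fun S hS => measure_ne_top_of_subset hS hM
    rw [h1, ENNReal.toReal_add (fin _ Set.sdiff_subset)
      (ENNReal.sum_ne_top.2 fun i _ => fin _ Set.inter_subset_left),
      ENNReal.toReal_sum fun i _ => fin _ Set.inter_subset_left]
  filter_upwards [hN.ae_ne_top hA hA'] with ω hω
  unfold compensated
  rw [key _ hω, key _ hA', Finset.sum_sub_distrib]
  ring

/-- The `D i` may overlap, whereas the definition gives independence only for disjoint sets. The
cure is to split the `D i` into the atoms of the algebra they generate off `C`: each `N(D i)` is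
then a sum of values on atoms. -/
theorem indepFun_of_disjoint (hN : IsPoissonRandomMeasure P N m) {ι : Type} [Fintype ι]
    {C : Set Z} {D : ι → Set Z} (hC : MeasurableSet C) (hD : ∀ i, MeasurableSet (D i))
    (hCD : ∀ i, Disjoint C (D i)) :
    IndepFun (fun ω => N ω C) (fun ω i => N ω (D i)) P := by
  classical
  -- `none` labels `C` itself; `some S` labels the atom of points outside `C` that lie in `D i`
  -- exactly for `i ∈ S`.
  let E : Option (Finset ι) → Set Z := fun o => o.elim C fun S =>
    Cᶜ ∩ ⋂ i, if i ∈ S then D i else (D i)ᶜ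
  have hE : ∀ o, MeasurableSet (E o) := by
    rintro (_ | S)
    · exact hC
    · refine hC.compl.inter (MeasurableSet.iInter fun i => ?_)
      split_ifs
      exacts [hD i, (hD i).compl]
  have mem : ∀ S z, z ∈ E (some S) ↔ z ∉ C ∧ ∀ i, (z ∈ D i ↔ i ∈ S) := by
    intro S z
    simp only [E, Option.elim, Set.mem_inter_iff, Set.mem_compl_iff, Set.mem_iInter]
    refine and_congr_right fun _ => forall_congr' fun i => ?_
    split_ifs with h <;> simp [h]
  have hd : Pairwise fun o o' => Disjoint (E o) (E o') := by
    rintro (_ | S) (_ | S') hne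
    · exact absurd rfl hne
    · exact Set.disjoint_left.2 fun z hz hz' => ((mem S' z).1 hz').1 hz
    · exact Set.disjoint_left.2 fun z hz hz' => ((mem S z).1 hz).1 hz'
    · refine Set.disjoint_left.2 fun z hz hz' => hne ?_
      congr 1
      ext i
      rw [← ((mem S z).1 hz).2 i, ((mem S' z).1 hz').2 i]
  have hun : ∀ i, D i = ⋃ S : {S : Finset ι // i ∈ S}, E (some S) := by
    intro i
    ext z
    simp only [Set.mem_iUnion]
    constructor
    · intro hz
      refine ⟨⟨Finset.univ.filter fun j => z ∈ D j, by simpa using hz⟩, (mem _ z).2 ⟨?_, by simp⟩⟩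
      exact fun hzC => Set.disjoint_left.1 (hCD i) hzC hz
    · rintro ⟨⟨S, hS⟩, hz⟩
      exact (((mem S z).1 hz).2 i).2 hS
  have hind : iIndepFun (fun o ω => N ω (E o)) P := by
    let e := Fintype.equivFin (Option (Finset ι))
    have h1 := (hN.indep _ (fun k => E (e.symm k)) (fun k => hE _)
      fun i j hij => hd (e.symm.injective.ne hij)).precomp e.injective
    simpa using h1
  have h2 := hind.indepFun_finset {none} (Finset.univ.erase none)
    (by simp) fun o => hN.measurable_eval _ (hE o)
  have hφ : Measurable fun f : ↥({none} : Finset (Option (Finset ι))) → ℝ≥0∞ =>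
      f ⟨none, by simp⟩ := measurable_pi_apply _
  have hψ : Measurable fun (f : ↥((Finset.univ : Finset (Option (Finset ι))).erase none) → ℝ≥0∞)
      (i : ι) => ∑ S : {S : Finset ι // i ∈ S}, f ⟨some S, by simp⟩ :=
    measurable_pi_lambda _ fun i => Finset.measurable_fun_sum _ fun S _ => measurable_pi_apply _
  have h3 := h2.comp hφ hψ
  convert h3 using 1
  · rfl
  ext ω i
  simp only [Function.comp]
  rw [hun i, measure_iUnion (fun S S' hS => hd (by simpa [Subtype.ext_iff] using hS))
    fun S => hE _, tsum_fintype]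

end IsPoissonRandomMeasure

/-- `Y` is a measurable function of finitely many values `N(D)` with `D` disjoint from `C`. -/
def DependsOnCompl (N : Ω → Measure Z) (C : Set Z) (Y : Ω → ℝ) : Prop :=
  ∃ (ι : Type) (_ : Fintype ι) (D : ι → Set Z) (F : (ι → ℝ≥0∞) → ℝ),
    (∀ i, MeasurableSet (D i)) ∧ (∀ i, Disjoint C (D i)) ∧ Measurable F ∧
      Y = fun ω => F fun i => N ω (D i)

namespace DependsOnCompl

variable {N : Ω → Measure Z} {m : Measure Z} {C : Set Z} {Y Y' : Ω → ℝ}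

theorem one : DependsOnCompl N C fun _ => 1 :=
  ⟨Empty, inferInstance, Empty.elim, fun _ => 1, by simp, by simp, measurable_const, rfl⟩

theorem compensated {D : Set Z} (hD : MeasurableSet D) (hCD : Disjoint C D) :
    DependsOnCompl N C (compensated N m D) :=
  ⟨Unit, inferInstance, fun _ => D, fun f => (f ()).toReal - (m D).toReal, fun _ => hD,
    fun _ => hCD, by fun_prop, rfl⟩

theorem mul (h : DependsOnCompl N C Y) (h' : DependsOnCompl N C Y') :
    DependsOnCompl N C fun ω => Y ω * Y' ω := by
  obtain ⟨ι, _, D, F, hD, hCD, hF, rfl⟩ := h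
  obtain ⟨ι', _, D', F', hD', hCD', hF', rfl⟩ := h'
  refine ⟨ι ⊕ ι', inferInstance, Sum.elim D D', fun f => F (fun i => f (.inl i)) *
    F' (fun i => f (.inr i)), ?_, ?_, by fun_prop, rfl⟩
  · rintro (i | i)
    exacts [hD i, hD' i]
  · rintro (i | i)
    exacts [hCD i, hCD' i]

theorem prod {ι : Type*} (s : Finset ι) {Y : ι → Ω → ℝ}
    (h : ∀ i ∈ s, DependsOnCompl N C (Y i)) : DependsOnCompl N C fun ω => ∏ i ∈ s, Y i ω := by
  classical
  induction s using Finset.induction_on with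
  | empty => simpa using one
  | insert a s ha ih =>
    simp only [Finset.prod_insert ha]
    exact (h a (by simp)).mul (ih fun i hi => h i (by simp [hi]))

/-- `N(C)` is independent of the finitely many values on which `Y` depends. It is applied with `f`
the identity, to kill centred factors, and with `f` the square, to extract variances. -/
theorem integral_mul {P : Measure Ω} (hN : IsPoissonRandomMeasure P N m)
    (hC : MeasurableSet C) (h : DependsOnCompl N C Y) {f : ℝ → ℝ} (hf : Measurable f) :
    ∫ ω, f (LevySPDE.compensated N m C ω) * Y ω ∂P =
      (∫ ω, f (LevySPDE.compensated N m C ω) ∂P) * ∫ ω, Y ω ∂P := by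
  obtain ⟨ι, _, D, F, hD, hCD, hF, rfl⟩ := h
  have hi := (hN.indepFun_of_disjoint hC hD hCD).comp
    (φ := fun x => f (x.toReal - (m C).toReal)) (by fun_prop) hF
  refine hi.integral_fun_mul_eq_mul_integral ?_ ?_
  · exact (hf.comp (hN.measurable_compensated hC)).aestronglyMeasurable
  · exact (hF.comp (measurable_pi_lambda _ fun i =>
      hN.measurable_eval _ (hD i))).aestronglyMeasurable

end DependsOnCompl

end PoissonMoments


/-! ### Second moments of products of compensated measures -/

section PoissonIsometry

variable {Ω Z : Type*} [MeasurableSpace Ω] [MeasurableSpace Z]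

/-- A finite family of pairwise disjoint measurable sets of finite measure. -/
structure DisjointFamily (m : Measure Z) {ι : Type*} (A : ι → Set Z) : Prop where
  measurableSet : ∀ i, MeasurableSet (A i)
  ne_top : ∀ i, m (A i) ≠ ⊤
  disjoint : Pairwise fun i j => Disjoint (A i) (A j)

theorem DisjointFamily.comp {m : Measure Z} {ι ι' : Type*} {A : ι → Set Z}
    (hA : DisjointFamily m A) {f : ι' → ι} (hf : f.Injective) :
    DisjointFamily m fun i => A (f i) :=
  ⟨fun _ => hA.1 _, fun _ => hA.2 _, fun _ _ h => hA.3 (hf.ne h)⟩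

variable {P : Measure Ω} [IsProbabilityMeasure P] {N : Ω → Measure Z} {m : Measure Z}

theorem IsPoissonRandomMeasure.hasAllMoments_prod (hN : IsPoissonRandomMeasure P N m)
    {ι : Type*} (s : Finset ι) {A : ι → Set Z} (hA : DisjointFamily m A) :
    HasAllMoments P fun ω => ∏ i ∈ s, compensated N m (A i) ω :=
  HasAllMoments.prod s fun i _ => hN.hasAllMoments_compensated (hA.1 i) (hA.2 i)

/-- Wick-type recursion: expand the first factor over the sets of the second family. -/
theorem IsPoissonRandomMeasure.integral_prod_mul_prod_succ (hN : IsPoissonRandomMeasure P N m)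
    {n k : ℕ} {A : Fin (n + 1) → Set Z} {B : Fin k → Set Z} (hA : DisjointFamily m A)
    (hB : DisjointFamily m B) :
    ∫ ω, (∏ i, compensated N m (A i) ω) * ∏ j, compensated N m (B j) ω ∂P =
      ∑ l, (m (A 0 ∩ B l)).toReal * ∫ ω, (∏ i : Fin n, compensated N m (A i.succ) ω) *
        ∏ j ∈ Finset.univ.erase l, compensated N m (B j) ω ∂P := by
  have hA' : DisjointFamily m fun i : Fin n => A i.succ := hA.comp (Fin.succ_injective n)
  set R : Ω → ℝ := fun ω => (∏ i : Fin n, compensated N m (A i.succ) ω) *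
    ∏ j, compensated N m (B j) ω with hR
  set R' : Fin k → Ω → ℝ := fun l ω => (∏ i : Fin n, compensated N m (A i.succ) ω) *
    ∏ j ∈ Finset.univ.erase l, compensated N m (B j) ω with hR'
  have mR : HasAllMoments P R := (hN.hasAllMoments_prod _ hA').mul (hN.hasAllMoments_prod _ hB)
  have mR' : ∀ l, HasAllMoments P (R' l) := fun l =>
    (hN.hasAllMoments_prod _ hA').mul (hN.hasAllMoments_prod _ hB)
  have hA0 := hA.1 0
  have fin : ∀ S ⊆ A 0, m S ≠ ⊤ := fun S hS => measure_ne_top_of_subset hS (hA.2 0)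
  have dA : ∀ (S : Set Z), S ⊆ A 0 → DependsOnCompl N S fun ω =>
      ∏ i : Fin n, compensated N m (A i.succ) ω := fun S hS =>
    DependsOnCompl.prod _ fun i _ => DependsOnCompl.compensated (hA.1 _)
      ((hA.3 (Fin.succ_ne_zero i).symm).mono_left hS)
  have hU : MeasurableSet (A 0 \ ⋃ j, B j) := hA0.diff (MeasurableSet.iUnion hB.1)
  -- A centred factor independent of all the others makes the expectation vanish.
  have zero : ∀ (S : Set Z) (Y : Ω → ℝ), MeasurableSet S → S ⊆ A 0 → DependsOnCompl N S Y →
      ∫ ω, compensated N m S ω * Y ω ∂P = 0 := by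
    intro S Y hS hSA hY
    rw [hY.integral_mul hN hS (f := fun x => x) measurable_id,
      hN.integral_compensated hS (fin S hSA), zero_mul]
  have h0 : ∫ ω, compensated N m (A 0 \ ⋃ j, B j) ω * R ω ∂P = 0 := by
    refine zero _ _ hU Set.sdiff_subset ((dA _ Set.sdiff_subset).mul ?_)
    refine DependsOnCompl.prod _ fun j _ => DependsOnCompl.compensated (hB.1 j) ?_
    exact Set.disjoint_left.2 fun z hz hz' => hz.2 (Set.mem_iUnion.2 ⟨j, hz'⟩)
  have hl : ∀ l, ∫ ω, compensated N m (A 0 ∩ B l) ω * R ω ∂P =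
      (m (A 0 ∩ B l)).toReal * ∫ ω, R' l ω ∂P := by
    intro l
    have hC : MeasurableSet (A 0 ∩ B l) := hA0.inter (hB.1 l)
    have dR' : DependsOnCompl N (A 0 ∩ B l) (R' l) := by
      refine (dA _ Set.inter_subset_left).mul (DependsOnCompl.prod _ fun j hj =>
        DependsOnCompl.compensated (hB.1 j) ?_)
      exact (hB.3 (Finset.ne_of_mem_erase hj).symm).mono_left Set.inter_subset_right
    have hD : MeasurableSet (B l \ A 0) := (hB.1 l).diff hA0
    have hDt : m (B l \ A 0) ≠ ⊤ := measure_ne_top_of_subset Set.sdiff_subset (hB.2 l)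
    have e := hN.compensated_eq_add_sum (ι := Unit) (B := fun _ => A 0) (hB.1 l) (hB.2 l)
      (fun _ => hA0) (fun i j h => absurd rfl h)
    -- Of the factors in `R`, only `N̂(B l)` depends on `A 0 ∩ B l`. Splitting it along `A 0` gives
    -- a cross term of mean zero and the square `N̂(A 0 ∩ B l)²`, whose mean is `m(A 0 ∩ B l)`.
    have e2 : (fun ω => compensated N m (A 0 ∩ B l) ω * R ω) =ᵐ[P] fun ω =>
        compensated N m (A 0 ∩ B l) ω * (compensated N m (B l \ A 0) ω * R' l ω) +
        (compensated N m (A 0 ∩ B l) ω * compensated N m (A 0 ∩ B l) ω) * R' l ω := by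
      filter_upwards [e] with ω hω
      simp only [Set.iUnion_const, Finset.univ_unique, Finset.sum_singleton] at hω
      rw [hR, hR']
      simp only
      rw [← Finset.mul_prod_erase Finset.univ (fun j => compensated N m (B j) ω)
        (Finset.mem_univ l), hω, Set.inter_comm (B l)]
      ring
    have mC := hN.hasAllMoments_compensated hC (fin _ Set.inter_subset_left)
    have mD := hN.hasAllMoments_compensated hD hDt
    rw [integral_congr_ae e2, integral_add (mC.mul (mD.mul (mR' l))).integrable
      ((mC.mul mC).mul (mR' l)).integrable, zero _ _ hC Set.inter_subset_left
      ((DependsOnCompl.compensated hD (Set.disjoint_left.2 fun z hz hz' => hz'.2 hz.1)).mul dR'),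
      zero_add, dR'.integral_mul hN hC (f := fun x => x * x) (by fun_prop),
      hN.integral_compensated_sq hC (fin _ Set.inter_subset_left)]
  have e := hN.compensated_eq_add_sum (B := B) hA0 (hA.2 0) hB.1 hB.3
  have e1 : (fun ω => (∏ i, compensated N m (A i) ω) * ∏ j, compensated N m (B j) ω) =ᵐ[P]
      fun ω => compensated N m (A 0 \ ⋃ j, B j) ω * R ω +
        ∑ l, compensated N m (A 0 ∩ B l) ω * R ω := by
    filter_upwards [e] with ω hω
    rw [Fin.prod_univ_succ, hω, hR, ← Finset.sum_mul]
    ring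
  have iC : ∀ l ∈ Finset.univ, Integrable (fun ω => compensated N m (A 0 ∩ B l) ω * R ω) P :=
    fun l _ => ((hN.hasAllMoments_compensated (hA0.inter (hB.1 l))
      (fin _ Set.inter_subset_left)).mul mR).integrable
  rw [integral_congr_ae e1, integral_add ((hN.hasAllMoments_compensated hU
    (fin _ Set.sdiff_subset)).mul mR).integrable (integrable_finsetSum _ iC), h0, zero_add,
    integral_finsetSum _ iC]
  exact Finset.sum_congr rfl fun l _ => hl l

/-- The enumeration `j ↦ swap 0 l j.succ` of the indices other than `l` is the one built into
`Equiv.Perm.decomposeFin`, so that the recursion on `l` assembles into a sum over permutations. -/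
theorem prod_erase_eq_prod_swap {M : Type*} [CommMonoid M] {k : ℕ} (f : Fin (k + 1) → M)
    (l : Fin (k + 1)) :
    ∏ j ∈ Finset.univ.erase l, f j = ∏ j : Fin k, f (Equiv.swap 0 l j.succ) := by
  have h : Finset.univ.erase l = Finset.univ.image fun j : Fin k => Equiv.swap 0 l j.succ := by
    ext x
    simp only [Finset.mem_erase, Finset.mem_univ, and_true, Finset.mem_image, true_and]
    constructor
    · intro hx
      have : Equiv.swap 0 l x ≠ 0 := by
        rw [Ne, Equiv.swap_apply_eq_iff, Equiv.swap_apply_left]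
        exact hx
      obtain ⟨j, hj⟩ := Fin.exists_succ_eq.2 this
      exact ⟨j, by rw [hj, Equiv.swap_apply_self]⟩
    · rintro ⟨j, rfl⟩ h
      rw [Equiv.swap_apply_eq_iff, Equiv.swap_apply_right] at h
      exact Fin.succ_ne_zero j h
  rw [h, Finset.prod_image]
  intro a _ b _ hab
  simpa using hab

/-- Each recursion step removes one factor from either family. When the sizes differ, one family is
exhausted first, and the recursion for the other is then an empty sum. -/
theorem IsPoissonRandomMeasure.integral_prod_mul_prod_of_ne (hN : IsPoissonRandomMeasure P N m)
    {n k : ℕ} (hnk : n ≠ k) {A : Fin n → Set Z} {B : Fin k → Set Z} (hA : DisjointFamily m A)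
    (hB : DisjointFamily m B) :
    ∫ ω, (∏ i, compensated N m (A i) ω) * ∏ j, compensated N m (B j) ω ∂P = 0 := by
  induction n generalizing k with
  | zero =>
    obtain ⟨k, rfl⟩ := Nat.exists_eq_succ_of_ne_zero hnk.symm
    have := hN.integral_prod_mul_prod_succ hB hA
    rw [Finset.univ_eq_empty (α := Fin 0), Finset.sum_empty] at this
    rw [← this]
    exact integral_congr_ae (ae_of_all _ fun ω => mul_comm _ _)
  | succ n ih =>
    rw [hN.integral_prod_mul_prod_succ hA hB]
    refine Finset.sum_eq_zero fun l _ => ?_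
    cases k with
    | zero => exact l.elim0
    | succ k =>
      simp only [prod_erase_eq_prod_swap]
      rw [ih (fun h => hnk (by rw [h])) (hA.comp (Fin.succ_injective n))
        (hB.comp (f := fun j => Equiv.swap 0 l (Fin.succ j))
          ((Equiv.injective _).comp (Fin.succ_injective k))), mul_zero]

/-- In the recursion `l` is the partner of `A 0`, i.e. `σ 0`, and the induction hypothesis matches
the remaining sets. -/
theorem IsPoissonRandomMeasure.integral_prod_mul_prod (hN : IsPoissonRandomMeasure P N m)
    {n : ℕ} {A B : Fin n → Set Z} (hA : DisjointFamily m A) (hB : DisjointFamily m B) :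
    ∫ ω, (∏ i, compensated N m (A i) ω) * ∏ j, compensated N m (B j) ω ∂P =
      ∑ σ : Equiv.Perm (Fin n), ∏ j, (m (A j ∩ B (σ j))).toReal := by
  induction n with
  | zero => simp
  | succ n ih =>
    rw [hN.integral_prod_mul_prod_succ hA hB, ← Equiv.sum_comp Equiv.Perm.decomposeFin.symm,
      Fintype.sum_prod_type]
    refine Finset.sum_congr rfl fun l _ => ?_
    simp only [prod_erase_eq_prod_swap]
    rw [ih (hA.comp (Fin.succ_injective n))
        (hB.comp (f := fun j => Equiv.swap 0 l (Fin.succ j))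
          ((Equiv.injective _).comp (Fin.succ_injective n))), Finset.mul_sum]
    refine Finset.sum_congr rfl fun σ _ => ?_
    rw [Fin.prod_univ_succ]
    simp

/-! ### The isometry inequality and orthogonality for elementary integrals -/

namespace OffDiagElementary

variable {n : ℕ}

theorem disjointFamily (s : OffDiagElementary m n) (i : Fin s.card) :
    DisjointFamily m (s.side i) :=
  ⟨s.measurableSet_side i, s.measure_side_ne_top i, s.disjoint_side i⟩

theorem hasAllMoments_integral (hN : IsPoissonRandomMeasure P N m) (s : OffDiagElementary m n) :
    HasAllMoments P (s.integral N) :=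
  HasAllMoments.sum _ fun i _ => (HasAllMoments.const P _).mul
    (hN.hasAllMoments_prod _ (s.disjointFamily i))

theorem memLp_integral (hN : IsPoissonRandomMeasure P N m) (s : OffDiagElementary m n) :
    MemLp (s.integral N) 2 P := s.hasAllMoments_integral hN 2

theorem integral_mul_integral (hN : IsPoissonRandomMeasure P N m) {k : ℕ}
    (s : OffDiagElementary m n) (s' : OffDiagElementary m k) :
    ∫ ω, s.integral N ω * s'.integral N ω ∂P = ∑ i, ∑ i', s.coef i * s'.coef i' *
      ∫ ω, (∏ j, compensated N m (s.side i j) ω) * ∏ j, compensated N m (s'.side i' j) ω ∂P := by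
  have e : ∀ ω, s.integral N ω * s'.integral N ω = ∑ i, ∑ i', s.coef i * s'.coef i' *
      ((∏ j, compensated N m (s.side i j) ω) * ∏ j, compensated N m (s'.side i' j) ω) := by
    intro ω
    unfold integral
    rw [Finset.sum_mul_sum]
    refine Finset.sum_congr rfl fun i _ => Finset.sum_congr rfl fun i' _ => by ring
  have hi : ∀ i i', Integrable (fun ω => s.coef i * s'.coef i' *
      ((∏ j, compensated N m (s.side i j) ω) * ∏ j, compensated N m (s'.side i' j) ω)) P :=
    fun i i' => (((hN.hasAllMoments_prod _ (s.disjointFamily i)).mul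
      (hN.hasAllMoments_prod _ (s'.disjointFamily i'))).integrable).const_mul _
  simp_rw [e]
  rw [integral_finsetSum _ fun i _ => integrable_finsetSum _ fun i' _ => hi i i']
  refine Finset.sum_congr rfl fun i _ => ?_
  rw [integral_finsetSum _ fun i' _ => hi i i']
  exact Finset.sum_congr rfl fun i' _ => integral_const_mul _ _

theorem integral_mul_integral_of_ne (hN : IsPoissonRandomMeasure P N m) {k : ℕ} (hnk : n ≠ k)
    (s : OffDiagElementary m n) (s' : OffDiagElementary m k) :
    ∫ ω, s.integral N ω * s'.integral N ω ∂P = 0 := by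
  rw [s.integral_mul_integral hN]
  refine Finset.sum_eq_zero fun i _ => Finset.sum_eq_zero fun i' _ => ?_
  rw [hN.integral_prod_mul_prod_of_ne hnk (s.disjointFamily i) (s'.disjointFamily i'), mul_zero]

variable [SigmaFinite m]

theorem memLp_toFun (s : OffDiagElementary m n) (p : ℝ≥0∞) :
    MemLp s.toFun p (Measure.pi fun _ => m) := by
  unfold toFun
  refine memLp_finsetSum _ fun i _ => MemLp.const_mul ?_ _
  refine memLp_indicator_const p (MeasurableSet.univ_pi (s.measurableSet_side i)) 1 (.inr ?_)
  rw [Measure.pi_pi]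
  exact ENNReal.prod_ne_top fun j _ => s.measure_side_ne_top i j

theorem measurePreserving_comp_perm (σ : Equiv.Perm (Fin n)) :
    MeasurePreserving (fun z : Fin n → Z => fun j => z (σ j))
      (Measure.pi fun _ => m) (Measure.pi fun _ => m) :=
  measurePreserving_arrowCongr' (fun _ => m) (fun _ => m) σ.symm (MeasurableEquiv.refl Z)
    fun _ => MeasurePreserving.id m

theorem indicator_pi_eq_prod (A : Fin n → Set Z) (z : Fin n → Z) :
    (Set.univ.pi A).indicator (fun _ => (1 : ℝ)) z =
      ∏ j, (A j).indicator (fun _ => (1 : ℝ)) (z j) := by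
  classical
  by_cases h : ∀ j, z j ∈ A j
  · rw [Set.indicator_of_mem (by simpa [Set.mem_univ_pi] using h)]
    exact (Finset.prod_eq_one fun j _ => Set.indicator_of_mem (h j) _).symm
  · rw [Set.indicator_of_notMem (by simpa [Set.mem_univ_pi] using h)]
    push Not at h
    obtain ⟨j, hj⟩ := h
    exact (Finset.prod_eq_zero (Finset.mem_univ j) (Set.indicator_of_notMem hj _)).symm

/-- The deterministic side of the Wick formula: pairing `s` with a coordinate permutation of itself
produces exactly the terms belonging to one `σ`. -/
theorem integral_toFun_mul_comp_perm (s : OffDiagElementary m n) (σ : Equiv.Perm (Fin n)) :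
    ∫ z, s.toFun z * s.toFun (fun j => z (σ.symm j)) ∂(Measure.pi fun _ => m) =
      ∑ i, ∑ i', s.coef i * s.coef i' * ∏ j, (m (s.side i j ∩ s.side i' (σ j))).toReal := by
  have e : ∀ z : Fin n → Z, s.toFun z * s.toFun (fun j => z (σ.symm j)) =
      ∑ i, ∑ i', s.coef i * s.coef i' *
        ∏ j, (s.side i j ∩ s.side i' (σ j)).indicator (fun _ => (1 : ℝ)) (z j) := by
    intro z
    unfold toFun
    rw [Finset.sum_mul_sum]
    refine Finset.sum_congr rfl fun i _ => Finset.sum_congr rfl fun i' _ => ?_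
    rw [indicator_pi_eq_prod, indicator_pi_eq_prod,
      ← Equiv.prod_comp σ fun j => (s.side i' j).indicator (fun _ => (1 : ℝ)) (z (σ.symm j))]
    simp only [Equiv.symm_apply_apply, Set.inter_indicator_one, ← Pi.one_def]
    simp only [Pi.one_def, Pi.mul_apply, Finset.prod_mul_distrib]
    ring
  have hi : ∀ i i', Integrable (fun z : Fin n → Z => s.coef i * s.coef i' *
        ∏ j, (s.side i j ∩ s.side i' (σ j)).indicator (fun _ => (1 : ℝ)) (z j))
        (Measure.pi fun _ => m) := by
    intro i i'
    refine (Integrable.fintype_prod fun j => ?_).const_mul _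
    exact (integrable_indicator_iff ((s.measurableSet_side i j).inter
      (s.measurableSet_side i' (σ j)))).2 (integrableOn_const
        (measure_ne_top_of_subset Set.inter_subset_left (s.measure_side_ne_top i j)) (by simp))
  simp_rw [e]
  rw [integral_finsetSum _ fun i _ => integrable_finsetSum _ fun i' _ => hi i i']
  refine Finset.sum_congr rfl fun i _ => ?_
  rw [integral_finsetSum _ fun i' _ => hi i i']
  refine Finset.sum_congr rfl fun i' _ => ?_
  rw [integral_const_mul, integral_fintype_prod_eq_prod]
  congr 1
  refine Finset.prod_congr rfl fun j _ => ?_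
  rw [integral_indicator_const _ ((s.measurableSet_side i j).inter
      (s.measurableSet_side i' (σ j)))]
  simp [measureReal_def]

/-- The integral of an elementary function is bounded in `L²` by `n!` times its norm. -/
theorem integral_integral_sq_le (hN : IsPoissonRandomMeasure P N m) (s : OffDiagElementary m n) :
    ∫ ω, s.integral N ω * s.integral N ω ∂P ≤
      n.factorial * ∫ z, s.toFun z * s.toFun z ∂(Measure.pi fun _ => m) := by
  have h1 : ∫ ω, s.integral N ω * s.integral N ω ∂P = ∑ σ : Equiv.Perm (Fin n),
      ∫ z, s.toFun z * s.toFun (fun j => z (σ.symm j)) ∂(Measure.pi fun _ => m) := by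
    simp_rw [integral_toFun_mul_comp_perm, s.integral_mul_integral hN]
    conv_rhs => rw [Finset.sum_comm]
    refine Finset.sum_congr rfl fun i _ => ?_
    conv_rhs => rw [Finset.sum_comm]
    refine Finset.sum_congr rfl fun i' _ => ?_
    rw [hN.integral_prod_mul_prod (s.disjointFamily i) (s.disjointFamily i'), Finset.mul_sum]
  rw [h1]
  -- From `ab ≤ (a² + b²)/2` and the invariance of the product measure under permutations; each of
  -- the `n!` terms is at most `‖s‖²`, so no symmetrization of the kernel is needed.
  have h2 : ∀ σ ∈ (Finset.univ : Finset (Equiv.Perm (Fin n))),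
      ∫ z, s.toFun z * s.toFun (fun j => z (σ.symm j)) ∂(Measure.pi fun _ => m) ≤
        ∫ z, s.toFun z * s.toFun z ∂(Measure.pi fun _ => m) := by
    intro σ _
    have mp := measurePreserving_comp_perm (m := m) σ.symm
    have m1 := s.memLp_toFun 2
    have m2 : MemLp (fun z : Fin n → Z => s.toFun fun j => z (σ.symm j)) 2
        (Measure.pi fun _ => m) := m1.comp_measurePreserving mp
    have i1 : Integrable (fun z => s.toFun z * s.toFun z) (Measure.pi fun _ => m) :=
      m1.integrable_mul m1
    have i2 : Integrable (fun z : Fin n → Z => s.toFun (fun j => z (σ.symm j)) *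
      s.toFun fun j => z (σ.symm j)) (Measure.pi fun _ => m) := m2.integrable_mul m2
    have e2 : ∫ z : Fin n → Z, s.toFun (fun j => z (σ.symm j)) *
        s.toFun (fun j => z (σ.symm j)) ∂(Measure.pi fun _ => m) =
        ∫ z, s.toFun z * s.toFun z ∂(Measure.pi fun _ => m) :=
      mp.integral_comp' (f := MeasurableEquiv.arrowCongr' σ (MeasurableEquiv.refl Z))
        fun z => s.toFun z * s.toFun z
    calc _ ≤ ∫ z : Fin n → Z, (2⁻¹ * (s.toFun z * s.toFun z) +
          2⁻¹ * (s.toFun (fun j => z (σ.symm j)) * s.toFun fun j => z (σ.symm j)))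
          ∂(Measure.pi fun _ => m) := by
            refine integral_mono (m1.integrable_mul m2)
              ((i1.const_mul _).add (i2.const_mul _)) fun z => ?_
            simp only
            nlinarith [sq_nonneg (s.toFun z - s.toFun fun j => z (σ.symm j))]
      _ = _ := by
        rw [integral_add (i1.const_mul _) (i2.const_mul _), integral_const_mul,
          integral_const_mul, e2]
        ring
  refine (Finset.sum_le_sum h2).trans ?_
  simp [Fintype.card_perm]

end OffDiagElementary

end PoissonIsometry


/-! ### The vector space of elementary functions -/

section Elementary

variable {Ω Z : Type*} [MeasurableSpace Ω] [MeasurableSpace Z] {m : Measure Z} {n : ℕ}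

namespace OffDiagElementary

/-- The elementary function `0`. -/
def zero (m : Measure Z) (n : ℕ) : OffDiagElementary m n where
  card := 0
  coef := Fin.elim0
  side := fun i => i.elim0
  measurableSet_side := fun i => i.elim0
  measure_side_ne_top := fun i => i.elim0
  disjoint_side := fun i => i.elim0

/-- The elementary function `s + c s'`. -/
def addSMul (s : OffDiagElementary m n) (c : ℝ) (s' : OffDiagElementary m n) :
    OffDiagElementary m n where
  card := s.card + s'.card
  coef := Fin.append s.coef fun i => c * s'.coef i
  side := Fin.append s.side s'.side
  measurableSet_side := fun i => by
    refine Fin.addCases (fun i => ?_) (fun i => ?_) i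
    · simpa using s.measurableSet_side i
    · simpa using s'.measurableSet_side i
  measure_side_ne_top := fun i => by
    refine Fin.addCases (fun i => ?_) (fun i => ?_) i
    · simpa using s.measure_side_ne_top i
    · simpa using s'.measure_side_ne_top i
  disjoint_side := fun i => by
    refine Fin.addCases (fun i => ?_) (fun i => ?_) i
    · simpa using s.disjoint_side i
    · simpa using s'.disjoint_side i

/-- The indicator function of a rectangle. -/
def rectangle {A : Fin n → Set Z} (hA : DisjointFamily m A) : OffDiagElementary m n where
  card := 1
  coef := fun _ => 1
  side := fun _ => A
  measurableSet_side := fun _ => hA.1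
  measure_side_ne_top := fun _ => hA.2
  disjoint_side := fun _ => hA.3

theorem toFun_zero : (zero m n).toFun = 0 := by
  ext z
  exact Finset.sum_of_isEmpty (ι := Fin 0) _

theorem toFun_addSMul (s : OffDiagElementary m n) (c : ℝ) (s' : OffDiagElementary m n) :
    (s.addSMul c s').toFun = fun z => s.toFun z + c * s'.toFun z := by
  ext z
  unfold toFun addSMul
  rw [Fin.sum_univ_add, Finset.mul_sum]
  simp [mul_assoc]

theorem integral_addSMul (s : OffDiagElementary m n) (c : ℝ) (s' : OffDiagElementary m n)
    (N : Ω → Measure Z) :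
    (s.addSMul c s').integral N = fun ω => s.integral N ω + c * s'.integral N ω := by
  ext z
  unfold integral addSMul
  rw [Fin.sum_univ_add, Finset.mul_sum]
  simp [mul_assoc]

theorem toFun_rectangle {A : Fin n → Set Z} (hA : DisjointFamily m A) :
    (rectangle hA).toFun = (Set.univ.pi A).indicator fun _ => (1 : ℝ) := by
  ext z
  exact (Fin.sum_univ_one _).trans (one_mul _)

end OffDiagElementary

/-! ### Density of the elementary functions -/

variable [SigmaFinite m]

/-- The elementary functions as a subspace of `L²(Z^n, m^n)`. -/
def elementarySubmodule (m : Measure Z) [SigmaFinite m] (n : ℕ) :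
    Submodule ℝ (Lp ℝ 2 (Measure.pi fun _ : Fin n => m)) where
  carrier := {F | ∃ s : OffDiagElementary m n, F =ᵐ[Measure.pi fun _ : Fin n => m] s.toFun}
  zero_mem' := ⟨.zero m n, by
    rw [OffDiagElementary.toFun_zero]
    exact Lp.coeFn_zero _ _ _⟩
  add_mem' := by
    rintro F G ⟨s, hs⟩ ⟨s', hs'⟩
    refine ⟨s.addSMul 1 s', ?_⟩
    filter_upwards [Lp.coeFn_add F G, hs, hs'] with z h1 h2 h3
    rw [h1, OffDiagElementary.toFun_addSMul, Pi.add_apply, h2, h3]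
    simp
  smul_mem' := by
    rintro c F ⟨s, hs⟩
    refine ⟨(OffDiagElementary.zero m n).addSMul c s, ?_⟩
    filter_upwards [Lp.coeFn_smul c F, hs] with z h1 h2
    rw [h1, OffDiagElementary.toFun_addSMul, OffDiagElementary.toFun_zero, Pi.smul_apply, h2]
    simp

/-- With all coordinates but the `i`-th fixed, the slice of the diagonal is a single point, which is
null. -/
theorem measure_pi_diagonal [MeasurableEq Z] [NullSingletonClass m] {i j : Fin n} (hij : i ≠ j) :
    (Measure.pi fun _ : Fin n => m) {z | z i = z j} = 0 := by
  cases n with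
  | zero => exact i.elim0
  | succ n =>
    obtain ⟨k, rfl⟩ := Fin.exists_succAbove_eq hij.symm
    have mp := measurePreserving_piFinSuccAbove (fun _ : Fin (n + 1) => m) i
    have hm : MeasurableSet {p : Z × (Fin n → Z) | p.1 = p.2 k} :=
      measurableSet_eq_fun measurable_fst ((measurable_pi_apply k).comp measurable_snd)
    have h := mp.measure_preimage hm.nullMeasurableSet
    have hs : MeasurableSet {p : (Fin n → Z) × Z | p.1 k = p.2} :=
      measurableSet_eq_fun ((measurable_pi_apply k).comp measurable_fst) measurable_snd
    have h0 : (m.prod (Measure.pi fun _ : Fin n => m)) {p : Z × (Fin n → Z) | p.1 = p.2 k} = 0 := by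
      rw [← Measure.prod_swap, Measure.map_apply measurable_swap hm]
      refine (Measure.measure_prod_null (measurable_swap hm)).2 (ae_of_all _ fun w => ?_)
      have : Prod.mk w ⁻¹' (Prod.swap ⁻¹' {p : Z × (Fin n → Z) | p.1 = p.2 k}) = {w k} := by
        ext z; simp
      simp only [this, measure_singleton, Pi.zero_apply]
    rw [h0] at h
    exact h

/-- Inside an off-diagonal rectangle every subrectangle again has disjoint sides, and these form a
π-system generating the product σ-algebra. A π-λ argument then makes all set integrals of `f` there
vanish. -/
theorem DisjointFamily.ae_restrict_eq_zero {A : Fin n → Set Z} (hA : DisjointFamily m A)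
    {f : (Fin n → Z) → ℝ} (hf : MemLp f 2 (Measure.pi fun _ => m))
    (h0 : ∀ B : Fin n → Set Z, DisjointFamily m B →
      ∫ z in Set.univ.pi B, f z ∂(Measure.pi fun _ => m) = 0) :
    ∀ᵐ z ∂((Measure.pi fun _ => m).restrict (Set.univ.pi A)), f z = 0 := by
  set μ := Measure.pi fun _ : Fin n => m
  have fin : μ (Set.univ.pi A) < ⊤ := by
    rw [Measure.pi_pi]
    exact ENNReal.prod_lt_top fun j _ => (hA.2 j).lt_top
  have : IsFiniteMeasure (μ.restrict (Set.univ.pi A)) := ⟨by simpa using fin⟩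
  have hi : Integrable f (μ.restrict (Set.univ.pi A)) := (hf.restrict _).integrable (by norm_num)
  have hu : ∫ z in Set.univ.pi A, f z ∂μ = 0 := h0 A hA
  refine hi.ae_eq_zero_of_forall_setIntegral_eq_zero fun s hs _ => ?_
  refine MeasurableSpace.induction_on_inter
    (C := fun s _ => ∫ z in s, f z ∂(μ.restrict (Set.univ.pi A)) = 0)
    generateFrom_pi.symm isPiSystem_pi (by simp) ?_ ?_ ?_ s hs
  · rintro _ ⟨B, hB, rfl⟩
    have hB' : ∀ j, MeasurableSet (B j) := fun j => hB j (Set.mem_univ j)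
    rw [Measure.restrict_restrict (MeasurableSet.univ_pi hB'), ← Set.pi_inter_distrib]
    refine h0 _ ⟨fun j => (hB' j).inter (hA.1 j), fun j => ?_, fun i j hij => ?_⟩
    · exact measure_ne_top_of_subset Set.inter_subset_right (hA.2 j)
    · exact (hA.3 hij).mono Set.inter_subset_right Set.inter_subset_right
  · intro t ht ih
    rw [setIntegral_compl ht hi, ih, hu, sub_zero]
  · intro s hd hs ih
    have := hasSum_integral_iUnion hs hd hi.integrableOn
    simp only [ih] at this
    exact this.unique hasSum_zero

variable [TopologicalSpace Z] [T2Space Z] [SecondCountableTopology Z] [BorelSpace Z]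
  [NullSingletonClass m]

/-- A function orthogonal to all elementary ones vanishes almost everywhere on each off-diagonal
rectangle; countably many of these cover the complement of the diagonals, which are null. -/
theorem elementarySubmodule_topologicalClosure :
    (elementarySubmodule m n).topologicalClosure = ⊤ := by
  rw [Submodule.topologicalClosure_eq_top_iff, Submodule.eq_bot_iff]
  intro F hF
  have h0 : ∀ B : Fin n → Set Z, DisjointFamily m B →
      ∫ z in Set.univ.pi B, F z ∂(Measure.pi fun _ => m) = 0 := by
    intro B hB
    have h := hF (((OffDiagElementary.rectangle hB).memLp_toFun 2).toLp _)
      ⟨OffDiagElementary.rectangle hB, MemLp.coeFn_toLp _⟩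
    rw [L2.inner_def] at h
    rw [← h, ← integral_indicator (MeasurableSet.univ_pi hB.1)]
    refine integral_congr_ae ?_
    filter_upwards [((OffDiagElementary.rectangle hB).memLp_toFun 2).coeFn_toLp] with z hz
    rw [hz, OffDiagElementary.toFun_rectangle]
    by_cases h : z ∈ Set.univ.pi B <;> simp [h]
  -- Distinct coordinates are separated by disjoint basic open sets; cutting with one spanning set,
  -- with `k` large enough for all coordinates, makes the sides of finite measure. The pairs `(U,
  -- k)` range over a countable set.
  have hcover : ∀ z : Fin n → Z, (Pairwise fun i j => z i ≠ z j) →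
      ∃ (U : Fin n → TopologicalSpace.countableBasis Z) (k : ℕ),
        (Pairwise fun i j => Disjoint ((U i).1 ∩ spanningSets m k) ((U j).1 ∩ spanningSets m k)) ∧
        z ∈ Set.univ.pi fun i => (U i).1 ∩ spanningSets m k := by
    intro z hz
    have hinj : Function.Injective z := fun i j h => by
      by_contra hne
      exact hz hne h
    obtain ⟨V, hV, hVd⟩ := (Set.finite_range z).t2_separation
    have hb := TopologicalSpace.isBasis_countableBasis Z
    have hU : ∀ i, ∃ u : TopologicalSpace.countableBasis Z, z i ∈ u.1 ∧ u.1 ⊆ V (z i) := by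
      intro i
      obtain ⟨u, hu, h1, h2⟩ := hb.exists_subset_of_mem_open (hV (z i)).1 (hV (z i)).2
      exact ⟨⟨u, hu⟩, h1, h2⟩
    choose U hU1 hU2 using hU
    refine ⟨U, Finset.univ.sup fun i => spanningSetsIndex m (z i), fun i j hij => ?_, ?_⟩
    · have := hVd (Set.mem_range_self i) (Set.mem_range_self j) (hinj.ne hij)
      exact this.mono (Set.inter_subset_left.trans (hU2 i)) (Set.inter_subset_left.trans (hU2 j))
    · refine fun i _ => ⟨hU1 i, ?_⟩
      exact monotone_spanningSets m (Finset.le_sup (f := fun i => spanningSetsIndex m (z i))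
        (Finset.mem_univ i)) (mem_spanningSetsIndex m (z i))
  have hnull : ∀ᵐ z ∂(Measure.pi fun _ : Fin n => m), Pairwise fun i j => z i ≠ z j := by
    simp only [Pairwise, ae_all_iff]
    intro i j hij
    exact measure_eq_zero_iff_ae_notMem.1 (measure_pi_diagonal hij)
  have hz : ∀ (U : Fin n → TopologicalSpace.countableBasis Z) (k : ℕ),
      ∀ᵐ z ∂(Measure.pi fun _ : Fin n => m),
        (Pairwise fun i j => Disjoint ((U i).1 ∩ spanningSets m k) ((U j).1 ∩ spanningSets m k)) →
        z ∈ (Set.univ.pi fun i => (U i).1 ∩ spanningSets m k) → F z = 0 := by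
    intro U k
    by_cases hd : Pairwise fun i j => Disjoint ((U i).1 ∩ spanningSets m k)
      ((U j).1 ∩ spanningSets m k)
    · have hA : DisjointFamily m fun i => (U i).1 ∩ spanningSets m k := by
        refine ⟨fun i => ?_, fun i => ?_, hd⟩
        · exact ((TopologicalSpace.isOpen_of_mem_countableBasis (U i).2).measurableSet).inter
            (measurableSet_spanningSets m k)
        · exact measure_ne_top_of_subset Set.inter_subset_right
            (measure_spanningSets_lt_top m k).ne
      have := (ae_restrict_iff' (MeasurableSet.univ_pi hA.1)).1
        (hA.ae_restrict_eq_zero (Lp.memLp F) h0)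
      filter_upwards [this] with z hz _ using hz
    · exact ae_of_all _ fun z h => absurd h hd
  have hz' := ae_all_iff.2 fun U => ae_all_iff.2 fun k => hz U k
  refine (Lp.eq_zero_iff_ae_eq_zero).2 ?_
  filter_upwards [hnull, hz'] with z h1 h2
  obtain ⟨U, k, hd, hzU⟩ := hcover z h1
  exact h2 U k hd hzU

end Elementary

/-! ### Multiple Poisson integrals -/

section MultipleIntegral

variable {Ω Z : Type*} [MeasurableSpace Ω] [MeasurableSpace Z] {m : Measure Z} [SigmaFinite m]
  {n : ℕ} {P : Measure Ω} [IsProbabilityMeasure P] {N : Ω → Measure Z}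

theorem norm_toLp_two_sq {α : Type*} [MeasurableSpace α] {μ : Measure α} {f : α → ℝ}
    (hf : MemLp f 2 μ) : ‖hf.toLp f‖ ^ 2 = ∫ z, f z * f z ∂μ := by
  rw [← real_inner_self_eq_norm_sq, L2.inner_def]
  refine integral_congr_ae ?_
  filter_upwards [hf.coeFn_toLp] with z hz
  rw [hz]
  simp [sq]

theorem inner_toLp_two {α : Type*} [MeasurableSpace α] {μ : Measure α} {f g : α → ℝ}
    (hf : MemLp f 2 μ) (hg : MemLp g 2 μ) :
    inner ℝ (hf.toLp f) (hg.toLp g) = ∫ z, f z * g z ∂μ := by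
  rw [L2.inner_def]
  refine integral_congr_ae ?_
  filter_upwards [hf.coeFn_toLp, hg.coeFn_toLp] with z hz hz'
  rw [hz, hz']
  simp [mul_comm]

theorem OffDiagElementary.norm_integral_le (hN : IsPoissonRandomMeasure P N m)
    (s : OffDiagElementary m n) :
    ‖(s.memLp_integral hN).toLp (s.integral N)‖ ≤
      √n.factorial * ‖(s.memLp_toFun 2).toLp s.toFun‖ := by
  refine le_of_sq_le_sq ?_ (by positivity)
  rw [mul_pow, Real.sq_sqrt (by positivity), norm_toLp_two_sq, norm_toLp_two_sq]
  exact s.integral_integral_sq_le hN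

namespace IsMultipleIntegral

variable {f f' : (Fin n → Z) → ℝ} {Y Y' : Ω → ℝ}

/-- Multiple integrals in terms of convergence in `L²` spaces. -/
theorem iff_tendsto_toLp (hN : IsPoissonRandomMeasure P N m)
    (hf : MemLp f 2 (Measure.pi fun _ => m)) (hY : MemLp Y 2 P) :
    IsMultipleIntegral P N m n f Y ↔ ∃ s : ℕ → OffDiagElementary m n,
      Tendsto (fun k => ((s k).memLp_toFun 2).toLp (s k).toFun) atTop (𝓝 (hf.toLp f)) ∧
      Tendsto (fun k => ((s k).memLp_integral hN).toLp ((s k).integral N)) atTop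
        (𝓝 (hY.toLp Y)) := by
  unfold IsMultipleIntegral
  simp only [hf, hY, true_and]
  refine exists_congr fun s => and_congr ?_ ?_
  · rw [Lp.tendsto_Lp_iff_tendsto_eLpNorm'' (fun k => (s k).toFun)
      (fun k => (s k).memLp_toFun 2)]
    exact tendsto_congr fun k => eLpNorm_sub_comm f (s k).toFun 2 _
  · rw [Lp.tendsto_Lp_iff_tendsto_eLpNorm'' (fun k => (s k).integral N)
      (fun k => (s k).memLp_integral hN)]
    exact tendsto_congr fun k => eLpNorm_sub_comm Y ((s k).integral N) 2 P

theorem norm_le (hN : IsPoissonRandomMeasure P N m) (h : IsMultipleIntegral P N m n f Y) :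
    ‖h.2.1.toLp Y‖ ≤ √n.factorial * ‖h.1.toLp f‖ := by
  obtain ⟨s, h1, h2⟩ := (iff_tendsto_toLp hN h.1 h.2.1).1 h
  exact le_of_tendsto_of_tendsto' h2.norm (h1.norm.const_mul _) fun k => (s k).norm_integral_le hN

theorem inner_eq_zero (hN : IsPoissonRandomMeasure P N m) {k : ℕ} (hnk : n ≠ k)
    {g : (Fin k → Z) → ℝ} (h : IsMultipleIntegral P N m n f Y)
    (h' : IsMultipleIntegral P N m k g Y') :
    inner ℝ (h.2.1.toLp Y) (h'.2.1.toLp Y') = 0 := by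
  obtain ⟨s, -, h2⟩ := (iff_tendsto_toLp hN h.1 h.2.1).1 h
  obtain ⟨s', -, h2'⟩ := (iff_tendsto_toLp hN h'.1 h'.2.1).1 h'
  refine tendsto_nhds_unique (h2.inner (𝕜 := ℝ) h2') ?_
  refine tendsto_const_nhds.congr fun k => ?_
  rw [inner_toLp_two, (s k).integral_mul_integral_of_ne hN hnk]

theorem sub (hN : IsPoissonRandomMeasure P N m) (h : IsMultipleIntegral P N m n f Y)
    (h' : IsMultipleIntegral P N m n f' Y') : IsMultipleIntegral P N m n (f - f') (Y - Y') := by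
  obtain ⟨s, h1, h2⟩ := (iff_tendsto_toLp hN h.1 h.2.1).1 h
  obtain ⟨s', h1', h2'⟩ := (iff_tendsto_toLp hN h'.1 h'.2.1).1 h'
  refine (iff_tendsto_toLp hN (h.1.sub h'.1) (h.2.1.sub h'.2.1)).2
    ⟨fun k => (s k).addSMul (-1) (s' k), ?_, ?_⟩
  · rw [MemLp.toLp_sub h.1 h'.1]
    refine (h1.sub h1').congr fun k => ?_
    rw [← MemLp.toLp_sub]
    refine MemLp.toLp_congr _ _ (ae_of_all _ fun z => ?_)
    rw [OffDiagElementary.toFun_addSMul]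
    simp [sub_eq_add_neg]
  · rw [MemLp.toLp_sub h.2.1 h'.2.1]
    refine (h2.sub h2').congr fun k => ?_
    rw [← MemLp.toLp_sub]
    refine MemLp.toLp_congr _ _ (ae_of_all _ fun z => ?_)
    rw [OffDiagElementary.integral_addSMul]
    simp [sub_eq_add_neg]

/-- By linearity `Y - Y'` is an integral of a null kernel, and the norm bound forces it to be zero,
whichever approximating sequences were used. -/
theorem ae_eq (hN : IsPoissonRandomMeasure P N m) (h : IsMultipleIntegral P N m n f Y)
    (h' : IsMultipleIntegral P N m n f' Y') (hff' : f =ᵐ[Measure.pi fun _ => m] f') :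
    Y =ᵐ[P] Y' := by
  have h3 := h.sub hN h'
  have h4 := h3.norm_le hN
  have h5 : h3.1.toLp (f - f') = 0 := by
    rw [MemLp.toLp_sub h.1 h'.1, MemLp.toLp_congr h.1 h'.1 hff', sub_self]
  rw [h5, norm_zero, mul_zero, MemLp.toLp_sub h.2.1 h'.2.1, norm_le_zero_iff, sub_eq_zero] at h4
  exact (MemLp.toLp_eq_toLp_iff h.2.1 h'.2.1).1 h4

variable [TopologicalSpace Z] [T2Space Z] [SecondCountableTopology Z] [BorelSpace Z]
  [NullSingletonClass m]

/-- Every square integrable kernel has a multiple integral. -/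
theorem exists_of_memLp (hN : IsPoissonRandomMeasure P N m)
    (hf : MemLp f 2 (Measure.pi fun _ => m)) : ∃ Y, IsMultipleIntegral P N m n f Y := by
  have hd : hf.toLp f ∈ closure (elementarySubmodule m n : Set _) := by
    rw [← Submodule.topologicalClosure_coe, elementarySubmodule_topologicalClosure]
    trivial
  obtain ⟨F, hF, hlim⟩ := mem_closure_iff_seq_limit.1 hd
  choose s hs' using hF
  have hs : ∀ k, ((s k).memLp_toFun 2).toLp (s k).toFun = F k := fun k =>
    Lp.ext (((s k).memLp_toFun 2).coeFn_toLp.trans (hs' k).symm)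
  -- The bound by `√n!` times the `L²` norm, applied to differences `s a - s b`, carries the Cauchy
  -- property from the kernels to the integrals.
  have hc : CauchySeq fun k => ((s k).memLp_integral hN).toLp ((s k).integral N) := by
    have hF' := hlim.cauchySeq
    rw [Metric.cauchySeq_iff] at hF' ⊢
    intro ε hε
    have hpos : 0 < √(n.factorial : ℝ) := Real.sqrt_pos.2 (by positivity)
    obtain ⟨K, hK⟩ := hF' (ε / √n.factorial) (div_pos hε hpos)
    refine ⟨K, fun a ha b hb => ?_⟩
    have h1 := hK a ha b hb
    have h2 := ((s a).addSMul (-1) (s b)).norm_integral_le hN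
    have e1 : ((((s a).addSMul (-1) (s b)).memLp_toFun 2).toLp _) = F a - F b := by
      rw [← hs a, ← hs b, ← MemLp.toLp_sub]
      refine MemLp.toLp_congr _ _ (ae_of_all _ fun z => ?_)
      rw [OffDiagElementary.toFun_addSMul]
      simp [sub_eq_add_neg]
    have e2 : ((((s a).addSMul (-1) (s b)).memLp_integral hN).toLp _) =
        ((s a).memLp_integral hN).toLp ((s a).integral N) -
          ((s b).memLp_integral hN).toLp ((s b).integral N) := by
      rw [← MemLp.toLp_sub]
      refine MemLp.toLp_congr _ _ (ae_of_all _ fun z => ?_)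
      rw [OffDiagElementary.integral_addSMul]
      simp [sub_eq_add_neg]
    rw [e1, e2] at h2
    rw [dist_eq_norm] at h1 ⊢
    rw [lt_div_iff₀' hpos] at h1
    exact h2.trans_lt h1
  obtain ⟨Y, hY⟩ := cauchySeq_tendsto_of_complete hc
  refine ⟨Y, (iff_tendsto_toLp hN hf (Lp.memLp Y)).2 ⟨s, ?_, ?_⟩⟩
  · exact hlim.congr fun k => (hs k).symm
  · rwa [Lp.toLp_coeFn]

end IsMultipleIntegral

end MultipleIntegral


/-! ### Product measures -/

section ProductMeasures

theorem lintegral_pi_succ {n : ℕ} {E : Type*} [MeasurableSpace E] (μ : Fin (n + 1) → Measure E)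
    [∀ i, SigmaFinite (μ i)] {F : (Fin (n + 1) → E) → ℝ≥0∞} (hF : Measurable F) :
    ∫⁻ x, F x ∂(Measure.pi μ) =
      ∫⁻ a, ∫⁻ w, F (Fin.cons a w) ∂(Measure.pi fun i : Fin n => μ i.succ) ∂(μ 0) := by
  have mp := (measurePreserving_piFinSuccAbove μ 0).symm
  have e : ∀ p : E × (Fin n → E), (MeasurableEquiv.piFinSuccAbove (fun _ => E) 0).symm p =
      (Fin.cons p.1 p.2 : Fin (n + 1) → E) := fun p => by
    simp [MeasurableEquiv.piFinSuccAbove_symm_apply, Fin.insertNthEquiv]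
  have hm : Measurable fun p : E × (Fin n → E) => F (Fin.cons p.1 p.2) := by
    simp_rw [← e]
    exact hF.comp (MeasurableEquiv.measurable _)
  rw [← mp.lintegral_comp_emb (MeasurableEquiv.measurableEmbedding _)]
  simp only [e]
  exact lintegral_prod _ hm.aemeasurable

theorem lintegral_fin_nat_prod_eq_prod {n : ℕ} {E : Type*} [MeasurableSpace E]
    (μ : Fin n → Measure E) [∀ i, SigmaFinite (μ i)] {f : Fin n → E → ℝ≥0∞}
    (hf : ∀ i, Measurable (f i)) :
    ∫⁻ x, ∏ i, f i (x i) ∂(Measure.pi μ) = ∏ i, ∫⁻ x, f i x ∂(μ i) := by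
  induction n with
  | zero => simp [lintegral_unique]
  | succ n ih =>
    have hm : ∀ {k : ℕ} {g : Fin k → E → ℝ≥0∞}, (∀ i, Measurable (g i)) →
        Measurable fun x : Fin k → E => ∏ i, g i (x i) := fun hg =>
      Finset.measurable_fun_prod _ fun i _ => (hg i).comp (measurable_pi_apply i)
    rw [lintegral_pi_succ μ (hm hf), Fin.prod_univ_succ]
    simp only [Fin.prod_univ_succ, Fin.cons_zero, Fin.cons_succ]
    simp_rw [lintegral_const_mul _ (hm fun i : Fin n => hf i.succ),
      ih (fun i => μ i.succ) fun i => hf i.succ]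
    rw [lintegral_mul_const _ (hf 0)]

theorem pi_withDensity {n : ℕ} {E : Type*} [MeasurableSpace E] (μ : Measure E) [SigmaFinite μ]
    {f : E → ℝ≥0∞} (hf : Measurable f) [SigmaFinite (μ.withDensity f)] :
    Measure.pi (fun _ : Fin n => μ.withDensity f) =
      (Measure.pi fun _ : Fin n => μ).withDensity fun x => ∏ i, f (x i) := by
  refine Measure.pi_eq fun s hs => ?_
  rw [withDensity_apply _ (MeasurableSet.univ_pi hs), Measure.restrict_pi_pi,
    lintegral_fin_nat_prod_eq_prod _ fun _ => hf]
  exact Finset.prod_congr rfl fun i _ => (withDensity_apply f (hs i)).symm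

theorem measurePreserving_uncurry_volume (n d : ℕ) :
    MeasurePreserving (fun (x : Fin n → Fin d → ℝ) (p : Σ _ : Fin n, Fin d) => x p.1 p.2)
      volume volume := by
  have hm : Measurable fun (x : Fin n → Fin d → ℝ) (p : Σ _ : Fin n, Fin d) => x p.1 p.2 := by
    fun_prop
  refine ⟨hm, (Measure.pi_eq fun s hs => ?_).symm⟩
  rw [Measure.map_apply hm (MeasurableSet.univ_pi hs)]
  have : (fun (x : Fin n → Fin d → ℝ) (p : Σ _ : Fin n, Fin d) => x p.1 p.2) ⁻¹' Set.univ.pi s =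
      Set.univ.pi fun i => Set.univ.pi fun j => s ⟨i, j⟩ := by
    ext x
    simp [Set.mem_pi, Sigma.forall]
  rw [this, volume_pi, Measure.pi_pi]
  simp_rw [volume_pi, Measure.pi_pi]
  exact (Fintype.prod_sigma fun p => volume (s p)).symm

/-- The identification of `(ℝ^d)^n` with `ℝ^{nd}` preserves Lebesgue measure. -/
theorem measurePreserving_toLp_Rnd (n d : ℕ) :
    MeasurePreserving (fun x : Fin n → Rd d => (WithLp.toLp 2 x : Rnd n d)) volume volume := by
  -- The map passes through flat coordinates indexed by pairs `(i, j)`: forget the inner norms,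
  -- uncurry, put the Euclidean norm on all coordinates, and curry back by a linear isometry.
  have h1 : MeasurePreserving (fun (x : Fin n → Rd d) (i : Fin n) => WithLp.ofLp (x i))
      volume volume :=
    volume_preserving_pi fun _ => PiLp.volume_preserving_ofLp (Fin d)
  have h2 := PiLp.volume_preserving_toLp (Σ _ : Fin n, Fin d)
  have h3 := (LinearIsometryEquiv.piLpCurry ℝ 2 fun (_ : Fin n) (_ : Fin d) => ℝ).measurePreserving
  exact h3.comp (h2.comp ((measurePreserving_uncurry_volume n d).comp h1))

theorem measurableEmbedding_toLp_Rnd (n d : ℕ) :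
    MeasurableEmbedding (fun x : Fin n → Rd d => (WithLp.toLp 2 x : Rnd n d)) :=
  (MeasurableEquiv.toLp 2 (Fin n → Rd d)).measurableEmbedding

end ProductMeasures


/-! ### Fourier transforms of Schwartz functions and of square integrable functions -/

section Fourier

variable {V : Type*} [NormedAddCommGroup V] [InnerProductSpace ℝ V] [FiniteDimensional ℝ V]
  [MeasurableSpace V] [BorelSpace V]

theorem fourierS_fourierSInv (φ : 𝓢(V, ℂ)) : fourierS (fourierSInv φ) = φ := by
  have h : 𝓕 (fourierSInv φ) =
      SchwartzMap.compCLMOfContinuousLinearEquiv ℂ (dilation V) φ := by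
    change 𝓕 (𝓕⁻ (SchwartzMap.compCLMOfContinuousLinearEquiv ℂ (dilation V) φ)) = _
    simp
  ext x
  change (𝓕 (fourierSInv φ)) ((dilation V).symm x) = φ x
  rw [h]
  change φ (dilation V ((dilation V).symm x)) = φ x
  simp

theorem fourierSInv_apply_eq_integral (φ : 𝓢(V, ℂ)) (ξ : V) :
    fourierSInv φ ξ =
      ∫ x, Complex.exp (2 * Real.pi * inner ℝ x ξ * Complex.I) * φ ((2 * Real.pi) • x) := by
  have h : fourierSInv φ ξ =
      (𝓕⁻ (SchwartzMap.compCLMOfContinuousLinearEquiv ℂ (dilation V) φ : V → ℂ)) ξ := by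
    rw [← SchwartzMap.fourierInv_coe]; rfl
  rw [h, Real.fourierInv_eq']
  refine integral_congr_ae (ae_of_all _ fun x => ?_)
  simp only [smul_eq_mul]
  push_cast
  rfl

theorem fourierSInv_apply (φ : 𝓢(V, ℂ)) (ξ : V) :
    fourierSInv φ ξ = (((2 * Real.pi) ^ Module.finrank ℝ V)⁻¹ : ℝ) *
      ∫ x, Complex.exp (Complex.I * (inner ℝ ξ x : ℝ)) * φ x := by
  have h := Measure.integral_comp_smul (volume : Measure V)
    (fun x => Complex.exp (Complex.I * (inner ℝ ξ x : ℝ)) * φ x) (2 * Real.pi)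
  rw [abs_of_nonneg (by positivity)] at h
  rw [fourierSInv_apply_eq_integral, ← Complex.real_smul, ← h]
  refine integral_congr_ae (ae_of_all _ fun x => ?_)
  simp only [inner_smul_right, real_inner_comm]
  congr 2
  push_cast
  ring

theorem fourierSInv_compSubConst (φ : 𝓢(V, ℂ)) (a ξ : V) :
    fourierSInv (SchwartzMap.compSubConstCLM ℂ a φ) ξ =
      Complex.exp (Complex.I * (inner ℝ ξ a : ℝ)) * fourierSInv φ ξ := by
  rw [fourierSInv_apply, fourierSInv_apply, ← integral_add_right_eq_self _ a, mul_left_comm]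
  refine congrArg (_ * ·) ?_
  rw [← integral_const_mul]
  refine integral_congr_ae (ae_of_all _ fun x => ?_)
  simp only
  rw [SchwartzMap.compSubConstCLM_apply, add_sub_cancel_right, inner_add_right, ← mul_assoc,
    ← Complex.exp_add]
  congr 2
  push_cast
  ring

theorem integral_exp_mul_fourierS (φ : 𝓢(V, ℂ)) (ξ : V) :
    ∫ x, Complex.exp (Complex.I * (inner ℝ ξ x : ℝ)) * fourierS φ x =
      ((2 * Real.pi) ^ Module.finrank ℝ V : ℝ) * φ ξ := by
  have h := fourierSInv_apply (fourierS φ) ξ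
  rw [fourierSInv_fourierS] at h
  rw [h, ← mul_assoc, ← Complex.ofReal_mul, mul_inv_cancel₀ (by positivity), Complex.ofReal_one,
    one_mul]

theorem lintegral_comp_inv_smul (r : ℝ) (hr : 0 < r) {f : V → ℝ≥0∞} (hf : Measurable f) :
    ∫⁻ x, f (r⁻¹ • x) = ENNReal.ofReal (r ^ Module.finrank ℝ V) * ∫⁻ x, f x := by
  rw [← lintegral_map hf (measurable_const_smul r⁻¹),
    Measure.map_addHaar_smul _ (inv_ne_zero hr.ne'), lintegral_smul_measure, inv_pow, inv_inv,
    abs_of_nonneg (by positivity), smul_eq_mul]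

/-- Plancherel's theorem: the function whose Fourier transform is the square integrable
function `S`. -/
theorem exists_memLp_integral_mul_eq {S : V → ℂ} (hS : MemLp S 2) :
    ∃ v : V → ℂ, MemLp v 2 ∧ (∀ φ : 𝓢(V, ℂ), ∫ x, v x * φ x = ∫ ξ, S ξ * fourierSInv φ ξ) ∧
      ∫⁻ x, ‖v x‖ₑ ^ 2 =
        ENNReal.ofReal (((2 * Real.pi) ^ Module.finrank ℝ V)⁻¹) * ∫⁻ ξ, ‖S ξ‖ₑ ^ 2 := by
  set c : ℝ := (2 * Real.pi) ^ Module.finrank ℝ V with hc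
  have hc0 : 0 < c := by positivity
  -- Here `𝓕⁻` has kernel `e^{2πi x·ξ}` and is an `L²` isometry. In the convention `e^{i x·ξ}` the
  -- function sought is `c⁻¹ W(x / 2π)`; its squared norm is `c⁻² · c = c⁻¹` times that of `S`.
  set W : Lp (α := V) ℂ 2 volume := 𝓕⁻ (hS.toLp S) with hW
  have hWn : ∫⁻ x, ‖W x‖ₑ ^ 2 = ∫⁻ ξ, ‖S ξ‖ₑ ^ 2 := by
    have h1 : ‖W‖ = ‖hS.toLp S‖ := by
      rw [← Lp.norm_fourier_eq W, hW, FourierTransform.fourier_fourierInv_eq]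
    have h2 : eLpNorm W 2 volume = eLpNorm S 2 volume := by
      rw [Lp.norm_def W, Lp.norm_def (hS.toLp S), ENNReal.toReal_eq_toReal_iff' (Lp.eLpNorm_ne_top _)
        (Lp.eLpNorm_ne_top _), eLpNorm_congr_ae hS.coeFn_toLp] at h1
      exact h1
    have h3 : ∀ f : V → ℂ, ∫⁻ x, ‖f x‖ₑ ^ 2 ∂volume = eLpNorm f 2 volume ^ (2 : ℝ) := by
      intro f
      rw [eLpNorm_eq_lintegral_rpow_enorm_toReal (by norm_num) (by norm_num), ← ENNReal.rpow_mul]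
      simp
    rw [h3, h3, h2]
  have hWm : StronglyMeasurable W := Lp.stronglyMeasurable W
  have hv : StronglyMeasurable fun x => (c⁻¹ : ℂ) * W ((2 * Real.pi)⁻¹ • x) :=
    (hWm.comp_measurable (measurable_const_smul _)).const_mul _
  have hnorm : ∫⁻ x, ‖(c⁻¹ : ℂ) * W ((2 * Real.pi)⁻¹ • x)‖ₑ ^ 2 =
      ENNReal.ofReal c⁻¹ * ∫⁻ ξ, ‖S ξ‖ₑ ^ 2 := by
    have hce : ‖(c⁻¹ : ℂ)‖ₑ = ENNReal.ofReal c⁻¹ := by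
      rw [← Complex.ofReal_inv, ← ofReal_norm, Complex.norm_real,
        Real.norm_of_nonneg (by positivity)]
    simp_rw [enorm_mul, mul_pow, hce]
    have hm2 : Measurable fun x => ‖W x‖ₑ ^ 2 := hWm.enorm.pow_const 2
    have hm3 : Measurable fun x => ‖W ((2 * Real.pi)⁻¹ • x)‖ₑ ^ 2 :=
      hm2.comp (measurable_const_smul _)
    rw [lintegral_const_mul _ hm3,
      lintegral_comp_inv_smul (2 * Real.pi) (by positivity) hm2, hWn, ← mul_assoc, ← hc, pow_two,
      mul_assoc (ENNReal.ofReal c⁻¹), ← ENNReal.ofReal_mul (by positivity),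
      inv_mul_cancel₀ hc0.ne', ENNReal.ofReal_one, mul_one]
  refine ⟨fun x => (c⁻¹ : ℂ) * W ((2 * Real.pi)⁻¹ • x), ?_, fun φ => ?_, hnorm⟩
  · refine ⟨hv.aestronglyMeasurable, ?_⟩
    rw [eLpNorm_lt_top_iff_lintegral_rpow_enorm_lt_top (by norm_num) (by norm_num)]
    have h4 := (eLpNorm_lt_top_iff_lintegral_rpow_enorm_lt_top (by norm_num) (by norm_num)).1 hS.2
    simp only [ENNReal.toReal_ofNat, ENNReal.rpow_ofNat] at h4 ⊢
    rw [hnorm]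
    exact ENNReal.mul_lt_top ENNReal.ofReal_lt_top h4
  · set g := SchwartzMap.compCLMOfContinuousLinearEquiv ℂ (dilation V) φ with hg
    have h1 := DFunLike.congr_fun (Lp.fourierInv_toTemperedDistribution_eq (hS.toLp S)) g
    rw [TemperedDistribution.fourierInv_apply, Lp.toTemperedDistribution_apply,
      Lp.toTemperedDistribution_apply] at h1
    have h2 : ∫ ξ, S ξ * fourierSInv φ ξ = ∫ x, (𝓕⁻ g) x • (hS.toLp S) x := by
      refine integral_congr_ae ?_
      filter_upwards [hS.coeFn_toLp] with x hx
      rw [hx, smul_eq_mul, mul_comm]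
      rfl
    rw [h2, h1]
    have h3 := Measure.integral_comp_inv_smul (volume : Measure V)
      (fun x => (c⁻¹ : ℂ) * (g x * W x)) (2 * Real.pi)
    rw [abs_of_nonneg (by positivity), ← hc, integral_const_mul (c⁻¹ : ℂ) fun x => g x * W x,
      Complex.real_smul, ← mul_assoc, mul_inv_cancel₀ (by exact_mod_cast hc0.ne'), one_mul] at h3
    simp only [smul_eq_mul]
    rw [← hW, ← h3]
    refine integral_congr_ae (ae_of_all _ fun x => ?_)
    have : g ((2 * Real.pi)⁻¹ • x) = φ x := by
      change φ ((2 * Real.pi) • ((2 * Real.pi)⁻¹ • x)) = φ x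
      rw [smul_inv_smul₀ (by positivity)]
    simp only [this]
    ring

/-! ### Functions representing a functional on test functions -/

theorem ae_eq_of_forall_integral_mul_schwartz_eq {u v : V → ℂ} (hu : LocallyIntegrable u)
    (hv : LocallyIntegrable v)
    (h : ∀ φ : 𝓢(V, ℂ), HasCompactSupport φ → ∫ x, u x * φ x = ∫ x, v x * φ x) : u =ᵐ[volume] v := by
  refine ae_eq_of_integral_contDiff_smul_eq hu hv fun g hg hgs => ?_
  have hs : HasCompactSupport fun x => (g x : ℂ) := hgs.comp_left (g := fun r : ℝ => (r : ℂ)) rfl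
  have hd : ContDiff ℝ ((⊤ : ℕ∞) : WithTop ℕ∞) fun x => (g x : ℂ) :=
    Complex.ofRealCLM.contDiff.comp hg
  have := h (hs.toSchwartzMap hd) hs
  refine Eq.trans ?_ (this.trans ?_) <;>
  · refine integral_congr_ae (ae_of_all _ fun x => ?_)
    simp [mul_comm]

theorem locallyIntegrable_ofReal {u : V → ℝ} (hu : LocallyIntegrable u) :
    LocallyIntegrable fun x => (u x : ℂ) := fun x => by
  obtain ⟨s, hs, hi⟩ := hu x
  exact ⟨s, hs, Integrable.ofReal hi⟩

theorem Represents.ae_eq {u u' : V → ℝ} {S : 𝓢(V, ℂ) → ℂ} (h : Represents u S)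
    (h' : Represents u' S) : u =ᵐ[volume] u' := by
  have := ae_eq_of_forall_integral_mul_schwartz_eq (u := fun x => (u x : ℂ))
    (v := fun x => (u' x : ℂ)) (locallyIntegrable_ofReal h.1) (locallyIntegrable_ofReal h'.1)
    fun φ hφ => (h.2 φ hφ).trans (h'.2 φ hφ).symm
  filter_upwards [this] with x hx
  exact_mod_cast hx

/-- Nothing beyond local integrability of `u` is known beforehand: it agrees almost everywhere with
the Plancherel inverse of `S`, because both act alike on compactly supported test functions. -/
theorem Represents.lintegral_sq_eq {u : V → ℝ} {S : V → ℂ} (hS : MemLp S 2)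
    (h : Represents u fun φ => ∫ ξ, S ξ * fourierSInv φ ξ) :
    ∫⁻ x, ‖u x‖ₑ ^ 2 =
      ENNReal.ofReal (((2 * Real.pi) ^ Module.finrank ℝ V)⁻¹) * ∫⁻ ξ, ‖S ξ‖ₑ ^ 2 := by
  obtain ⟨v, hv, hvφ, hvn⟩ := exists_memLp_integral_mul_eq hS
  rw [← hvn]
  have := ae_eq_of_forall_integral_mul_schwartz_eq (u := fun x => (u x : ℂ)) (v := v)
    (locallyIntegrable_ofReal h.1) (hv.locallyIntegrable (by norm_num))
    fun φ hφ => (h.2 φ hφ).trans (hvφ φ).symm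
  refine lintegral_congr_ae ?_
  filter_upwards [this] with x hx
  rw [← hx]
  congr 1
  rw [← ofReal_norm, ← ofReal_norm, Complex.norm_real]

end Fourier


/-! ### Tempered functions -/

section Tempered

variable {V : Type*} [NormedAddCommGroup V] [InnerProductSpace ℝ V] [FiniteDimensional ℝ V]
  [MeasurableSpace V] [BorelSpace V]

/-- A complex function which is integrable against some `(1 + |x|²)^{-p}`. -/
def IsTemperedFun (F : V → ℂ) : Prop :=
  ∃ p : ℕ, Integrable fun x => F x / (((1 + ‖x‖ ^ 2) ^ p : ℝ) : ℂ)

theorem weight_pos (x : V) (p : ℕ) : 0 < (1 + ‖x‖ ^ 2) ^ p := by positivity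

theorem weight_ne_zero (x : V) (p : ℕ) : (((1 + ‖x‖ ^ 2) ^ p : ℝ) : ℂ) ≠ 0 := by
  exact_mod_cast (weight_pos x p).ne'

theorem continuous_weight (p : ℕ) : Continuous fun x : V => (((1 + ‖x‖ ^ 2) ^ p : ℝ) : ℂ) := by
  fun_prop

theorem norm_weight (x : V) (p : ℕ) :
    ‖(((1 + ‖x‖ ^ 2) ^ p : ℝ) : ℂ)‖ = (1 + ‖x‖ ^ 2) ^ p := by
  rw [Complex.norm_real, Real.norm_of_nonneg (weight_pos x p).le]

theorem schwartz_decay (Φ : 𝓢(V, ℂ)) (p : ℕ) :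
    ∃ C, 0 ≤ C ∧ ∀ x, (1 + ‖x‖ ^ 2) ^ p * ‖Φ x‖ ≤ C := by
  have h : ∀ x, (1 + ‖x‖ ^ 2) ^ p * ‖Φ x‖ ≤ 2 ^ (2 * p) *
      (Finset.Iic (2 * p, 0)).sup (fun m => SchwartzMap.seminorm ℂ m.1 m.2) Φ := fun x => by
    have h := SchwartzMap.one_add_le_sup_seminorm_apply (𝕜 := ℂ) (m := (2 * p, 0)) le_rfl le_rfl Φ x
    rw [norm_iteratedFDeriv_zero, pow_mul] at h
    refine le_trans ?_ h
    gcongr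
    nlinarith [norm_nonneg x]
  exact ⟨_, le_trans (by positivity) (h 0), h⟩

theorem IsTemperedFun.aestronglyMeasurable {F : V → ℂ} (hF : IsTemperedFun F) :
    AEStronglyMeasurable F volume := by
  obtain ⟨p, hp⟩ := hF
  refine (hp.aestronglyMeasurable.mul
    (continuous_weight p).aestronglyMeasurable).congr (ae_of_all _ fun x => ?_)
  exact div_mul_cancel₀ _ (weight_ne_zero x p)

theorem IsTemperedFun.integrable_mul_schwartz {F : V → ℂ} (hF : IsTemperedFun F) (Φ : 𝓢(V, ℂ)) :
    Integrable fun x => F x * Φ x := by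
  obtain ⟨p, hp⟩ := hF
  obtain ⟨C, -, hC⟩ := schwartz_decay Φ p
  refine (hp.mul_bdd (g := fun x => (((1 + ‖x‖ ^ 2) ^ p : ℝ) : ℂ) * Φ x) (c := C)
    ((continuous_weight p).mul Φ.continuous).aestronglyMeasurable
    (ae_of_all _ fun x => ?_)).congr (ae_of_all _ fun x => ?_)
  · rw [norm_mul, norm_weight]
    exact hC x
  · simp only
    rw [← mul_assoc, div_mul_cancel₀ _ (weight_ne_zero x p)]

theorem isTemperedFun_of_isTempered_enorm {F : V → ℂ} (hm : Measurable F)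
    (hF : IsTempered fun x => ‖F x‖ₑ) : IsTemperedFun F := by
  obtain ⟨-, p, hp⟩ := hF
  refine ⟨p, ⟨(hm.div (continuous_weight p).measurable).aestronglyMeasurable, ?_⟩⟩
  refine lt_of_eq_of_lt (lintegral_congr fun x => ?_) hp.lt_top
  simp only
  rw [← ofReal_norm, ← ofReal_norm, norm_div, norm_weight,
    ENNReal.ofReal_div_of_pos (weight_pos x p)]

theorem IsTempered.isTemperedFun {u : V → ℝ≥0∞} (hu : IsTempered u) :
    IsTemperedFun fun x => ((u x).toReal : ℂ) := by
  refine isTemperedFun_of_isTempered_enorm (Complex.measurable_ofReal.comp hu.1.ennreal_toReal) ?_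
  obtain ⟨hm, p, hp⟩ := hu
  have e : ∀ x, ‖((u x).toReal : ℂ)‖ₑ ≤ u x := fun x => by
    rw [← ofReal_norm, Complex.norm_real, Real.norm_of_nonneg ENNReal.toReal_nonneg]
    exact ENNReal.ofReal_toReal_le
  refine ⟨(Complex.measurable_ofReal.comp hm.ennreal_toReal).enorm, p, ne_top_of_le_ne_top hp ?_⟩
  exact lintegral_mono fun x => ENNReal.div_le_div_right (e x) _

variable {n d : ℕ}

theorem integrable_prod_Rnd {f : Fin n → Rd d → ℂ} (hf : ∀ j, Integrable (f j)) :
    Integrable fun x : Rnd n d => ∏ j, f j (x j) :=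
  ((measurePreserving_toLp_Rnd n d).integrable_comp_emb (measurableEmbedding_toLp_Rnd n d)).1
    (Integrable.fintype_prod hf)

theorem integral_prod_Rnd {𝕜 : Type*} [RCLike 𝕜] (f : Fin n → Rd d → 𝕜) :
    ∫ x : Rnd n d, ∏ j, f j (x j) = ∏ j, ∫ x, f j x := by
  rw [← (measurePreserving_toLp_Rnd n d).integral_comp (measurableEmbedding_toLp_Rnd n d)]
  exact integral_fintype_prod_volume_eq_prod f

theorem norm_apply_le_Rnd (x : Rnd n d) (j : Fin n) : ‖x j‖ ≤ ‖x‖ := PiLp.norm_apply_le x j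

theorem IsTemperedFun.prod {f : Rd d → ℂ} (hf : IsTemperedFun f) :
    IsTemperedFun fun x : Rnd n d => ∏ j, f (x j) := by
  obtain ⟨p, hp⟩ := hf
  -- Since `‖x j‖ ≤ ‖x‖`, the product of the `n` block weights of exponent `p` is at most the full
  -- weight of exponent `n * p`.
  refine ⟨n * p, ?_⟩
  have h1 := integrable_prod_Rnd (n := n) fun _ => hp
  refine (h1.mul_bdd (c := 1) (g := fun x : Rnd n d =>
    (∏ j, (((1 + ‖x j‖ ^ 2) ^ p : ℝ) : ℂ)) / (((1 + ‖x‖ ^ 2) ^ (n * p) : ℝ) : ℂ)) ?_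
    (ae_of_all _ fun x => ?_)).congr (ae_of_all _ fun x => ?_)
  · refine Continuous.aestronglyMeasurable (Continuous.div ?_ (continuous_weight _)
      fun x => weight_ne_zero x _)
    exact continuous_finsetProd _ fun j _ => (continuous_weight p).comp (by fun_prop)
  · rw [norm_div, norm_weight, norm_prod]
    refine div_le_one_of_le₀ ?_ (weight_pos x _).le
    calc ∏ j, ‖(((1 + ‖x j‖ ^ 2) ^ p : ℝ) : ℂ)‖ ≤ ∏ _j : Fin n, (1 + ‖x‖ ^ 2) ^ p := by
          refine Finset.prod_le_prod (fun _ _ => norm_nonneg _) fun j _ => ?_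
          rw [norm_weight]
          have := norm_apply_le_Rnd x j
          gcongr
      _ = _ := by
          rw [Finset.prod_const, Finset.card_univ, Fintype.card_fin, ← pow_mul, mul_comm]
  · simp only [Finset.prod_div_distrib]
    rw [← mul_div_assoc, div_mul_cancel₀]
    exact Finset.prod_ne_zero_iff.2 fun j _ => weight_ne_zero _ _

end Tempered

/-! ### Mollification by products of bump functions -/

section Mollify

variable {n d : ℕ}

instance isNegInvariant_volume_Rnd : (volume : Measure (Rnd n d)).IsNegInvariant :=
  Measure.IsAddHaarMeasure.isNegInvariant_of_regular volume

/-- A bump function on `ℝ^d`, as a Schwartz function of integral `1`. -/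
noncomputable def bumpS (φ : ContDiffBump (0 : Rd d)) : 𝓢(Rd d, ℂ) :=
  HasCompactSupport.toSchwartzMap (f := fun x => ((φ.normed volume x : ℝ) : ℂ))
    (φ.hasCompactSupport_normed.comp_left (g := fun r : ℝ => (r : ℂ)) rfl)
    (Complex.ofRealCLM.contDiff.comp φ.contDiff_normed)

theorem bumpS_apply (φ : ContDiffBump (0 : Rd d)) (x : Rd d) :
    bumpS φ x = (φ.normed volume x : ℝ) := rfl

/-- The product of bump functions, on `ℝ^{nd}`. -/
noncomputable def prodBump (n : ℕ) (φ : ContDiffBump (0 : Rd d)) (z : Rnd n d) : ℝ :=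
  ∏ j, φ.normed volume (z j)

theorem prodBump_nonneg (φ : ContDiffBump (0 : Rd d)) (z : Rnd n d) : 0 ≤ prodBump n φ z :=
  Finset.prod_nonneg fun _ _ => φ.nonneg_normed _

theorem integral_prodBump (φ : ContDiffBump (0 : Rd d)) : ∫ z, prodBump n φ z = 1 := by
  unfold prodBump
  rw [integral_prod_Rnd fun _ => φ.normed volume]
  simp [φ.integral_normed]

theorem integrable_prodBump (φ : ContDiffBump (0 : Rd d)) : Integrable (prodBump n φ) := by
  by_contra h
  have := integral_prodBump (n := n) φ
  rw [integral_undef h] at this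
  exact zero_ne_one this

theorem continuous_prodBump (φ : ContDiffBump (0 : Rd d)) : Continuous (prodBump n φ) :=
  continuous_finsetProd _ fun j _ => φ.continuous_normed.comp (by fun_prop)

theorem norm_sq_le_of_prodBump_ne_zero {φ : ContDiffBump (0 : Rd d)} {z : Rnd n d}
    (h : prodBump n φ z ≠ 0) : ‖z‖ ^ 2 ≤ n * φ.rOut ^ 2 := by
  have h1 : ∀ j, ‖z j‖ ≤ φ.rOut := fun j => by
    have h2 : z j ∈ Function.support (φ.normed volume) :=
      Finset.prod_ne_zero_iff.1 h j (Finset.mem_univ j)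
    rw [φ.support_normed_eq] at h2
    exact (mem_ball_zero_iff.1 h2).le
  rw [PiLp.norm_sq_eq_of_L2]
  calc ∑ j, ‖z j‖ ^ 2 ≤ ∑ _j : Fin n, φ.rOut ^ 2 :=
        Finset.sum_le_sum fun j _ => pow_le_pow_left₀ (norm_nonneg _) (h1 j) 2
    _ = _ := by simp

/-- On the support `‖x - y‖² ≤ n`, so `1 + ‖x‖² ≤ 1 + 2n + 2‖y‖²`. This transfers Schwartz decay in
`y` to decay in `x`, uniformly over bumps of radius at most `1`. -/
theorem weight_le_of_prodBump_ne_zero {φ : ContDiffBump (0 : Rd d)} (hφ : φ.rOut ≤ 1)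
    {x y : Rnd n d} (h : prodBump n φ (x - y) ≠ 0) :
    1 + ‖x‖ ^ 2 ≤ 2 * (1 + n) * (1 + ‖y‖ ^ 2) := by
  have h1 := norm_sq_le_of_prodBump_ne_zero h
  have h2 : (n : ℝ) * φ.rOut ^ 2 ≤ n := by
    have := pow_le_one₀ (n := 2) φ.rOut_pos.le hφ
    nlinarith [Nat.cast_nonneg (α := ℝ) n]
  have h3 : ‖x‖ ≤ ‖x - y‖ + ‖y‖ := by simpa using norm_add_le (x - y) y
  have h4 : ‖x‖ ^ 2 ≤ (‖x - y‖ + ‖y‖) ^ 2 := pow_le_pow_left₀ (norm_nonneg _) h3 2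
  nlinarith [sq_nonneg (‖x - y‖ - ‖y‖), sq_nonneg ‖y‖, Nat.cast_nonneg (α := ℝ) n,
    mul_nonneg (Nat.cast_nonneg (α := ℝ) n) (sq_nonneg ‖y‖)]

theorem norm_prodBump_mul_le (Ψ : 𝓢(Rnd n d, ℂ)) (p : ℕ) :
    ∃ C, 0 ≤ C ∧ ∀ (φ : ContDiffBump (0 : Rd d)), φ.rOut ≤ 1 → ∀ x y,
      (1 + ‖x‖ ^ 2) ^ p * ‖(prodBump n φ (x - y) : ℂ) * Ψ y‖ ≤ C * prodBump n φ (x - y) := by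
  obtain ⟨C, hC0, hC⟩ := schwartz_decay Ψ p
  refine ⟨(2 * (1 + n)) ^ p * C, by positivity, fun φ hφ x y => ?_⟩
  by_cases h : prodBump n φ (x - y) = 0
  · simp [h]
  have h1 := pow_le_pow_left₀ (by positivity) (weight_le_of_prodBump_ne_zero hφ h) p
  rw [norm_mul, Complex.norm_real, Real.norm_of_nonneg (prodBump_nonneg _ _)]
  have h0 := prodBump_nonneg φ (x - y)
  calc (1 + ‖x‖ ^ 2) ^ p * (prodBump n φ (x - y) * ‖Ψ y‖)
      ≤ (2 * (1 + n) * (1 + ‖y‖ ^ 2)) ^ p * (prodBump n φ (x - y) * ‖Ψ y‖) := by gcongr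
    _ = (2 * (1 + n)) ^ p * ((1 + ‖y‖ ^ 2) ^ p * ‖Ψ y‖) * prodBump n φ (x - y) := by
      rw [mul_pow]; ring
    _ ≤ (2 * (1 + n)) ^ p * C * prodBump n φ (x - y) := by
      gcongr
      exact hC y

theorem integrable_prodBump_sub (φ : ContDiffBump (0 : Rd d)) (x : Rnd n d) :
    Integrable fun y => prodBump n φ (x - y) :=
  (integrable_prodBump φ).comp_sub_left x

theorem integral_prodBump_sub (φ : ContDiffBump (0 : Rd d)) (x : Rnd n d) :
    ∫ y, prodBump n φ (x - y) = 1 := by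
  rw [integral_sub_left_eq_self (prodBump n φ), integral_prodBump]

/-- The mollification of a Schwartz function is bounded by a multiple of `(1 + |x|²)^{-p}`,
uniformly in the bump function. -/
theorem norm_integral_prodBump_mul_le (Ψ : 𝓢(Rnd n d, ℂ)) (p : ℕ) :
    ∃ C, 0 ≤ C ∧ ∀ (φ : ContDiffBump (0 : Rd d)), φ.rOut ≤ 1 → ∀ x,
      (1 + ‖x‖ ^ 2) ^ p * ‖∫ y, (prodBump n φ (x - y) : ℂ) * Ψ y‖ ≤ C := by
  obtain ⟨C, hC0, hC⟩ := norm_prodBump_mul_le Ψ p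
  refine ⟨C, hC0, fun φ hφ x => ?_⟩
  calc (1 + ‖x‖ ^ 2) ^ p * ‖∫ y, (prodBump n φ (x - y) : ℂ) * Ψ y‖
      = ‖∫ y, (((1 + ‖x‖ ^ 2) ^ p : ℝ) : ℂ) * ((prodBump n φ (x - y) : ℂ) * Ψ y)‖ := by
        rw [integral_const_mul, norm_mul, norm_weight]
    _ ≤ ∫ y, C * prodBump n φ (x - y) := by
        refine norm_integral_le_of_norm_le ((integrable_prodBump_sub φ x).const_mul C)
          (ae_of_all _ fun y => ?_)
        rw [norm_mul, norm_weight]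
        exact hC φ hφ x y
    _ = C := by rw [integral_const_mul, integral_prodBump_sub, mul_one]

theorem tendsto_integral_prodBump_mul {φ : ℕ → ContDiffBump (0 : Rd d)}
    (hφ : Tendsto (fun k => (φ k).rOut) atTop (𝓝 0)) {f : Rnd n d → ℂ} (hf : Continuous f)
    (x : Rnd n d) :
    Tendsto (fun k => ∫ y, (prodBump n (φ k) (x - y) : ℂ) * f y) atTop (𝓝 (f x)) := by
  have h := convolution_tendsto_right (μ := (volume : Measure (Rnd n d))) (l := atTop)
    (φ := fun k => prodBump n (φ k)) (g := fun _ => f) (x₀ := x) (z₀ := f x) (k := fun _ => x)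
    (Eventually.of_forall fun k => prodBump_nonneg (φ k))
    (Eventually.of_forall fun k => integral_prodBump (φ k)) ?_
    (Eventually.of_forall fun k => hf.aestronglyMeasurable) ?_ tendsto_const_nhds
  · refine h.congr fun k => ?_
    rw [convolution_def, ← integral_sub_left_eq_self _ _ x]
    refine integral_congr_ae (ae_of_all _ fun y => ?_)
    simp
  · rw [tendsto_smallSets_iff]
    intro t ht
    obtain ⟨ε, hε, hεt⟩ := Metric.mem_nhds_iff.1 ht
    have h2 : Tendsto (fun k => (n : ℝ) * (φ k).rOut ^ 2) atTop (𝓝 0) := by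
      simpa using (hφ.pow 2).const_mul (n : ℝ)
    filter_upwards [h2.eventually_lt_const (pow_pos hε 2)] with k hk z hz
    refine hεt (mem_ball_zero_iff.2 ?_)
    exact lt_of_pow_lt_pow_left₀ 2 hε.le ((norm_sq_le_of_prodBump_ne_zero hz).trans_lt hk)
  · exact hf.continuousAt.tendsto.comp tendsto_snd

theorem tendsto_integral_exp_mul_bump {φ : ℕ → ContDiffBump (0 : Rd d)}
    (hφ : Tendsto (fun k => (φ k).rOut) atTop (𝓝 0)) (ξ : Rd d) :
    Tendsto (fun k => ∫ x, Complex.exp (Complex.I * (inner ℝ ξ x : ℝ)) * bumpS (φ k) x) atTop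
      (𝓝 1) := by
  have hc : Continuous fun x : Rd d => Complex.exp (Complex.I * (inner ℝ ξ (-x) : ℝ)) := by
    fun_prop
  have h := ContDiffBump.convolution_tendsto_right_of_continuous
    (μ := (volume : Measure (Rd d))) hφ hc 0
  simp only [neg_zero, inner_zero_right, Complex.ofReal_zero, mul_zero, Complex.exp_zero] at h
  refine h.congr fun k => ?_
  rw [convolution_def]
  refine integral_congr_ae (ae_of_all _ fun y => ?_)
  simp [bumpS_apply, mul_comm]

theorem norm_integral_exp_mul_bump_le (φ : ContDiffBump (0 : Rd d)) (ξ : Rd d) :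
    ‖∫ x, Complex.exp (Complex.I * (inner ℝ ξ x : ℝ)) * bumpS φ x‖ ≤ 1 := by
  rw [← φ.integral_normed (μ := volume)]
  refine norm_integral_le_of_norm_le ?_ (ae_of_all _ fun x => ?_)
  · exact φ.continuous_normed.integrable_of_hasCompactSupport φ.hasCompactSupport_normed
  · rw [norm_mul, mul_comm Complex.I, Complex.norm_exp_ofReal_mul_I, one_mul, bumpS_apply,
      Complex.norm_real, Real.norm_of_nonneg (φ.nonneg_normed _)]

end Mollify


/-! ### The Fourier transform of the tensor power of the kernel -/

section Tensor

variable {n d : ℕ} {κ : Rd d → ℝ≥0∞} {h : Rd d → ℂ}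

theorem finrank_Rnd (n d : ℕ) : Module.finrank ℝ (Rnd n d) = n * d := by
  rw [(WithLp.linearEquiv 2 ℝ (Fin n → Rd d)).finrank_eq, Module.finrank_pi_fintype]
  simp

theorem KernelAssumption.isTemperedFun_fourier (hκ : KernelAssumption κ h) : IsTemperedFun h :=
  isTemperedFun_of_isTempered_enorm hκ.measurable_fourier hκ.tempered_fourier

/-- The translated product bump is a tensor product, so both sides factor over the blocks, and in
each block this is the hypothesis on `κ` tested on the inverse transform of a translated bump. -/
theorem KernelAssumption.integral_mul_bump (hκ : KernelAssumption κ h)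
    (φ : ContDiffBump (0 : Rd d)) (y : Rnd n d) :
    ∫ x : Rnd n d, (∏ j, ((κ (x j)).toReal : ℂ)) * (prodBump n φ (x - y) : ℂ) =
      ∫ ξ : Rnd n d, (∏ j, h (ξ j)) *
        (Complex.exp (Complex.I * (inner ℝ ξ y : ℝ)) * ∏ j, fourierSInv (bumpS φ) (ξ j)) := by
  have h1 : ∀ x : Rnd n d, (∏ j, ((κ (x j)).toReal : ℂ)) * (prodBump n φ (x - y) : ℂ) =
      ∏ j, (fun x => ((κ x).toReal : ℂ) * bumpS φ (x - y j)) (x j) := fun x => by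
    simp only [Finset.prod_mul_distrib, prodBump, Complex.ofReal_prod, bumpS_apply]
    rfl
  have h2 : ∀ ξ : Rnd n d, (∏ j, h (ξ j)) *
        (Complex.exp (Complex.I * (inner ℝ ξ y : ℝ)) * ∏ j, fourierSInv (bumpS φ) (ξ j)) =
      ∏ j, (fun ξ => h ξ * (Complex.exp (Complex.I * (inner ℝ ξ (y j) : ℝ)) *
        fourierSInv (bumpS φ) ξ)) (ξ j) := fun ξ => by
    simp only [Finset.prod_mul_distrib, PiLp.inner_apply, Complex.ofReal_sum, Finset.mul_sum,
      Complex.exp_sum]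
  simp_rw [h1, h2]
  rw [integral_prod_Rnd fun j x => ((κ x).toReal : ℂ) * bumpS φ (x - y j),
    integral_prod_Rnd fun j ξ => h ξ * (Complex.exp (Complex.I * (inner ℝ ξ (y j) : ℝ)) *
        fourierSInv (bumpS φ) ξ)]
  refine Finset.prod_congr rfl fun j _ => ?_
  have h3 := hκ.fourier_kernel (fourierSInv (SchwartzMap.compSubConstCLM ℂ (y j) (bumpS φ)))
  rw [fourierS_fourierSInv] at h3
  simp only [fourierSInv_compSubConst, SchwartzMap.compSubConstCLM_apply] at h3
  exact h3.symm

/-- The decay of `Ψ`, moved to `x` by the support of the bump, absorbs the growth of `K`. The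
integrand is then dominated by that of a convolution of two integrable functions, which justifies
Fubini below. -/
theorem IsTemperedFun.integrable_mul_prodBump {K : Rnd n d → ℂ} (hK : IsTemperedFun K)
    {φ : ContDiffBump (0 : Rd d)} (hφ : φ.rOut ≤ 1) (Ψ : 𝓢(Rnd n d, ℂ)) :
    Integrable (Function.uncurry fun y x => K x * (prodBump n φ (x - y) : ℂ) * Ψ y)
      ((volume : Measure (Rnd n d)).prod volume) := by
  have hKm := hK.aestronglyMeasurable
  obtain ⟨p, hp⟩ := hK
  obtain ⟨C, hC0, hC⟩ := norm_prodBump_mul_le (n := n) Ψ p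
  have hneg : Integrable fun z : Rnd n d => (prodBump n φ (-z) : ℂ) :=
    (integrable_prodBump φ).comp_neg.ofReal
  have hconv := hp.convolution_integrand (ContinuousLinearMap.mul ℝ ℂ) (μ := volume) hneg
  refine (hconv.const_mul (C : ℂ)).mono ?_ (ae_of_all _ ?_)
  · have hXc : Continuous fun q : Rnd n d × Rnd n d => (prodBump n φ (q.2 - q.1) : ℂ) * Ψ q.1 :=
      (Complex.continuous_ofReal.comp ((continuous_prodBump φ).comp
        (continuous_snd.sub continuous_fst))).mul (Ψ.continuous.comp continuous_fst)
    refine ((hKm.comp_snd (μ := volume)).mul hXc.aestronglyMeasurable).congr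
      (ae_of_all _ fun q => ?_)
    simp only [Function.uncurry, Pi.mul_apply]
    ring
  · rintro ⟨y, x⟩
    simp only [Function.uncurry, ContinuousLinearMap.mul_apply', neg_sub]
    have h1 := hC φ hφ x y
    rw [mul_assoc, norm_mul (K x), norm_mul (C : ℂ), norm_mul (K x / _), norm_div, norm_weight,
      Complex.norm_real C,
      Real.norm_of_nonneg hC0, Complex.norm_real (prodBump n φ (x - y)),
      Real.norm_of_nonneg (prodBump_nonneg φ _), div_mul_eq_mul_div, ← mul_div_assoc,
      le_div_iff₀ (weight_pos x p)]
    calc ‖K x‖ * ‖(prodBump n φ (x - y) : ℂ) * Ψ y‖ * (1 + ‖x‖ ^ 2) ^ p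
        = ‖K x‖ * ((1 + ‖x‖ ^ 2) ^ p * ‖(prodBump n φ (x - y) : ℂ) * Ψ y‖) := by ring
      _ ≤ ‖K x‖ * (C * prodBump n φ (x - y)) := by gcongr
      _ = _ := by ring

theorem KernelAssumption.isTemperedFun_prod_kernel (hκ : KernelAssumption κ h) :
    IsTemperedFun fun x : Rnd n d => ∏ j, ((κ (x j)).toReal : ℂ) := by
  have h1 : IsTemperedFun fun x : Rd d => ((κ x).toReal : ℂ) := hκ.tempered_kernel.isTemperedFun
  exact h1.prod

theorem KernelAssumption.isTemperedFun_prod_fourier (hκ : KernelAssumption κ h) :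
    IsTemperedFun fun ξ : Rnd n d => ∏ j, h (ξ j) :=
  hκ.isTemperedFun_fourier.prod

/-- The identity for translated product bumps, integrated against `Ψ(y)`: Fubini turns
superpositions of tensor products into mollifications of an arbitrary Schwartz function. -/
theorem KernelAssumption.integral_mul_mollify (hκ : KernelAssumption κ h)
    {φ : ContDiffBump (0 : Rd d)} (hφ : φ.rOut ≤ 1) (Ψ : 𝓢(Rnd n d, ℂ)) :
    ∫ x : Rnd n d, (∏ j, ((κ (x j)).toReal : ℂ)) * ∫ y, (prodBump n φ (x - y) : ℂ) * Ψ y =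
      ∫ ξ : Rnd n d, (∏ j, h (ξ j)) * ((∏ j, fourierSInv (bumpS φ) (ξ j)) *
        ∫ y, Complex.exp (Complex.I * (inner ℝ ξ y : ℝ)) * Ψ y) := by
  have hL := integral_integral_swap
    ((hκ.isTemperedFun_prod_kernel (n := n)).integrable_mul_prodBump hφ Ψ)
  have hHX : Integrable fun ξ : Rnd n d => (∏ j, h (ξ j)) * ∏ j, fourierSInv (bumpS φ) (ξ j) := by
    simp_rw [← Finset.prod_mul_distrib]
    exact integrable_prod_Rnd fun _ => hκ.isTemperedFun_fourier.integrable_mul_schwartz _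
  have hRi : Integrable (Function.uncurry fun (y ξ : Rnd n d) => (∏ j, h (ξ j)) *
      (Complex.exp (Complex.I * (inner ℝ ξ y : ℝ)) * ∏ j, fourierSInv (bumpS φ) (ξ j)) * Ψ y)
      (volume.prod volume) := by
    have h1 := (Ψ.integrable (μ := volume)).mul_prod hHX
    refine (h1.mul_bdd (c := 1) (g := fun q : Rnd n d × Rnd n d =>
      Complex.exp (Complex.I * (inner ℝ q.2 q.1 : ℝ))) ?_ (ae_of_all _ fun q => ?_)).congr
      (ae_of_all _ fun q => ?_)
    · exact Continuous.aestronglyMeasurable (by fun_prop)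
    · rw [mul_comm Complex.I, Complex.norm_exp_ofReal_mul_I]
    · simp only [Function.uncurry]
      ring
  have hR := integral_integral_swap hRi
  have e1 : ∀ x : Rnd n d, (∏ j, ((κ (x j)).toReal : ℂ)) *
      ∫ y, (prodBump n φ (x - y) : ℂ) * Ψ y =
      ∫ y, (∏ j, ((κ (x j)).toReal : ℂ)) * (prodBump n φ (x - y) : ℂ) * Ψ y := fun x => by
    rw [← integral_const_mul]
    simp_rw [mul_assoc]
  have e2 : ∀ ξ : Rnd n d, (∏ j, h (ξ j)) * ((∏ j, fourierSInv (bumpS φ) (ξ j)) *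
        ∫ y, Complex.exp (Complex.I * (inner ℝ ξ y : ℝ)) * Ψ y) =
      ∫ y, (∏ j, h (ξ j)) * (Complex.exp (Complex.I * (inner ℝ ξ y : ℝ)) *
        ∏ j, fourierSInv (bumpS φ) (ξ j)) * Ψ y := fun ξ => by
    rw [← mul_assoc, ← integral_const_mul]
    congr 1
    ext y
    ring
  simp_rw [e1, e2]
  rw [← hL, ← hR]
  congr 1
  ext y
  rw [integral_mul_const, integral_mul_const, hκ.integral_mul_bump φ y]

/-- The Fourier transform of `κ^{⊗ n}` is `h^{⊗ n}`. -/
theorem KernelAssumption.integral_prod_mul_fourierS (hκ : KernelAssumption κ h)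
    (Φ : 𝓢(Rnd n d, ℂ)) :
    ∫ x : Rnd n d, (∏ j, ((κ (x j)).toReal : ℂ)) * fourierS Φ x =
      ∫ ξ : Rnd n d, (∏ j, h (ξ j)) * Φ ξ := by
  let φ : ℕ → ContDiffBump (0 : Rd d) := fun k =>
    ⟨1 / ((k : ℝ) + 1) / 2, 1 / ((k : ℝ) + 1), by positivity, half_lt_self (by positivity)⟩
  have hφ : Tendsto (fun k => (φ k).rOut) atTop (𝓝 0) := tendsto_one_div_add_atTop_nhds_zero_nat
  have hφ1 : ∀ k, (φ k).rOut ≤ 1 := fun k => by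
    change 1 / ((k : ℝ) + 1) ≤ 1
    rw [div_le_one (by positivity)]
    linarith [Nat.cast_nonneg (α := ℝ) k]
  set Ψ := fourierS Φ with hΨ
  have hK := hκ.isTemperedFun_prod_kernel (n := n)
  have hH := hκ.isTemperedFun_prod_fourier (n := n)
  -- As the bumps shrink, the mollified `Ψ` tends pointwise to `Ψ`; the decay bound uniform in `k`
  -- provides the dominating function.
  have hL : Tendsto (fun k => ∫ x : Rnd n d, (∏ j, ((κ (x j)).toReal : ℂ)) *
      ∫ y, (prodBump n (φ k) (x - y) : ℂ) * Ψ y) atTop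
      (𝓝 (∫ x : Rnd n d, (∏ j, ((κ (x j)).toReal : ℂ)) * Ψ x)) := by
    have hKm := hK.aestronglyMeasurable
    have hKi := fun k => (hK.integrable_mul_prodBump (hφ1 k) Ψ).integral_prod_right
    obtain ⟨p, hp⟩ := hK
    obtain ⟨C, hC0, hC⟩ := norm_integral_prodBump_mul_le (n := n) Ψ p
    refine tendsto_integral_of_dominated_convergence
      (fun x => C * ‖(∏ j, ((κ (x j)).toReal : ℂ)) / (((1 + ‖x‖ ^ 2) ^ p : ℝ) : ℂ)‖)
      (fun k => ?_) (hp.norm.const_mul C) (fun k => ae_of_all _ fun x => ?_)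
      (ae_of_all _ fun x => (tendsto_integral_prodBump_mul hφ Ψ.continuous x).const_mul _)
    · refine (hKi k).aestronglyMeasurable.congr (ae_of_all _ fun x => ?_)
      simp only [Function.uncurry]
      rw [← integral_const_mul]
      simp_rw [mul_assoc]
    · have h1 := hC (φ k) (hφ1 k) x
      rw [norm_mul, norm_div, norm_weight, ← mul_div_assoc, le_div_iff₀ (weight_pos x p)]
      calc _ = ‖∏ j, ((κ (x j)).toReal : ℂ)‖ *
            ((1 + ‖x‖ ^ 2) ^ p * ‖∫ y, (prodBump n (φ k) (x - y) : ℂ) * Ψ y‖) := by ring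
        _ ≤ ‖∏ j, ((κ (x j)).toReal : ℂ)‖ * C := by gcongr
        _ = _ := mul_comm _ _
  set M : ℕ → Rd d → ℂ := fun k ξ =>
    ∫ x, Complex.exp (Complex.I * (inner ℝ ξ x : ℝ)) * bumpS (φ k) x with hM
  -- The first factor comes from the `n` inverse transforms of the bump, the second from Fourier
  -- inversion of `Ψ = fourierS Φ`.
  have hc : ((((2 * Real.pi) ^ d)⁻¹ : ℝ) : ℂ) ^ n * (((2 * Real.pi) ^ (n * d) : ℝ) : ℂ) = 1 := by
    rw [← Complex.ofReal_pow, ← Complex.ofReal_mul, inv_pow, ← pow_mul, mul_comm d n,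
      inv_mul_cancel₀ (by positivity), Complex.ofReal_one]
  have hR : Tendsto (fun k => ∫ ξ : Rnd n d, (∏ j, h (ξ j)) * Φ ξ * ∏ j, M k (ξ j)) atTop
      (𝓝 (∫ ξ : Rnd n d, (∏ j, h (ξ j)) * Φ ξ)) := by
    have hHi := hH.integrable_mul_schwartz Φ
    refine tendsto_integral_of_dominated_convergence (fun ξ => ‖(∏ j, h (ξ j)) * Φ ξ‖)
      (fun k => ?_) hHi.norm (fun k => ae_of_all _ fun ξ => ?_) (ae_of_all _ fun ξ => ?_)
    · refine hHi.aestronglyMeasurable.mul (Continuous.aestronglyMeasurable ?_)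
      refine continuous_finsetProd _ fun j _ => ?_
      have : M k = fun ξ => (((2 * Real.pi) ^ Module.finrank ℝ (Rd d) : ℝ) : ℂ) *
          fourierSInv (bumpS (φ k)) ξ := by
        ext ξ
        rw [fourierSInv_apply, ← mul_assoc, ← Complex.ofReal_mul, mul_inv_cancel₀ (by positivity),
          Complex.ofReal_one, one_mul]
      rw [this]
      exact continuous_const.mul ((fourierSInv (bumpS (φ k))).continuous.comp (by fun_prop))
    · rw [norm_mul, norm_prod]
      exact mul_le_of_le_one_right (norm_nonneg _) (Finset.prod_le_one (fun _ _ => norm_nonneg _)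
        fun j _ => norm_integral_exp_mul_bump_le _ _)
    · have := tendsto_finsetProd (Finset.univ : Finset (Fin n)) fun j _ =>
        tendsto_integral_exp_mul_bump hφ (ξ j)
      simpa using this.const_mul ((∏ j, h (ξ j)) * Φ ξ)
  refine tendsto_nhds_unique hL (hR.congr fun k => ?_)
  rw [hκ.integral_mul_mollify (hφ1 k) Ψ]
  refine integral_congr_ae (ae_of_all _ fun ξ => ?_)
  simp only
  rw [hΨ, integral_exp_mul_fourierS, finrank_Rnd]
  simp_rw [fourierSInv_apply, Finset.prod_mul_distrib, Finset.prod_const, Finset.card_univ,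
    Fintype.card_fin, finrank_euclideanSpace, Fintype.card_fin]
  linear_combination (-(∏ j, h (ξ j)) * (Φ ξ) * ∏ j, M k (ξ j)) * hc

/-- The action of `f_n * κ^{⊗ n}` on test functions, in Fourier variables. -/
theorem KernelAssumption.convDist_distOfFourier (hκ : KernelAssumption κ h) {g : Rnd n d → ℂ}
    (hg : g.HasTemperateGrowth) (φ : 𝓢(Rnd n d, ℂ)) :
    convDist (distOfFourier hg) (kernelTensor κ n) φ =
      ∫ ξ : Rnd n d, ((∏ j, h (ξ j)) * g ξ) * fourierSInv φ ξ := by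
  -- Translation of `φ` becomes modulation of its inverse transform, so `y ↦ ⟨T, φ(· + y)⟩` is the
  -- Fourier transform of `g · fourierSInv φ`, a Schwartz function that is not a tensor product in
  -- general.
  have h1 := hκ.integral_prod_mul_fourierS (SchwartzMap.smulLeftCLM ℂ g (fourierSInv φ))
  simp only [SchwartzMap.smulLeftCLM_apply_apply hg, smul_eq_mul, ← mul_assoc] at h1
  rw [← h1]
  unfold convDist
  refine integral_congr_ae (ae_of_all _ fun y => ?_)
  simp only [kernelTensor, ENNReal.toReal_prod, Complex.ofReal_prod]
  congr 1
  rw [fourierS_apply]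
  change ∫ ξ, (fourierSInv (SchwartzMap.compSubConstCLM ℂ (-y) φ)) ξ • g ξ = _
  refine integral_congr_ae (ae_of_all _ fun ξ => ?_)
  simp only [fourierSInv_compSubConst, SchwartzMap.smulLeftCLM_apply_apply hg, smul_eq_mul,
    inner_neg_right, Complex.ofReal_neg, mul_neg, real_inner_comm]
  ring

end Tensor


/-! ### The spectral measure and the intensity -/

section Measures

variable {d : ℕ} {h : Rd d → ℂ}

theorem spectralMeasure_eq_withDensity (hh : Measurable h) :
    spectralMeasure h = volume.withDensity fun ξ =>
      ENNReal.ofReal (((2 * Real.pi) ^ d)⁻¹) * ‖h ξ‖ₑ ^ 2 :=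
  (withDensity_smul _ (hh.enorm.pow_const 2)).symm

theorem sigmaFinite_spectralMeasure (hh : Measurable h) : SigmaFinite (spectralMeasure h) := by
  rw [spectralMeasure_eq_withDensity hh]
  exact SigmaFinite.withDensity_of_ne_top (ae_of_all _ fun ξ =>
    ENNReal.mul_ne_top ENNReal.ofReal_ne_top (ENNReal.pow_ne_top enorm_ne_top))

/-- `|z|² ν` is a finite measure, and `ν` has the finite density `|z|⁻²` with respect to it because
`z ≠ 0`. -/
theorem sigmaFinite_of_secondMoment {ν : Measure R0} (hν : secondMoment ν < ⊤) :
    SigmaFinite ν := by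
  have hm : Measurable fun z : R0 => ‖(z : ℝ)‖ₑ ^ 2 := measurable_subtype_coe.enorm.pow_const 2
  have h0 : ∀ z : R0, ‖(z : ℝ)‖ₑ ^ 2 ≠ 0 := fun z => by simpa using z.2
  have h1 := withDensity_inv_same (μ := ν) hm (ae_of_all _ h0)
    (ae_of_all _ fun z => ENNReal.pow_ne_top enorm_ne_top)
  have : IsFiniteMeasure (ν.withDensity fun z : R0 => ‖(z : ℝ)‖ₑ ^ 2) :=
    isFiniteMeasure_withDensity hν.ne
  rw [← h1]
  exact SigmaFinite.withDensity_of_ne_top (ae_of_all _ fun z => ENNReal.inv_ne_top.2 (h0 z))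

theorem sigmaFinite_intensity (d : ℕ) {ν : Measure R0} (hν : secondMoment ν < ⊤) :
    SigmaFinite (intensity d ν) := by
  have := sigmaFinite_of_secondMoment hν
  unfold intensity
  infer_instance

/-- For `d ≥ 1` the Lebesgue factor has no atoms, so neither does the product, even if `ν` has some.
-/
theorem nullSingletonClass_intensity (hd : 1 ≤ d) {ν : Measure R0} (hν : secondMoment ν < ⊤) :
    NullSingletonClass (intensity d ν) := by
  have := sigmaFinite_of_secondMoment hν
  have : NeZero d := ⟨by omega⟩
  unfold intensity
  infer_instance

end Measures

/-! ### The simplex and its increments -/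

section Simplex

theorem measurableSet_simplex (n : ℕ) (t : ℝ) : MeasurableSet (simplex n t) := by
  have h1 : simplex n t = (⋂ i : Fin n, ⋂ j : Fin n, ⋂ _ : i < j, {s | s i < s j}) ∩
      ⋂ j, ({s | 0 < s j} ∩ {s | s j < t}) := by
    ext s
    simp [simplex, StrictMono]
  rw [h1]
  refine MeasurableSet.inter ?_ ?_
  · exact .iInter fun i => .iInter fun j => .iInter fun _ =>
      measurableSet_lt (measurable_pi_apply i) (measurable_pi_apply j)
  · exact .iInter fun j => (measurableSet_lt measurable_const (measurable_pi_apply j)).inter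
      (measurableSet_lt (measurable_pi_apply j) measurable_const)

theorem measurable_increment {n : ℕ} (t : ℝ) (j : Fin n) :
    Measurable fun s : Fin n → ℝ => increment s t j := by
  unfold increment
  split_ifs <;> fun_prop

theorem increment_mem_Ioo {n : ℕ} {t : ℝ} {s : Fin n → ℝ} (hs : s ∈ simplex n t) (j : Fin n) :
    increment s t j ∈ Set.Ioo 0 t := by
  obtain ⟨h1, h2⟩ := hs
  unfold increment
  split_ifs with hj
  · have h3 : s j < s ⟨(j : ℕ) + 1, hj⟩ := h1 (by simp [Fin.lt_def])
    have h4 := h2 ⟨(j : ℕ) + 1, hj⟩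
    have h5 := h2 j
    constructor <;> linarith
  · have h5 := h2 j
    constructor <;> linarith

theorem increment_cons_succ {n : ℕ} (a : ℝ) (w : Fin n → ℝ) (t : ℝ) (j : Fin n) :
    increment (Fin.cons a w : Fin (n + 1) → ℝ) t j.succ = increment w t j := by
  have e : ∀ hj : (j.succ : ℕ) + 1 < n + 1,
      (⟨(j.succ : ℕ) + 1, hj⟩ : Fin (n + 1)) = Fin.succ ⟨j + 1, by simpa using hj⟩ := fun hj => by
    ext; simp
  unfold increment
  by_cases hj : (j : ℕ) + 1 < n
  · rw [dif_pos (by simpa using hj), dif_pos hj, e, Fin.cons_succ, Fin.cons_succ]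
  · rw [dif_neg (by simpa using hj), dif_neg hj, Fin.cons_succ]

theorem increment_cons_zero {n : ℕ} (a : ℝ) (w : Fin n → ℝ) (t : ℝ) :
    increment (Fin.cons a w : Fin (n + 1) → ℝ) t 0 = (if hn : 0 < n then w ⟨0, hn⟩ else t) - a := by
  have e : ∀ hj : ((0 : Fin (n + 1)) : ℕ) + 1 < n + 1,
      (⟨((0 : Fin (n + 1)) : ℕ) + 1, hj⟩ : Fin (n + 1)) =
        Fin.succ ⟨0, by simpa using hj⟩ := fun hj => by
    ext; simp
  unfold increment
  by_cases hn : 0 < n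
  · rw [dif_pos (by simpa using hn), dif_pos hn, e, Fin.cons_succ, Fin.cons_zero]
  · rw [dif_neg (by simpa using hn), dif_neg hn, Fin.cons_zero]

/-- The first time occurs only in the first increment, so integrating it out gives `∫ k` by
invariance under reflection and translation; the rest is the same integral with one variable fewer.
-/
theorem lintegral_prod_increment {k : ℝ → ℝ≥0∞} (hk : Measurable k) (n : ℕ) (t : ℝ) :
    ∫⁻ s : Fin n → ℝ, ∏ j, k (increment s t j) = (∫⁻ r, k r) ^ n := by
  induction n with
  | zero => simp [volume_pi]
  | succ n ih =>
    have hm : ∀ m : ℕ, Measurable fun s : Fin m → ℝ => ∏ j, k (increment s t j) := fun m =>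
      Finset.measurable_fun_prod _ fun j _ => hk.comp (measurable_increment t j)
    have hc : Measurable fun w : Fin n → ℝ => if hn : 0 < n then w ⟨0, hn⟩ else t := by
      split_ifs <;> fun_prop
    rw [volume_pi, lintegral_pi_succ _ (hm _)]
    simp only [Fin.prod_univ_succ, increment_cons_succ, increment_cons_zero]
    rw [lintegral_lintegral_swap]
    · have h1 : ∀ w : Fin n → ℝ, ∫⁻ a : ℝ, k ((if hn : 0 < n then w ⟨0, hn⟩ else t) - a) *
          ∏ j, k (increment w t j) = (∫⁻ r, k r) * ∏ j, k (increment w t j) := fun w => by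
        rw [lintegral_mul_const _ (by fun_prop), lintegral_sub_left_eq_self k]
      simp_rw [h1]
      rw [lintegral_const_mul _ (hm n), ← volume_pi, ih, pow_succ']
    · exact ((hk.comp ((hc.comp measurable_snd).sub measurable_fst)).mul
        ((hm n).comp measurable_snd)).aemeasurable

theorem simplex_zero {n : ℕ} (hn : 1 ≤ n) {t : ℝ} (ht : t ≤ 0) : simplex n t = ∅ := by
  ext s
  simp only [Set.mem_empty_iff_false, iff_false]
  rintro ⟨-, h⟩
  have := h ⟨0, hn⟩
  linarith

/-- The `n!` coordinate permutations of the simplex are pairwise disjoint, of equal volume, and lie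
in `(0, t)^n`. -/
theorem factorial_mul_volume_simplex_le (n : ℕ) (t : ℝ) :
    (n.factorial : ℝ≥0∞) * volume (simplex n t) ≤ ENNReal.ofReal t ^ n := by
  have hmp : ∀ σ : Equiv.Perm (Fin n), MeasurePreserving (fun s : Fin n → ℝ => s ∘ σ)
      volume volume := fun σ => by
    have := volume_measurePreserving_piCongrLeft (fun _ : Fin n => ℝ) σ.symm
    convert this using 1
    ext s i
    obtain ⟨j, rfl⟩ := σ.symm.surjective i
    simp only [Function.comp_apply, Equiv.apply_symm_apply, MeasurableEquiv.coe_piCongrLeft]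
    exact (Equiv.piCongrLeft_apply_apply (fun _ : Fin n => ℝ) σ.symm s j).symm
  have hme : ∀ σ : Equiv.Perm (Fin n),
      MeasurableSet ((fun s : Fin n → ℝ => s ∘ σ) ⁻¹' simplex n t) := fun σ =>
    (hmp σ).measurable (measurableSet_simplex n t)
  have hsub : ∀ σ : Equiv.Perm (Fin n), (fun s : Fin n → ℝ => s ∘ σ) ⁻¹' simplex n t ⊆
      Set.univ.pi fun _ => Set.Ioo 0 t := by
    rintro σ s ⟨-, hs⟩ i -
    have := hs (σ.symm i)
    simpa using this
  have hdisj : Pairwise (Function.onFun Disjoint fun σ : Equiv.Perm (Fin n) =>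
      (fun s : Fin n → ℝ => s ∘ σ) ⁻¹' simplex n t) := by
    intro σ τ hστ
    refine Set.disjoint_left.2 fun s hs hs' => hστ ?_
    have h1 : s ∘ σ = s ∘ τ := (StrictMono.range_inj hs.1 hs'.1).1 (by
      rw [EquivLike.range_comp, EquivLike.range_comp])
    have hinj : Function.Injective s := by
      have := hs.1.injective.comp σ.symm.injective
      simpa [Function.comp_assoc] using this
    exact Equiv.ext fun i => hinj (congrFun h1 i)
  calc (n.factorial : ℝ≥0∞) * volume (simplex n t)
      = ∑ σ : Equiv.Perm (Fin n), volume ((fun s : Fin n → ℝ => s ∘ σ) ⁻¹' simplex n t) := by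
        simp_rw [fun σ => (hmp σ).measure_preimage (measurableSet_simplex n t).nullMeasurableSet]
        simp [Fintype.card_perm]
    _ = volume (⋃ σ : Equiv.Perm (Fin n), (fun s : Fin n → ℝ => s ∘ σ) ⁻¹' simplex n t) := by
        rw [measure_iUnion hdisj hme, tsum_fintype]
    _ ≤ volume (Set.univ.pi fun _ : Fin n => Set.Ioo 0 t) :=
        measure_mono (Set.iUnion_subset hsub)
    _ = ENNReal.ofReal t ^ n := by
        rw [volume_pi_pi]
        simp

theorem volume_simplex_lt_top (n : ℕ) (t : ℝ) : volume (simplex n t) < ⊤ := by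
  have h1 := factorial_mul_volume_simplex_le n t
  have h2 : (n.factorial : ℝ≥0∞) * volume (simplex n t) < ⊤ :=
    h1.trans_lt (ENNReal.pow_lt_top ENNReal.ofReal_lt_top)
  refine lt_of_le_of_lt ?_ h2
  exact le_mul_of_one_le_left zero_le (by exact_mod_cast n.factorial_pos)

end Simplex

/-! ### The chaos energies -/

section Energy

/-- With the first variable fixed, its value acts on the later partial sums as a constant shift. The
induction is therefore run for every shift `η`, and bounds uniform in the shift multiply. -/
theorem lintegral_prod_partial_sum_le {E : Type*} [NormedAddCommGroup E] [MeasurableSpace E]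
    [MeasurableAdd₂ E] (μ : Measure E) [SigmaFinite μ] {n : ℕ} {q : Fin n → E → ℝ≥0∞}
    (hq : ∀ j, Measurable (q j)) {K : Fin n → ℝ≥0∞}
    (hK : ∀ j η, ∫⁻ ξ, q j (ξ + η) ∂μ ≤ K j) (η : E) :
    ∫⁻ ξ, ∏ j, q j ((∑ l ∈ Finset.Iic j, ξ l) + η) ∂(Measure.pi fun _ : Fin n => μ) ≤
      ∏ j, K j := by
  induction n generalizing η with
  | zero => simp
  | succ n ih =>
    have hm : ∀ (m : ℕ) (p : Fin m → E → ℝ≥0∞) (_ : ∀ j, Measurable (p j)) (η : E),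
        Measurable fun ξ : Fin m → E => ∏ j, p j ((∑ l ∈ Finset.Iic j, ξ l) + η) :=
      fun m p hp η => Finset.measurable_fun_prod _ fun j _ => (hp j).comp
        ((Finset.measurable_fun_sum _ fun l _ => measurable_pi_apply l).add_const η)
    rw [lintegral_pi_succ _ (hm _ q hq η)]
    have e0 : ∀ (a : E) (w : Fin n → E),
        (∑ l ∈ Finset.Iic (0 : Fin (n + 1)), (Fin.cons a w : Fin (n + 1) → E) l) = a :=
      fun a w => by
        have : Finset.Iic (0 : Fin (n + 1)) = {0} := by ext l; simp
        simp [this]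
    have e1 : ∀ (a : E) (w : Fin n → E) (j : Fin n),
        (∑ l ∈ Finset.Iic j.succ, (Fin.cons a w : Fin (n + 1) → E) l) + η =
          (∑ l ∈ Finset.Iic j, w l) + (a + η) := fun a w j => by
      have h1 : ∀ (m : ℕ) (i : Fin m), Finset.Iic i = Finset.univ.filter (· ≤ i) := fun m i => by
        ext; simp
      rw [h1, h1, Finset.sum_filter, Finset.sum_filter, Fin.sum_univ_succ]
      simp only [Fin.zero_le, if_true, Fin.cons_zero, Fin.cons_succ, Fin.succ_le_succ_iff]
      abel
    simp only [Fin.prod_univ_succ, e0, e1]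
    calc ∫⁻ a, ∫⁻ w, q 0 (a + η) * ∏ j : Fin n, q j.succ ((∑ l ∈ Finset.Iic j, w l) + (a + η))
          ∂(Measure.pi fun _ => μ) ∂μ
        ≤ ∫⁻ a, q 0 (a + η) * ∏ j : Fin n, K j.succ ∂μ := by
          refine lintegral_mono fun a => ?_
          rw [lintegral_const_mul _ (hm _ (fun j => q j.succ) (fun j => hq _) _)]
          gcongr
          exact ih (fun j => hq _) (fun j => hK _) _
      _ ≤ K 0 * ∏ j : Fin n, K j.succ := by
          rw [lintegral_mul_const _ (by have := hq 0; fun_prop)]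
          gcongr
          exact hK 0 η

variable {d : ℕ} {h : Rd d → ℂ} {G : ℝ → 𝓢'(Rd d, ℂ)}

theorem continuous_fourierFun (T : 𝓢'(Rd d, ℂ)) : Continuous (fourierFun T) :=
  (fourierFun_hasTemperateGrowth T).1.continuous

theorem lintegral_energy_le (hh : Measurable h) {n : ℕ} (s : Fin n → ℝ) (t : ℝ) :
    ∫⁻ ξ : Fin n → Rd d,
      ∏ j, ‖fourierFun (G (increment s t j)) (∑ l ∈ Finset.Iic j, ξ l)‖ₑ ^ 2
        ∂(Measure.pi fun _ => spectralMeasure h) ≤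
      ∏ j, shiftedEnergy h G (increment s t j) := by
  have := sigmaFinite_spectralMeasure hh
  have := lintegral_prod_partial_sum_le (spectralMeasure h)
    (q := fun j : Fin n => fun ξ => ‖fourierFun (G (increment s t j)) ξ‖ₑ ^ 2)
    (fun j => (continuous_fourierFun _).measurable.enorm.pow_const 2)
    (K := fun j => shiftedEnergy h G (increment s t j))
    (fun j η => le_iSup (fun η => ∫⁻ ξ, ‖fourierFun (G (increment s t j)) (ξ + η)‖ₑ ^ 2
      ∂(spectralMeasure h)) η) 0
  simpa using this

/-- By Fatou and the continuity of `𝓕 G_t`, the shifted energy is lower semicontinuous in `η`, so a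
countable dense set of shifts suffices. This makes `K` measurable in `t`. -/
theorem shiftedEnergy_eq_iSup_denseSeq (h : Rd d → ℂ) (G : ℝ → 𝓢'(Rd d, ℂ)) (t : ℝ) :
    shiftedEnergy h G t = ⨆ k : ℕ, ∫⁻ ξ,
      ‖fourierFun (G t) (ξ + TopologicalSpace.denseSeq (Rd d) k)‖ₑ ^ 2 ∂(spectralMeasure h) := by
  refine le_antisymm (iSup_le fun η => ?_) (iSup_le fun k => le_iSup
    (fun η => ∫⁻ ξ, ‖fourierFun (G t) (ξ + η)‖ₑ ^ 2 ∂(spectralMeasure h)) _)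
  obtain ⟨u, hu, hlim⟩ := mem_closure_iff_seq_limit.1
    (TopologicalSpace.denseRange_denseSeq (Rd d) η)
  choose k hk using hu
  have h1 : ∀ ξ, liminf (fun i => ‖fourierFun (G t) (ξ + u i)‖ₑ ^ 2) atTop =
      ‖fourierFun (G t) (ξ + η)‖ₑ ^ 2 := fun ξ => by
    refine Tendsto.liminf_eq ?_
    have : Continuous fun η => ‖fourierFun (G t) (ξ + η)‖ₑ ^ 2 :=
      (ENNReal.continuous_pow 2).comp ((continuous_fourierFun _).comp
        (continuous_const.add continuous_id)).enorm
    exact (this.tendsto η).comp hlim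
  simp_rw [← h1]
  refine (lintegral_liminf_le fun i => ((continuous_fourierFun _).comp
    (continuous_id.add continuous_const)).measurable.enorm.pow_const 2).trans ?_
  refine liminf_le_of_le (by isBoundedDefault) fun b hb => ?_
  obtain ⟨i, hi⟩ := hb.exists
  refine hi.trans ?_
  rw [← hk i]
  exact le_iSup (fun k => ∫⁻ ξ,
    ‖fourierFun (G t) (ξ + TopologicalSpace.denseSeq (Rd d) k)‖ₑ ^ 2 ∂(spectralMeasure h)) (k i)

theorem measurable_indicator_shiftedEnergy (hh : Measurable h) (hD : HypothesisD h G) (t : ℝ) :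
    Measurable ((Set.Ioo 0 t).indicator (shiftedEnergy h G)) := by
  have := sigmaFinite_spectralMeasure hh
  have h1 : Measurable fun r : Set.Ioi (0 : ℝ) => shiftedEnergy h G r := by
    simp_rw [shiftedEnergy_eq_iSup_denseSeq]
    refine Measurable.iSup fun k => ?_
    refine Measurable.lintegral_prod_right' (f := fun p : Set.Ioi (0 : ℝ) × Rd d =>
      ‖fourierFun (G p.1) (p.2 + TopologicalSpace.denseSeq (Rd d) k)‖ₑ ^ 2) ?_
    exact (hD.measurable.comp (measurable_fst.prodMk (measurable_snd.add_const _))).enorm.pow_const 2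
  have h2 : Measurable ((Set.Ioi 0).indicator (shiftedEnergy h G)) := by
    refine measurable_of_restrict_of_restrict_compl (measurableSet_Ioi (a := (0 : ℝ))) ?_ ?_
    · convert h1 using 2 with r
      exact Set.indicator_of_mem r.2 _
    · convert measurable_const (a := (0 : ℝ≥0∞)) using 2 with r
      exact Set.indicator_of_notMem r.2 _
  have h3 := h2.indicator (measurableSet_Iio (a := t))
  rwa [Set.indicator_indicator, Set.Iio_inter_Ioi] at h3

theorem chaosEnergy_lt_top (hh : Measurable h) (hD : HypothesisD h G) {n : ℕ} (hn : 1 ≤ n)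
    (t : ℝ) : chaosEnergy h G n t < ⊤ := by
  rcases le_or_gt t 0 with ht | ht
  · simp [chaosEnergy, simplex_zero hn ht]
  set k := (Set.Ioo 0 t).indicator (shiftedEnergy h G) with hk
  have hkm := measurable_indicator_shiftedEnergy hh hD t
  calc chaosEnergy h G n t ≤ ∫⁻ s in simplex n t, ∏ j, k (increment s t j) := by
        refine setLIntegral_mono' (measurableSet_simplex n t) fun s hs => ?_
        refine (lintegral_energy_le hh s t).trans (le_of_eq ?_)
        refine Finset.prod_congr rfl fun j _ => ?_
        rw [hk, Set.indicator_of_mem (increment_mem_Ioo hs j)]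
    _ ≤ ∫⁻ s : Fin n → ℝ, ∏ j, k (increment s t j) := setLIntegral_le_lintegral _ _
    _ = (∫⁻ r, k r) ^ n := lintegral_prod_increment hkm n t
    _ < ⊤ := by
        rw [hk, lintegral_indicator measurableSet_Ioo]
        exact ENNReal.pow_lt_top (hD.integral_lt_top t ht)

theorem energy_lt_top (hh : Measurable h) (hB : HypothesisB h G) {n : ℕ} {s : Fin n → ℝ} {t : ℝ}
    (hs : s ∈ simplex n t) :
    ∫⁻ ξ : Fin n → Rd d,
      ∏ j, ‖fourierFun (G (increment s t j)) (∑ l ∈ Finset.Iic j, ξ l)‖ₑ ^ 2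
        ∂(Measure.pi fun _ => spectralMeasure h) < ⊤ :=
  (lintegral_energy_le hh s t).trans_lt
    (ENNReal.prod_lt_top fun j _ => hB _ (increment_mem_Ioo hs j).1)

end Energy


/-! ### The `L²` norm of the chaos kernels -/

section Kernels

variable {d : ℕ} {κ : Rd d → ℝ≥0∞} {h : Rd d → ℂ} {G : ℝ → 𝓢'(Rd d, ℂ)} {n : ℕ} {t : ℝ} {x : Rd d}

theorem enorm_prod_sq {𝕜 ι : Type*} [NormedField 𝕜] [Fintype ι] (f : ι → 𝕜) :
    ‖∏ j, f j‖ₑ ^ 2 = ∏ j, ‖f j‖ₑ ^ 2 := by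
  rw [Finset.prod_pow]
  simp_rw [← ofReal_norm, norm_prod]
  rw [ENNReal.ofReal_prod_of_nonneg fun _ _ => norm_nonneg _]

theorem enorm_chaosSymbol_sq (s : Fin n → ℝ) (ξ : Rnd n d) :
    ‖chaosSymbol G n s t x ξ‖ₑ ^ 2 =
      ∏ j, ‖fourierFun (G (increment s t j)) (∑ l ∈ Finset.Iic j, ξ l)‖ₑ ^ 2 := by
  have h1 : ∀ r : ℝ, ‖Complex.exp (-(Complex.I * r))‖ₑ = 1 := fun r => by
    rw [← ofReal_norm, show -(Complex.I * (r : ℂ)) = ((-r : ℝ) : ℂ) * Complex.I by push_cast; ring,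
      Complex.norm_exp_ofReal_mul_I, ENNReal.ofReal_one]
  rw [chaosSymbol, enorm_mul, h1, one_mul, enorm_prod_sq]
  refine Finset.prod_congr rfl fun j _ => ?_
  rw [← ofReal_norm, ← ofReal_norm, RCLike.norm_conj]

theorem lintegral_energy_eq (hh : Measurable h) (s : Fin n → ℝ) (x : Rd d) :
    ∫⁻ ξ : Fin n → Rd d,
      ∏ j, ‖fourierFun (G (increment s t j)) (∑ l ∈ Finset.Iic j, ξ l)‖ₑ ^ 2
        ∂(Measure.pi fun _ => spectralMeasure h) =
      ENNReal.ofReal (((2 * Real.pi) ^ Module.finrank ℝ (Rnd n d))⁻¹) *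
        ∫⁻ ξ : Rnd n d, ‖(∏ j, h (ξ j)) * chaosSymbol G n s t x ξ‖ₑ ^ 2 := by
  have hsf := sigmaFinite_spectralMeasure hh
  rw [spectralMeasure_eq_withDensity hh] at hsf ⊢
  have hw : Measurable fun ξ : Rd d =>
      ENNReal.ofReal (((2 * Real.pi) ^ d)⁻¹) * ‖h ξ‖ₑ ^ 2 := (hh.enorm.pow_const 2).const_mul _
  have hq : Measurable fun ξ : Fin n → Rd d =>
      ∏ j, ‖fourierFun (G (increment s t j)) (∑ l ∈ Finset.Iic j, ξ l)‖ₑ ^ 2 :=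
    Finset.measurable_fun_prod _ fun j _ => ((continuous_fourierFun _).measurable.comp
      (Finset.measurable_fun_sum _ fun l _ => measurable_pi_apply l)).enorm.pow_const 2
  have hp : Measurable fun ξ : Fin n → Rd d => ∏ j, ‖h (ξ j)‖ₑ ^ 2 :=
    Finset.measurable_fun_prod _ fun j _ => (hh.comp (measurable_pi_apply j)).enorm.pow_const 2
  have hwp : Measurable fun ξ : Fin n → Rd d =>
      ∏ j, (ENNReal.ofReal (((2 * Real.pi) ^ d)⁻¹) * ‖h (ξ j)‖ₑ ^ 2) :=
    Finset.measurable_fun_prod _ fun j _ => hw.comp (measurable_pi_apply j)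
  rw [pi_withDensity volume hw, lintegral_withDensity_eq_lintegral_mul _ hwp hq,
    ← (measurePreserving_toLp_Rnd n d).lintegral_comp_emb (measurableEmbedding_toLp_Rnd n d)]
  have hpq : Measurable fun ξ : Fin n → Rd d => (∏ j, ‖h (ξ j)‖ₑ ^ 2) *
      ∏ j, ‖fourierFun (G (increment s t j)) (∑ l ∈ Finset.Iic j, ξ l)‖ₑ ^ 2 := hp.mul hq
  have hc : ENNReal.ofReal (((2 * Real.pi) ^ Module.finrank ℝ (Rnd n d))⁻¹) =
      ENNReal.ofReal (((2 * Real.pi) ^ d)⁻¹) ^ n := by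
    rw [finrank_Rnd, mul_comm n d, pow_mul, ← inv_pow, ENNReal.ofReal_pow (by positivity)]
  rw [hc]
  generalize ENNReal.ofReal (((2 * Real.pi) ^ d)⁻¹) = c
  simp only [Pi.mul_apply, enorm_mul, mul_pow, enorm_prod_sq, enorm_chaosSymbol_sq,
    Finset.prod_mul_distrib, Finset.prod_const, Finset.card_univ, Fintype.card_fin, mul_assoc]
  rw [lintegral_const_mul _ hpq]
  rfl

/-- Finite energy at `s` says that `h^{⊗n}` times the symbol is square integrable; Plancherel then
applies, and its constant `(2π)^{-nd}` is the one contained in the product of the spectral measures.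
-/
theorem Represents.lintegral_sq_eq_energy (hκ : KernelAssumption κ h) (hB : HypothesisB h G)
    {s : Fin n → ℝ} (hs : s ∈ simplex n t) {u : Rnd n d → ℝ}
    (hu : Represents u (chaosConv κ G n s t x)) :
    ∫⁻ y, ‖u y‖ₑ ^ 2 = ∫⁻ ξ : Fin n → Rd d,
      ∏ j, ‖fourierFun (G (increment s t j)) (∑ l ∈ Finset.Iic j, ξ l)‖ₑ ^ 2
        ∂(Measure.pi fun _ => spectralMeasure h) := by
  have h0 := hκ.measurable_fourier
  have hE := energy_lt_top h0 hB hs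
  rw [lintegral_energy_eq h0 s x] at hE ⊢
  have hm : Measurable fun ξ : Rnd n d => (∏ j, h (ξ j)) * chaosSymbol G n s t x ξ :=
    (Finset.measurable_fun_prod _ fun j _ => h0.comp (by fun_prop)).mul
      (chaosSymbol_hasTemperateGrowth G n s t x).1.continuous.measurable
  refine Represents.lintegral_sq_eq ?_ ?_
  · refine ⟨hm.aestronglyMeasurable, ?_⟩
    rw [eLpNorm_lt_top_iff_lintegral_rpow_enorm_lt_top (by norm_num) (by norm_num)]
    simp only [ENNReal.toReal_ofNat, ENNReal.rpow_ofNat]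
    refine ENNReal.lt_top_of_mul_ne_top_right hE.ne ?_
    rw [ne_eq, ENNReal.ofReal_eq_zero, not_le]
    positivity
  · have : chaosConv κ G n s t x = fun φ => ∫ ξ, ((∏ j, h (ξ j)) * chaosSymbol G n s t x ξ) *
        fourierSInv φ ξ :=
      funext fun φ => hκ.convDist_distOfFourier (chaosSymbol_hasTemperateGrowth G n s t x) φ
    rwa [← this]

theorem IsConvVersion.ae_represents {g : (Fin n → ℝ) → Rnd n d → ℝ}
    (hg : IsConvVersion κ G n t x g) :
    ∀ᵐ s ∂(volume.restrict (simplex n t)), Represents (g s) (chaosConv κ G n s t x) := by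
  rcases hg.2 with h1 | h1
  · exact (ae_restrict_iff' (measurableSet_simplex n t)).2 (ae_of_all _ h1)
  · exact h1.mono fun s hs => hs.2

/-- `g` is measurable only over the simplex; extending it by zero gives a function to which Tonelli
applies on the whole product. -/
theorem IsConvVersion.measurable_indicator {g : (Fin n → ℝ) → Rnd n d → ℝ}
    (hg : IsConvVersion κ G n t x g) :
    Measurable ((simplex n t ×ˢ (Set.univ : Set (Rnd n d))).indicator (Function.uncurry g)) := by
  refine measurable_of_restrict_of_restrict_compl (s := simplex n t ×ˢ (Set.univ : Set (Rnd n d)))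
    ((measurableSet_simplex n t).prod .univ) ?_ ?_
  · have h1 : Measurable fun p : (simplex n t ×ˢ (Set.univ : Set (Rnd n d)) : Set _) =>
        ((⟨p.1.1, p.2.1⟩ : simplex n t), p.1.2) :=
      (measurable_subtype_coe.fst.subtype_mk).prodMk measurable_subtype_coe.snd
    convert hg.1.comp h1 using 1
    ext p
    exact Set.indicator_of_mem p.2 _
  · convert measurable_const (a := (0 : ℝ)) using 1
    ext p
    exact Set.indicator_of_notMem p.2 _

theorem indicator_simplex_apply {g : (Fin n → ℝ) → Rnd n d → ℝ} {s : Fin n → ℝ}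
    (hs : s ∈ simplex n t) (y : Rnd n d) :
    (simplex n t ×ˢ (Set.univ : Set (Rnd n d))).indicator (Function.uncurry g) (s, y) = g s y :=
  Set.indicator_of_mem (Set.mk_mem_prod hs (Set.mem_univ y)) _

theorem lintegral_sq_le {α : Type*} [MeasurableSpace α] (μ : Measure α) {f : α → ℝ≥0∞}
    (hf : AEMeasurable f μ) : (∫⁻ a, f a ∂μ) ^ 2 ≤ μ Set.univ * ∫⁻ a, f a ^ 2 ∂μ := by
  have h1 := ENNReal.lintegral_mul_le_Lp_mul_Lq μ Real.HolderConjugate.two_two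
    (aemeasurable_const (b := (1 : ℝ≥0∞))) hf
  have h2 : ∀ a : ℝ≥0∞, (a ^ (1 / 2 : ℝ)) ^ 2 = a := fun a => by
    rw [← ENNReal.rpow_natCast, ← ENNReal.rpow_mul]
    norm_num
  simp only [Pi.mul_apply, one_mul, lintegral_const, ENNReal.rpow_ofNat, one_pow] at h1
  calc (∫⁻ a, f a ∂μ) ^ 2 ≤ (μ Set.univ ^ (1 / 2 : ℝ) * (∫⁻ a, f a ^ 2 ∂μ) ^ (1 / 2 : ℝ)) ^ 2 := by
        gcongr
    _ = _ := by rw [mul_pow, h2, h2]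

/-- Cauchy–Schwarz in `s`, Tonelli, then the energy identity for almost every `s`. The absolute
value stays inside the time integral, so the same bound yields absolute convergence for almost every
`y`. -/
theorem IsConvVersion.lintegral_sq_lintegral_le (hκ : KernelAssumption κ h) (hB : HypothesisB h G)
    {g : (Fin n → ℝ) → Rnd n d → ℝ} (hg : IsConvVersion κ G n t x g) :
    ∫⁻ y, (∫⁻ s in simplex n t, ‖g s y‖ₑ) ^ 2 ≤ volume (simplex n t) * chaosEnergy h G n t := by
  set g' := (simplex n t ×ˢ (Set.univ : Set (Rnd n d))).indicator (Function.uncurry g) with hg'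
  have hm : Measurable g' := hg.measurable_indicator
  have hS := measurableSet_simplex n t
  have e1 : ∀ y, ∫⁻ s in simplex n t, ‖g s y‖ₑ = ∫⁻ s in simplex n t, ‖g' (s, y)‖ₑ := fun y =>
    setLIntegral_congr_fun hS fun s hs => by simp only [hg', indicator_simplex_apply hs]
  calc ∫⁻ y, (∫⁻ s in simplex n t, ‖g s y‖ₑ) ^ 2
      ≤ ∫⁻ y, volume (simplex n t) * ∫⁻ s in simplex n t, ‖g' (s, y)‖ₑ ^ 2 := by
        refine lintegral_mono fun y => ?_
        rw [e1]
        refine (lintegral_sq_le _ (hm.comp measurable_prodMk_right).enorm.aemeasurable).trans ?_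
        rw [Measure.restrict_apply_univ]
        rfl
    _ = volume (simplex n t) * ∫⁻ s in simplex n t, ∫⁻ y, ‖g' (s, y)‖ₑ ^ 2 := by
        have hm2 : Measurable fun p : Rnd n d × (Fin n → ℝ) => ‖g' (p.2, p.1)‖ₑ ^ 2 :=
          (hm.comp measurable_swap).enorm.pow_const 2
        rw [lintegral_const_mul _ hm2.lintegral_prod_right', lintegral_lintegral_swap]
        exact hm2.aemeasurable
    _ = volume (simplex n t) * chaosEnergy h G n t := by
        congr 1
        refine lintegral_congr_ae ?_
        filter_upwards [hg.ae_represents, ae_restrict_mem hS] with s h1 h2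
        rw [← h1.lintegral_sq_eq_energy hκ hB h2]
        simp only [hg', indicator_simplex_apply h2]

theorem IsConvVersion.measurable_integral {g : (Fin n → ℝ) → Rnd n d → ℝ}
    (hg : IsConvVersion κ G n t x g) : Measurable fun y => ∫ s in simplex n t, g s y := by
  have h1 := (hg.measurable_indicator.stronglyMeasurable.integral_prod_left'
    (μ := volume.restrict (simplex n t))).measurable
  convert h1 using 2 with y
  exact setIntegral_congr_fun (measurableSet_simplex n t)
    fun s hs => (indicator_simplex_apply hs y).symm

theorem IsConvVersion.ae_integrableOn (hκ : KernelAssumption κ h) (hB : HypothesisB h G)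
    (hE : chaosEnergy h G n t < ⊤) {g : (Fin n → ℝ) → Rnd n d → ℝ}
    (hg : IsConvVersion κ G n t x g) : ∀ᵐ y, IntegrableOn (fun s => g s y) (simplex n t) := by
  have h1 := (hg.lintegral_sq_lintegral_le hκ hB).trans_lt
    (ENNReal.mul_lt_top (volume_simplex_lt_top n t) hE)
  have hS := measurableSet_simplex n t
  have e1 : ∀ y, ∫⁻ s in simplex n t, ‖g s y‖ₑ = ∫⁻ s in simplex n t,
      ‖(simplex n t ×ˢ (Set.univ : Set (Rnd n d))).indicator (Function.uncurry g) (s, y)‖ₑ :=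
    fun y => setLIntegral_congr_fun hS fun s hs => by simp only [indicator_simplex_apply hs]
  have hm : Measurable fun y => (∫⁻ s in simplex n t, ‖g s y‖ₑ) ^ 2 := by
    simp_rw [e1]
    exact (hg.measurable_indicator.enorm.lintegral_prod_left').pow_const 2
  filter_upwards [ae_lt_top hm h1.ne] with y hy
  refine ⟨?_, ?_⟩
  · refine ((hg.measurable_indicator.comp
      (measurable_prodMk_right (y := y))).aestronglyMeasurable).congr ?_
    filter_upwards [ae_restrict_mem hS] with s hs
    exact indicator_simplex_apply hs y
  · exact (ENNReal.pow_lt_top_iff.1 hy).resolve_right (by norm_num)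

theorem lintegral_chaosKernel_sq {ν : Measure R0} (hν : secondMoment ν < ⊤)
    {g : (Fin n → ℝ) → Rnd n d → ℝ} (hg : IsConvVersion κ G n t x g) :
    ∫⁻ z, ‖chaosKernel n t g z‖ₑ ^ 2 ∂(intensityPow d ν n) =
      secondMoment ν ^ n * ∫⁻ y, ‖∫ s in simplex n t, g s y‖ₑ ^ 2 := by
  have := sigmaFinite_of_secondMoment hν
  have hA : Measurable fun y : Fin n → Rd d =>
      ‖∫ s in simplex n t, g s (WithLp.toLp 2 y)‖ₑ ^ 2 :=
    (hg.measurable_integral.comp (measurableEmbedding_toLp_Rnd n d).measurable).enorm.pow_const 2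
  have hz : Measurable fun z : R0 => ‖(z : ℝ)‖ₑ ^ 2 := measurable_subtype_coe.enorm.pow_const 2
  have hB : Measurable fun w : Fin n → R0 => ∏ j, ‖((w j : R0) : ℝ)‖ₑ ^ 2 :=
    Finset.measurable_fun_prod _ fun j _ => hz.comp (measurable_pi_apply j)
  have hmp := measurePreserving_arrowProdEquivProdArrow (Rd d) R0 (Fin n)
    (fun _ => (volume : Measure (Rd d))) (fun _ => ν)
  have e1 : ∫⁻ z, ‖chaosKernel n t g z‖ₑ ^ 2 ∂(intensityPow d ν n) =
      ∫⁻ z, (fun p : (Fin n → Rd d) × (Fin n → R0) =>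
        ‖∫ s in simplex n t, g s (WithLp.toLp 2 p.1)‖ₑ ^ 2 * ∏ j, ‖((p.2 j : R0) : ℝ)‖ₑ ^ 2)
        (MeasurableEquiv.arrowProdEquivProdArrow (Rd d) R0 (Fin n) z)
        ∂(Measure.pi fun _ => (volume : Measure (Rd d)).prod ν) := by
    refine lintegral_congr fun z => ?_
    rw [chaosKernel, enorm_mul, mul_pow, enorm_prod_sq, mul_comm]
    rfl
  have hAB : Measurable fun p : (Fin n → Rd d) × (Fin n → R0) =>
      ‖∫ s in simplex n t, g s (WithLp.toLp 2 p.1)‖ₑ ^ 2 * ∏ j, ‖((p.2 j : R0) : ℝ)‖ₑ ^ 2 :=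
    (hA.comp measurable_fst).mul (hB.comp measurable_snd)
  rw [e1, hmp.lintegral_comp hAB,
    lintegral_prod_mul hA.aemeasurable hB.aemeasurable,
    lintegral_fin_nat_prod_eq_prod (fun _ => ν) fun _ => hz, mul_comm, ← volume_pi,
    ← (measurePreserving_toLp_Rnd n d).lintegral_comp_emb (measurableEmbedding_toLp_Rnd n d)
      fun y => ‖∫ s in simplex n t, g s y‖ₑ ^ 2]
  simp [secondMoment]

theorem IsConvVersion.lintegral_chaosKernel_sq_le (hκ : KernelAssumption κ h)
    (hB : HypothesisB h G) {ν : Measure R0} (hν : secondMoment ν < ⊤)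
    {g : (Fin n → ℝ) → Rnd n d → ℝ} (hg : IsConvVersion κ G n t x g) :
    ∫⁻ z, ‖chaosKernel n t g z‖ₑ ^ 2 ∂(intensityPow d ν n) ≤
      secondMoment ν ^ n * ENNReal.ofReal t ^ n * chaosEnergy h G n t / (n.factorial : ℝ≥0∞) := by
  have hf0 : (n.factorial : ℝ≥0∞) ≠ 0 := by exact_mod_cast n.factorial_ne_zero
  have hft : (n.factorial : ℝ≥0∞) ≠ ⊤ := ENNReal.natCast_ne_top _
  rw [lintegral_chaosKernel_sq hν hg, ENNReal.le_div_iff_mul_le (.inl hf0) (.inl hft)]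
  calc secondMoment ν ^ n * (∫⁻ y, ‖∫ s in simplex n t, g s y‖ₑ ^ 2) * n.factorial
      ≤ secondMoment ν ^ n * (volume (simplex n t) * chaosEnergy h G n t) * n.factorial := by
        gcongr
        refine le_trans (lintegral_mono fun y => ?_) (hg.lintegral_sq_lintegral_le hκ hB)
        gcongr
        exact enorm_integral_le_lintegral_enorm _
    _ = secondMoment ν ^ n * (n.factorial * volume (simplex n t)) * chaosEnergy h G n t := by ring
    _ ≤ _ := by
        gcongr
        exact factorial_mul_volume_simplex_le n t

theorem IsConvVersion.memLp_chaosKernel (hκ : KernelAssumption κ h) (hB : HypothesisB h G)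
    (hE : chaosEnergy h G n t < ⊤) {ν : Measure R0} (hν : secondMoment ν < ⊤)
    {g : (Fin n → ℝ) → Rnd n d → ℝ} (hg : IsConvVersion κ G n t x g) :
    MemLp (chaosKernel n t g) 2 (intensityPow d ν n) := by
  refine ⟨Measurable.aestronglyMeasurable ?_, ?_⟩
  · refine Measurable.mul (Finset.measurable_fun_prod _ fun j _ =>
      measurable_subtype_coe.comp (measurable_pi_apply j).snd) (hg.measurable_integral.comp ?_)
    exact (measurableEmbedding_toLp_Rnd n d).measurable.comp
      (measurable_pi_lambda _ fun j => (measurable_pi_apply j).fst)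
  · rw [eLpNorm_lt_top_iff_lintegral_rpow_enorm_lt_top (by norm_num) (by norm_num)]
    simp only [ENNReal.toReal_ofNat, ENNReal.rpow_ofNat]
    refine (hg.lintegral_chaosKernel_sq_le hκ hB hν).trans_lt (ENNReal.div_lt_top ?_ ?_)
    · exact (ENNReal.mul_lt_top (ENNReal.mul_lt_top (ENNReal.pow_lt_top hν)
        (ENNReal.pow_lt_top ENNReal.ofReal_lt_top)) hE).ne
    · exact_mod_cast n.factorial_ne_zero

/-- Both versions represent the same functional for almost every `s`, hence agree for almost every
`y`. Joint measurability permits exchanging the two quantifiers, after which the time integrals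
coincide. -/
theorem IsConvVersion.chaosKernel_ae_eq {ν : Measure R0} (hν : secondMoment ν < ⊤)
    {g g' : (Fin n → ℝ) → Rnd n d → ℝ} (hg : IsConvVersion κ G n t x g)
    (hg' : IsConvVersion κ G n t x g') :
    chaosKernel n t g =ᵐ[intensityPow d ν n] chaosKernel n t g' := by
  have := sigmaFinite_of_secondMoment hν
  have hS := measurableSet_simplex n t
  have h1 : ∀ᵐ s ∂(volume.restrict (simplex n t)), ∀ᵐ y,
      (simplex n t ×ˢ (Set.univ : Set (Rnd n d))).indicator (Function.uncurry g) (s, y) =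
      (simplex n t ×ˢ (Set.univ : Set (Rnd n d))).indicator (Function.uncurry g') (s, y) := by
    filter_upwards [hg.ae_represents, hg'.ae_represents, ae_restrict_mem hS] with s h1 h2 h3
    filter_upwards [h1.ae_eq h2] with y hy
    rwa [indicator_simplex_apply h3, indicator_simplex_apply h3]
  have hms := measurableSet_eq_fun hg.measurable_indicator hg'.measurable_indicator
  have h2 : ∀ᵐ y : Rnd n d, ∫ s in simplex n t, g s y = ∫ s in simplex n t, g' s y := by
    have h3 := (Measure.ae_ae_comm hms).1 h1
    filter_upwards [h3] with y hy
    refine integral_congr_ae ?_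
    filter_upwards [hy, ae_restrict_mem hS] with s h4 h5
    rwa [indicator_simplex_apply h5, indicator_simplex_apply h5] at h4
  have hmp := (measurePreserving_toLp_Rnd n d).quasiMeasurePreserving.comp
    (Measure.quasiMeasurePreserving_fst.comp (measurePreserving_arrowProdEquivProdArrow (Rd d) R0
      (Fin n) (fun _ => (volume : Measure (Rd d))) (fun _ => ν)).quasiMeasurePreserving)
  filter_upwards [hmp.ae h2] with z hz
  rw [chaosKernel, chaosKernel]
  exact congrArg _ hz

end Kernels


/-! ### Convergence of chaos series -/

section ChaosSeries

variable {Ω Z : Type*} [MeasurableSpace Ω] [MeasurableSpace Z] {P : Measure Ω} {N : Ω → Measure Z}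
  {m : Measure Z}

theorem IsMultipleIntegral.norm_sq_le [SigmaFinite m] [IsProbabilityMeasure P]
    (hN : IsPoissonRandomMeasure P N m) {n : ℕ} {f : (Fin n → Z) → ℝ} {Y : Ω → ℝ}
    (hY : IsMultipleIntegral P N m n f Y) :
    ENNReal.ofReal (‖hY.2.1.toLp Y‖ ^ 2) ≤
      n.factorial * ∫⁻ z, ‖f z‖ₑ ^ 2 ∂(Measure.pi fun _ => m) := by
  have h1 := hY.norm_le hN
  have h2 : eLpNorm f 2 (Measure.pi fun _ => m) ^ 2 = ∫⁻ z, ‖f z‖ₑ ^ 2 ∂(Measure.pi fun _ => m) := by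
    have := eLpNorm_nnreal_pow_eq_lintegral (f := f) (μ := Measure.pi fun _ => m)
      (p := 2) (by norm_num)
    simpa using this
  have h3 : ‖hY.2.1.toLp Y‖ ^ 2 ≤ n.factorial * ‖hY.1.toLp f‖ ^ 2 := by
    calc ‖hY.2.1.toLp Y‖ ^ 2 ≤ (√n.factorial * ‖hY.1.toLp f‖) ^ 2 := by gcongr
      _ = _ := by rw [mul_pow, Real.sq_sqrt (by positivity)]
  refine (ENNReal.ofReal_le_ofReal h3).trans (le_of_eq ?_)
  rw [ENNReal.ofReal_mul (by positivity), ENNReal.ofReal_natCast,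
    ENNReal.ofReal_pow (norm_nonneg _), Lp.norm_toLp, ENNReal.ofReal_toReal hY.1.2.ne, h2]

/-- Orders are `n + 1`, as the constant chaos is left out. Integrals of different orders are
orthogonal, so summability of the squared norms is enough for convergence in `L²`. -/
theorem exists_tendsto_chaos_sum [SigmaFinite m] [IsProbabilityMeasure P]
    (hN : IsPoissonRandomMeasure P N m) {f : ∀ n, (Fin (n + 1) → Z) → ℝ} {I : ℕ → Ω → ℝ}
    (hI : ∀ n, IsMultipleIntegral P N m (n + 1) (f n) (I n))
    (hsum : ∑' n, ((n + 1).factorial : ℝ≥0∞) * ∫⁻ z, ‖f n z‖ₑ ^ 2 ∂(Measure.pi fun _ => m) ≠ ⊤) :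
    ∃ v : Ω → ℝ, MemLp v 2 P ∧
      Tendsto (fun M : ℕ => eLpNorm (fun ω => v ω - ∑ n ∈ Finset.range M, I n ω) 2 P)
        atTop (𝓝 0) := by
  set e : ℕ → Lp ℝ 2 P := fun n => (hI n).2.1.toLp (I n) with he
  -- Spans are used in place of normalized vectors because some `e n` may be zero.
  have horth : OrthogonalFamily ℝ (fun n => (Submodule.span ℝ {e n} : Submodule ℝ (Lp ℝ 2 P)))
      fun n => (Submodule.span ℝ {e n}).subtypeₗᵢ := by
    rintro i j hij ⟨v, hv⟩ ⟨w, hw⟩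
    obtain ⟨a, rfl⟩ := Submodule.mem_span_singleton.1 hv
    obtain ⟨b, rfl⟩ := Submodule.mem_span_singleton.1 hw
    have := IsMultipleIntegral.inner_eq_zero hN (by omega : i + 1 ≠ j + 1) (hI i) (hI j)
    simp only [Submodule.coe_subtypeₗᵢ, Submodule.subtype_apply, inner_smul_left,
      inner_smul_right, he, this, mul_zero]
  have hs : Summable fun n => ‖e n‖ ^ 2 := by
    have h1 : ∑' n, ENNReal.ofReal (‖e n‖ ^ 2) ≠ ⊤ :=
      ne_top_of_le_ne_top hsum (ENNReal.tsum_le_tsum fun n => (hI n).norm_sq_le hN)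
    exact (ENNReal.summable_toReal h1).congr fun n => ENNReal.toReal_ofReal (by positivity)
  have hse : Summable e := (horth.summable_iff_norm_sq_summable fun n =>
    (⟨e n, Submodule.mem_span_singleton_self _⟩ : Submodule.span ℝ {e n})).2 hs
  obtain ⟨v, hv⟩ := hse
  have hmem : ∀ M : ℕ, MemLp (fun ω => ∑ n ∈ Finset.range M, I n ω) 2 P := fun M =>
    memLp_finsetSum _ fun n _ => (hI n).2.1
  have hcoe : ∀ M : ℕ, (hmem M).toLp _ = ∑ n ∈ Finset.range M, e n := fun M => by
    induction M with
    | zero => simp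
    | succ M ih =>
      rw [Finset.sum_range_succ, ← ih, he, ← MemLp.toLp_add]
      refine MemLp.toLp_congr _ _ (ae_of_all _ fun ω => ?_)
      simp [Finset.sum_range_succ]
  refine ⟨v, Lp.memLp v, ?_⟩
  have h1 := hv.tendsto_sum_nat
  simp_rw [← hcoe] at h1
  have h2 := (Lp.tendsto_Lp_iff_tendsto_eLpNorm' _ _).1 h1
  refine h2.congr fun M => ?_
  rw [← eLpNorm_neg]
  refine eLpNorm_congr_ae ?_
  filter_upwards [(hmem M).coeFn_toLp] with ω hω
  simp [hω]

end ChaosSeries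

/-! ### Existence and uniqueness of the Skorohod solution -/

section Main

variable {Ω : Type*} [MeasurableSpace Ω] {P : Measure Ω} [IsProbabilityMeasure P] {d : ℕ}
  {ν : Measure R0} {N : Ω → Measure (ZSpace d)} {κ : Rd d → ℝ≥0∞} {h : Rd d → ℂ}
  {G : ℝ → 𝓢'(Rd d, ℂ)}

theorem sum_Icc_one_eq_sum_range (I : ℕ → ℝ) (M : ℕ) :
    ∑ n ∈ Finset.Icc 1 M, I n = ∑ n ∈ Finset.range M, I (n + 1) := by
  induction M with
  | zero => simp
  | succ M ih => rw [Finset.sum_Icc_succ_top (by omega), ih, Finset.sum_range_succ]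

theorem memLp_one_add_sum {I : ℕ → Ω → ℝ} {S : Finset ℕ} (hI : ∀ n ∈ S, MemLp (I n) 2 P) :
    MemLp (fun ω => 1 + ∑ n ∈ S, I n ω) 2 P :=
  MemLp.add (f := fun _ : Ω => (1 : ℝ)) (memLp_const 1) (memLp_finsetSum S hI)

theorem IsMultipleIntegral.ae_eq_of_intensity (hν : secondMoment ν < ⊤)
    (hN : IsPoissonRandomMeasure P N (intensity d ν)) {n : ℕ} {f f' : (Fin n → ZSpace d) → ℝ}
    {I I' : Ω → ℝ} (hI : IsMultipleIntegral P N (intensity d ν) n f I)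
    (hI' : IsMultipleIntegral P N (intensity d ν) n f' I') (hff' : f =ᵐ[intensityPow d ν n] f') :
    I =ᵐ[P] I' := by
  have := sigmaFinite_intensity d hν
  exact IsMultipleIntegral.ae_eq hN hI hI' hff'

theorem exists_isMultipleIntegral_of_intensity (hd : 1 ≤ d) (hν : secondMoment ν < ⊤)
    (hN : IsPoissonRandomMeasure P N (intensity d ν)) {n : ℕ} {f : (Fin n → ZSpace d) → ℝ}
    (hf : MemLp f 2 (intensityPow d ν n)) :
    ∃ I, IsMultipleIntegral P N (intensity d ν) n f I := by
  have := sigmaFinite_intensity d hν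
  have := nullSingletonClass_intensity hd hν
  exact IsMultipleIntegral.exists_of_memLp hN hf

/-- The two solutions may use different `g_n` and different versions of the integrals, but the
partial sums agree almost surely, and the triangle inequality compares the two limits. -/
theorem IsSkorohodSolution.ae_eq (hν : secondMoment ν < ⊤)
    (hN : IsPoissonRandomMeasure P N (intensity d ν)) {u u' : ℝ → Rd d → Ω → ℝ}
    (hu : IsSkorohodSolution P N ν κ G u) (hu' : IsSkorohodSolution P N ν κ G u') {t : ℝ}
    (ht : 0 ≤ t) (x : Rd d) : u' t x =ᵐ[P] u t x := by
  obtain ⟨hm, g, I, hI, hlim⟩ := hu t x ht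
  obtain ⟨hm', g', I', hI', hlim'⟩ := hu' t x ht
  have hII : ∀ n, 1 ≤ n → I' n =ᵐ[P] I n := fun n hn =>
    (hI' n hn).2.2.ae_eq_of_intensity hν hN (hI n hn).2.2
      ((hI' n hn).1.chaosKernel_ae_eq hν (hI n hn).1)
  have hI2 : ∀ n, 1 ≤ n → MemLp (I n) 2 P := fun n hn => by
    obtain ⟨-, -, -, h2, -⟩ := hI n hn
    exact h2
  have hmem : ∀ M : ℕ, MemLp (fun ω => 1 + ∑ n ∈ Finset.Icc 1 M, I n ω) 2 P := fun M =>
    memLp_one_add_sum fun n hn => hI2 n (Finset.mem_Icc.1 hn).1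
  have hsum : ∀ M : ℕ, (fun ω => 1 + ∑ n ∈ Finset.Icc 1 M, I' n ω) =ᵐ[P]
      fun ω => 1 + ∑ n ∈ Finset.Icc 1 M, I n ω := fun M => by
    have h1 : ∀ᵐ ω ∂P, ∀ n ∈ Finset.Icc 1 M, I' n ω = I n ω :=
      (Finset.eventually_all _).2 fun n hn => hII n (Finset.mem_Icc.1 hn).1
    filter_upwards [h1] with ω hω
    rw [Finset.sum_congr rfl hω]
  have hle : ∀ M : ℕ, eLpNorm (u' t x - u t x) 2 P ≤
      eLpNorm (fun ω => u' t x ω - (1 + ∑ n ∈ Finset.Icc 1 M, I' n ω)) 2 P +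
      eLpNorm (fun ω => u t x ω - (1 + ∑ n ∈ Finset.Icc 1 M, I n ω)) 2 P := fun M => by
    have h1 : eLpNorm (fun ω => u' t x ω - (1 + ∑ n ∈ Finset.Icc 1 M, I' n ω)) 2 P =
        eLpNorm (fun ω => u' t x ω - (1 + ∑ n ∈ Finset.Icc 1 M, I n ω)) 2 P := by
      refine eLpNorm_congr_ae ?_
      filter_upwards [hsum M] with ω hω
      rw [hω]
    rw [h1]
    refine (le_of_eq (congrArg (fun f => eLpNorm f 2 P) ?_)).trans
      (eLpNorm_sub_le (hm'.sub (hmem M)).1 (hm.sub (hmem M)).1 (by norm_num))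
    ext ω
    simp
  have h0 : eLpNorm (u' t x - u t x) 2 P = 0 := by
    have h1 := hlim'.add hlim
    rw [add_zero] at h1
    exact le_antisymm (ge_of_tendsto' h1 hle) zero_le
  have h1 := (eLpNorm_eq_zero_iff (hm'.sub hm).1 (by norm_num)).1 h0
  filter_upwards [h1] with ω hω
  simpa [sub_eq_zero] using hω

theorem tsum_factorial_mul_chaosKernel_ne_top (hν : secondMoment ν < ⊤)
    (hκ : KernelAssumption κ h) (hB : HypothesisB h G)
    (hsum : ∀ t : ℝ, 0 < t → ∑' n : ℕ, secondMoment ν ^ (n + 1) * ENNReal.ofReal t ^ (n + 1) *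
      chaosEnergy h G (n + 1) t < ⊤) {t : ℝ} (ht : 0 ≤ t) {x : Rd d}
    {g : ∀ n : ℕ, (Fin n → ℝ) → Rnd n d → ℝ}
    (hg : ∀ n, 1 ≤ n → IsConvVersion κ G n t x (g n)) :
    ∑' n : ℕ, ((n + 1).factorial : ℝ≥0∞) *
      ∫⁻ z, ‖chaosKernel (n + 1) t (g (n + 1)) z‖ₑ ^ 2 ∂(intensityPow d ν (n + 1)) ≠ ⊤ := by
  have h1 : ∑' n : ℕ, secondMoment ν ^ (n + 1) * ENNReal.ofReal t ^ (n + 1) *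
      chaosEnergy h G (n + 1) t ≠ ⊤ := by
    -- The summability hypothesis covers only `t > 0`; at `t = 0` every term carries a positive
    -- power of `0`.
    rcases ht.eq_or_lt with rfl | ht
    · simp
    · exact (hsum t ht).ne
  refine ne_top_of_le_ne_top h1 (ENNReal.tsum_le_tsum fun n => ?_)
  have h2 := (hg (n + 1) (by omega)).lintegral_chaosKernel_sq_le hκ hB hν
  rwa [ENNReal.le_div_iff_mul_le (.inl (by exact_mod_cast (n + 1).factorial_ne_zero))
    (.inl (ENNReal.natCast_ne_top _)), mul_comm] at h2

theorem exists_isSkorohodSolution (hd : 1 ≤ d) (hν : secondMoment ν < ⊤)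
    (hN : IsPoissonRandomMeasure P N (intensity d ν)) (hκ : KernelAssumption κ h)
    (hB : HypothesisB h G) (hD : HypothesisD h G) (hE : HypothesisE κ G)
    (hsum : ∀ t : ℝ, 0 < t → ∑' n : ℕ, secondMoment ν ^ (n + 1) * ENNReal.ofReal t ^ (n + 1) *
      chaosEnergy h G (n + 1) t < ⊤) :
    ∃ u : ℝ → Rd d → Ω → ℝ, IsSkorohodSolution P N ν κ G u := by
  have := sigmaFinite_intensity d hν
  have key : ∀ (t : ℝ) (x : Rd d), ∃ v : Ω → ℝ, 0 ≤ t → MemLp v 2 P ∧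
    ∃ (g : ∀ n : ℕ, (Fin n → ℝ) → Rnd n d → ℝ) (I : ℕ → Ω → ℝ),
      (∀ n, 1 ≤ n → IsConvVersion κ G n t x (g n) ∧
        MemLp (chaosKernel n t (g n)) 2 (intensityPow d ν n) ∧
        IsMultipleIntegral P N (intensity d ν) n (chaosKernel n t (g n)) (I n)) ∧
      Tendsto (fun M : ℕ =>
        eLpNorm (fun ω => v ω - (1 + ∑ n ∈ Finset.Icc 1 M, I n ω)) 2 P) atTop (𝓝 0) := by
    intro t x
    by_cases ht : 0 ≤ t
    swap
    -- For negative times nothing is required, and `0` is a filler; so it is for the kernel and the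
    -- integral of order `0` below.
    · exact ⟨0, fun h0 => absurd h0 ht⟩
    have hg : ∀ n : ℕ, ∃ g : (Fin n → ℝ) → Rnd n d → ℝ, 1 ≤ n → IsConvVersion κ G n t x g :=
      fun n => by
        by_cases hn : 1 ≤ n
        · exact (hE t x n ht hn).imp fun g hg _ => hg
        · exact ⟨0, fun h0 => absurd h0 hn⟩
    choose g hg using hg
    have hmem : ∀ n, 1 ≤ n → MemLp (chaosKernel n t (g n)) 2 (intensityPow d ν n) := fun n hn =>
      (hg n hn).memLp_chaosKernel hκ hB (chaosEnergy_lt_top hκ.measurable_fourier hD hn t) hν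
    have hI : ∀ n : ℕ, ∃ I : Ω → ℝ, 1 ≤ n →
        IsMultipleIntegral P N (intensity d ν) n (chaosKernel n t (g n)) I := fun n => by
      by_cases hn : 1 ≤ n
      · exact (exists_isMultipleIntegral_of_intensity hd hν hN (hmem n hn)).imp fun I hI _ => hI
      · exact ⟨0, fun h0 => absurd h0 hn⟩
    choose I hI using hI
    obtain ⟨v, hv, hlim⟩ := exists_tendsto_chaos_sum hN
      (f := fun n => chaosKernel (n + 1) t (g (n + 1))) (I := fun n => I (n + 1))
      (fun n => hI (n + 1) (by omega))
      (tsum_factorial_mul_chaosKernel_ne_top hν hκ hB hsum ht hg)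
    have hv1 : MemLp (fun ω => 1 + v ω) 2 P :=
      MemLp.add (f := fun _ : Ω => (1 : ℝ)) (memLp_const 1) hv
    refine ⟨fun ω => 1 + v ω, fun _ => ⟨hv1, g, I,
      fun n hn => ⟨hg n hn, hmem n hn, hI n hn⟩, ?_⟩⟩
    refine hlim.congr fun M => ?_
    congr 1
    ext ω
    rw [sum_Icc_one_eq_sum_range fun n => I n ω]
    ring
  choose u hu using key
  exact ⟨u, hu⟩

end Main

end LevySPDE

theorem mainTheorem8 {Ω : Type*} [MeasurableSpace Ω] (P : Measure Ω) [IsProbabilityMeasure P]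
    (d : ℕ) (hd : 1 ≤ d)
    (ν : Measure R0) (hν : secondMoment ν < ⊤)
    (N : Ω → Measure (ZSpace d)) (hN : IsPoissonRandomMeasure P N (intensity d ν))
    (κ : Rd d → ℝ≥0∞) (h : Rd d → ℂ) (hκ : KernelAssumption κ h)
    (G : ℝ → 𝓢'(Rd d, ℂ)) (hG : ∀ t, 0 < t → IsRealDist (G t))
    (hA : HypothesisA G) (hB : HypothesisB h G) (hD : HypothesisD h G) (hE : HypothesisE κ G) :
    (∀ (n : ℕ) (t : ℝ) (x : Rd d), 1 ≤ n → 0 ≤ t → ∀ g, IsConvVersion κ G n t x g →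
      (∀ᵐ y, IntegrableOn (fun s => g s y) (simplex n t)) ∧
      MemLp (chaosKernel n t g) 2 (intensityPow d ν n) ∧
      chaosEnergy h G n t < ⊤ ∧
      ∫⁻ z, ‖chaosKernel n t g z‖ₑ ^ 2 ∂(intensityPow d ν n) ≤
        secondMoment ν ^ n * ENNReal.ofReal t ^ n * chaosEnergy h G n t / (n.factorial : ℝ≥0∞)) ∧
    ((∀ t : ℝ, 0 < t →
        ∑' n : ℕ, secondMoment ν ^ (n + 1) * ENNReal.ofReal t ^ (n + 1) *
          chaosEnergy h G (n + 1) t < ⊤) →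
      ∃ u : ℝ → Rd d → Ω → ℝ, IsSkorohodSolution P N ν κ G u ∧
        ∀ u' : ℝ → Rd d → Ω → ℝ, IsSkorohodSolution P N ν κ G u' →
          ∀ (t : ℝ) (x : Rd d), 0 ≤ t → u' t x =ᵐ[P] u t x) := by
  refine ⟨fun n t x hn _ g hg => ?_, fun hsum => ?_⟩
  · have hJ := chaosEnergy_lt_top hκ.measurable_fourier hD hn t
    exact ⟨hg.ae_integrableOn hκ hB hJ, hg.memLp_chaosKernel hκ hB hJ hν, hJ,
      hg.lintegral_chaosKernel_sq_le hκ hB hν⟩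
  · obtain ⟨u, hu⟩ := exists_isSkorohodSolution hd hν hN hκ hB hD hE hsum
    exact ⟨u, hu, fun u' hu' t x ht => hu.ae_eq hν hN hu' ht x⟩
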